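/- **Setting.** Let $(X,\mathsf d)$ be a complete separable metric space and $\mathbf m$ a Borel measure on $X$ which is doubling: $0<\mathbf m(B_r(x))<\infty$ and $\mathbf m(B_{2r}(x))\le C\,\mathbf m(B_r(x))$ for all $x\in X$, $r>0$. Let $p_0>1$, with conjugate exponent $q_0$, and suppose that $(X,\mathsf d,\mathbf m)$ supports a weak local $(1,p_0)$-Poincaré inequality: there are $C_{PI}$ and $\lambda\ge1$ with $$\frac1{\mathbf m(B_r(x))}\int_{B_r(x)}|f-f_{B_r(x)}|\,d\mathbf m\le 2r\,C_{PI}\Big(\frac1{\mathbf m(B_{\lambda r}(x))}\int_{B_{\lambda r}(x)}|Df|^{p_0}d\mathbf m\Big)^{1/p_0}$$ for all $x\in X$, $r>0$ and Lipschitz $f:X\to\mathbb R$, where $|Df|$ is the local Lipschitz constant and $f_B$ the mean of $f$ over $B$. **Sobolev classes.** For $p>1$ with conjugate exponent $q$, a $q$-test plan is a Borel probability measure $\pi$ on $C([0,1],X)$, concentrated on $q$-absolutely continuous curves, with $\iint_0^1|\dot\gamma_t|^q\,dt\,d\pi(\gamma)<\infty$ and $(e_t)_\sharp\pi\le C\mathbf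 m$ for all $t$ and some $C$, where $e_t(\gamma)=\gamma_t$. A Borel function $G\ge0$ is a $p$-weak upper gradient of a Borel function $f$ if $\int|f(\gamma_1)-f(\gamma_0)|\,d\pi\le\iint_0^1G(\gamma_s)|\dot\gamma_s|\,ds\,d\pi$ for every $q$-test plan $\pi$. The function $f$ is in $S^p(X)$ (resp. $S^p_{loc}(X)$) if it has such a $G$ in $L^p(X)$ (resp. $L^p_{loc}(X)$); the a.e. minimal one is $|Df|_{w,p}$. For $\Omega\subset X$ open, $S^p_{loc}(\Omega)$ consists of the Borel $f:\Omega\to\mathbb R$ such that $\chi f\in S^p_{loc}(X)$ for every Lipschitz $\chi:X\to[0,1]$ with compact support in $\Omega$, and $|Df|_{w,p}:=|D(\chi f)|_{w,p}$ a.e. on $\{\chi=1\}$. For $p\ge p_0$ one has $S^p_{loc}(\Omega)\subset S^{p_0}_{loc}(\Omega)$, and we write $|Df|_w:=|Df|_{w,p_0}$. **Differentials and divergence.** For $p\ge p_0$ and $f,g\in S^p_{loc}(\Omega)$ set, on $\{|Dg|_w\ne0\}$, $$D^+f(\nabla g)=\liminf_{\varepsilon\downarrow0}\frac{|D(g+\varepsilon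 f)|_w^p-|Dg|_w^p}{p\,\varepsilon\,|Dg|_w^{p-2}},\qquad D^-f(\nabla g)=\limsup_{\varepsilon\uparrow0}\frac{|D(g+\varepsilon f)|_w^p-|Dg|_w^p}{p\,\varepsilon\,|Dg|_w^{p-2}}$$ (the limits being taken along rational $\varepsilon$), and $D^\pm f(\nabla g)=0$ on $\{|Dg|_w=0\}$. The space is $q_0$-infinitesimally strictly convex if $\int D^+f(\nabla g)|Dg|_w^{p_0-2}d\mathbf m=\int D^-f(\nabla g)|Dg|_w^{p_0-2}d\mathbf m$ for all $f,g\in S^{p_0}(X)$. By a Radon measure on an open set $\Omega$ we mean a signed one: a difference of two mutually singular non-negative Borel measures on $\Omega$, each finite on compact subsets of $\Omega$. For $p\ge p_0$ with conjugate exponent $q$, $g\in S^p_{loc}(\Omega)$ and $h\in L^q_{loc}(\Omega)$, let $\mathbf{div}(h\nabla g)|_\Omega$ be the set of Radon measures $\mu$ on $\Omega$ such that $$-\int_\Omega D^{\mathrm{sign}(h)}f(\nabla g)\,h\,d\mathbf m\le\int f\,d\mu\le-\int_\Omega D^{-\mathrm{sign}(h)}f(\nabla g)\,h\,d\mathbf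 m$$ for every Lipschitz $f:X\to\mathbb R$ with compact support contained in $\Omega$; write $h\nabla g\in D(\mathbf{div},\Omega)$ if this set is non-empty. **Proposition (local to global).** Assume moreover that $(X,\mathsf d,\mathbf m)$ is $q_0$-infinitesimally strictly convex. Let $\{\Omega_i\}_{i\in I}$ be a family of open subsets of $X$ and $\Omega=\bigcup_i\Omega_i$. Let $p\ge p_0$ with conjugate exponent $q$, $g\in S^p_{loc}(\Omega)$ and $h\in L^q_{loc}(\Omega)$, and suppose that $h\nabla g\in D(\mathbf{div},\Omega_i)$ for every $i\in I$. Then for each $i$ the set $\mathbf{div}(h\nabla g)|_{\Omega_i}$ has exactly one element $\mu_i$, and $$\mu_i|_{\Omega_i\cap\Omega_j}=\mu_j|_{\Omega_i\cap\Omega_j}\qquad\forall i,j\in I.$$ Moreover $h\nabla g\in D(\mathbf{div},\Omega)$, there is exactly one Radon measure $\mu$ on $\Omega$ with $\mu|_{\Omega_i}=\mu_i$ for every $i\in I$, and $\mu$ is the only element of $\mathbf{div}(h\nabla g)|_\Omega$. -/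

import Mathlib

open MeasureTheory Filter Topology TopologicalSpace Set
open scoped NNReal ENNReal unitInterval

noncomputable section

namespace MetricDivergence

/-! ## Metric measure spaces, doubling and Poincaré -/

/-- A Borel measure is doubling if all balls have positive finite mass and
`m (B (x, 2r)) ≤ C m (B (x, r))` for all `x` and all `r > 0`. -/
structure IsDoubling {X : Type*} [MetricSpace X] [MeasurableSpace X] (m : Measure X) : Prop where
  ball_pos : ∀ (x : X) (r : ℝ), 0 < r → 0 < m (Metric.ball x r)
  ball_lt_top : ∀ (x : X) (r : ℝ), m (Metric.ball x r) < ∞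
  doubling : ∃ C : ℝ≥0, ∀ (x : X) (r : ℝ), 0 < r →
    m (Metric.ball x (2 * r)) ≤ C * m (Metric.ball x r)

/-- The local Lipschitz constant `limsup_{y → x} |f y - f x| / d(x, y)`; it is `0` at isolated
points, where the punctured neighbourhood filter is trivial. -/
def localLip {X : Type*} [MetricSpace X] (f : X → ℝ) (x : X) : ℝ≥0∞ :=
  limsup (fun y => edist (f y) (f x) / edist y x) (𝓝[≠] x)

/-- The weak local `(1, p₀)`-Poincaré inequality, tested on Lipschitz functions. -/
def SupportsPoincare {X : Type*} [MetricSpace X] [MeasurableSpace X] (m : Measure X)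
    (p₀ : ℝ) : Prop :=
  ∃ (C : ℝ≥0) (lam : ℝ), 1 ≤ lam ∧ ∀ (x : X) (r : ℝ), 0 < r →
    ∀ f : X → ℝ, (∃ K : ℝ≥0, LipschitzWith K f) →
      (m (Metric.ball x r))⁻¹ *
          ∫⁻ y in Metric.ball x r, ‖f y - ⨍ z in Metric.ball x r, f z ∂m‖ₑ ∂m ≤
        C * ENNReal.ofReal (2 * r) *
          ((m (Metric.ball x (lam * r)))⁻¹ *
            ∫⁻ y in Metric.ball x (lam * r), (localLip f y) ^ p₀ ∂m) ^ (1 / p₀)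

/-! ## Curves and test plans -/

/-- The space of continuous curves `C([0,1], X)` carries the Borel σ-algebra of the topology of
uniform convergence. -/
instance curveMeasurableSpace {X : Type*} [TopologicalSpace X] : MeasurableSpace C(I, X) :=
  borel _

instance curveBorelSpace {X : Type*} [TopologicalSpace X] : BorelSpace C(I, X) := ⟨rfl⟩

/-- `γ ∈ AC^q([0,1], X)`. -/
def IsAC {X : Type*} [MetricSpace X] (q : ℝ) (γ : C(I, X)) : Prop :=
  ∃ φ : I → ℝ, MemLp φ (ENNReal.ofReal q) volume ∧
    ∀ s t : I, s < t → dist (γ t) (γ s) ≤ ∫ r in Ioc s t, φ r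

/-- The metric speed of a curve. It is written as a limsup, which is defined for all curves and all
times and equals the limit `lim_{s → t} d(γ s, γ t) / |s - t|` whenever that limit exists. -/
def metricSpeed {X : Type*} [MetricSpace X] (γ : C(I, X)) (t : I) : ℝ≥0∞ :=
  limsup (fun s => edist (γ s) (γ t) / edist s t) (𝓝[≠] t)

/-- `q`-test plans. -/
structure IsTestPlan {X : Type*} [MetricSpace X] [MeasurableSpace X] (m : Measure X) (q : ℝ)
    (π : Measure C(I, X)) : Prop where
  isProbabilityMeasure : IsProbabilityMeasure π
  boundedCompression : ∃ C : ℝ≥0, ∀ t : I, π.map (fun γ => γ t) ≤ C • m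
  ae_isAC : ∀ᵐ γ ∂π, IsAC q γ
  finite_energy : ∫⁻ γ, (∫⁻ t : I, (metricSpeed γ t) ^ q) ∂π < ∞

/-! ## Sobolev classes -/

/-- `u ∈ L^p_loc(Ω, m)`: `u` is `p`-integrable on every compact subset of `Ω`. -/
def MemLpLoc {X : Type*} [MetricSpace X] [MeasurableSpace X] (m : Measure X) (p : ℝ)
    (Ω : Opens X) (u : X → ℝ) : Prop :=
  ∀ K : Set X, IsCompact K → K ⊆ Ω → MemLp u (ENNReal.ofReal p) (m.restrict K)

/-- The inequality defining (non-negative, Borel) `p`-weak upper gradients `G` of `f`, tested on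
all `q`-test plans, where `q` is the exponent conjugate to `p`. -/
structure IsWeakUpperGradient {X : Type*} [MetricSpace X] [MeasurableSpace X] (m : Measure X)
    (p : ℝ) (f G : X → ℝ) : Prop where
  measurable : Measurable G
  nonneg : ∀ x, 0 ≤ G x
  le : ∀ π : Measure C(I, X), IsTestPlan m (Real.conjExponent p) π →
    ∫⁻ γ, ‖f (γ 1) - f (γ 0)‖ₑ ∂π ≤
      ∫⁻ γ, (∫⁻ s : I, ENNReal.ofReal (G (γ s)) * metricSpeed γ s) ∂π

/-- The Sobolev class `S^p(X, d, m)`. -/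
def MemSobolev {X : Type*} [MetricSpace X] [MeasurableSpace X] (m : Measure X) (p : ℝ)
    (f : X → ℝ) : Prop :=
  Measurable f ∧ ∃ G, IsWeakUpperGradient m p f G ∧ MemLp G (ENNReal.ofReal p) m

/-- The Sobolev class `S^p_loc(X, d, m)`. -/
def MemSobolevLoc {X : Type*} [MetricSpace X] [MeasurableSpace X] (m : Measure X) (p : ℝ)
    (f : X → ℝ) : Prop :=
  Measurable f ∧ ∃ G, IsWeakUpperGradient m p f G ∧ MemLpLoc m p ⊤ G

/-- `G` is the minimal `p`-weak upper gradient of `f` in `L^p_loc(X, m)`; it is unique up to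
`m`-null sets. -/
structure IsMinimalGradient {X : Type*} [MetricSpace X] [MeasurableSpace X] (m : Measure X)
    (p : ℝ) (f G : X → ℝ) : Prop where
  weakUpperGradient : IsWeakUpperGradient m p f G
  memLpLoc : MemLpLoc m p ⊤ G
  minimal : ∀ G', IsWeakUpperGradient m p f G' → MemLpLoc m p ⊤ G' → G ≤ᵐ[m] G'

open Classical in
/-- (A Borel representative of) the minimal `p`-weak upper gradient `|Df|_{w,p}` of
`f ∈ S^p_loc(X, d, m)`. -/
def minGradient {X : Type*} [MetricSpace X] [MeasurableSpace X] (m : Measure X) (p : ℝ)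
    (f : X → ℝ) : X → ℝ :=
  if h : ∃ G, IsMinimalGradient m p f G then h.choose else 0

/-- Lipschitz cut-off functions `χ : X → [0,1]` with compact support contained in `Ω`. -/
structure IsCutoff {X : Type*} [MetricSpace X] (Ω : Opens X) (χ : X → ℝ) : Prop where
  lipschitz : ∃ K : ℝ≥0, LipschitzWith K χ
  mem_Icc : ∀ x, χ x ∈ Icc (0 : ℝ) 1
  hasCompactSupport : HasCompactSupport χ
  tsupport_subset : tsupport χ ⊆ Ω

/-- The Sobolev class `S^p_loc(Ω)`. A function on `Ω` is represented by any function on `X` that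
extends it; only the values on `Ω` matter, since cut-off functions vanish outside `Ω`. -/
def MemSobolevLocOn {X : Type*} [MetricSpace X] [MeasurableSpace X] (m : Measure X) (p : ℝ)
    (Ω : Opens X) (f : X → ℝ) : Prop :=
  Measurable (fun x : Ω => f x) ∧
    ∀ χ : X → ℝ, IsCutoff Ω χ → MemSobolevLoc m p (fun x => χ x * f x)

/-- `G` is the minimal weak upper gradient of `f` on `Ω`: it equals `|D(χ f)|_{w,p}` almost
everywhere on `{χ = 1}`, for every cut-off function `χ`. It is unique up to null sets of `Ω`. -/
def IsMinimalGradientOn {X : Type*} [MetricSpace X] [MeasurableSpace X] (m : Measure X) (p : ℝ)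
    (Ω : Opens X) (f G : X → ℝ) : Prop :=
  Measurable G ∧ ∀ χ : X → ℝ, IsCutoff Ω χ →
    ∀ᵐ x ∂m, χ x = 1 → G x = minGradient m p (fun y => χ y * f y) x

open Classical in
/-- (A Borel representative of) `|Df|_{w,p}` on `Ω`, for `f ∈ S^p_loc(Ω)`. -/
def minGradientOn {X : Type*} [MetricSpace X] [MeasurableSpace X] (m : Measure X) (p : ℝ)
    (Ω : Opens X) (f : X → ℝ) : X → ℝ :=
  if h : ∃ G, IsMinimalGradientOn m p Ω f G then h.choose else 0

/-! ## The functions `D⁺f(∇g)` and `D⁻f(∇g)` -/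

/-- `D⁺f(∇g)`, computed with exponent `p` from the operation `N : u ↦ |Du|_w`. As each `|Du|_w` is
defined only up to null sets, the limit `ε ↓ 0` is taken over the countably many rational `ε`; by
convexity of `ε ↦ |D(g + ε f)|_w` it is almost everywhere a limit and an infimum, and is the same
along any sequence `ε ↓ 0`. -/
def diffPlus {X : Type*} (N : (X → ℝ) → X → ℝ) (p : ℝ) (f g : X → ℝ) (x : X) : ℝ :=
  if N g x = 0 then 0 else
    liminf (fun ε : ℚ => ((N (fun y => g y + (ε : ℝ) * f y) x) ^ p - (N g x) ^ p) /
      (p * (ε : ℝ) * (N g x) ^ (p - 2))) (𝓝[>] (0 : ℚ))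

/-- `D⁻f(∇g)`, computed with exponent `p` from the operation `N : u ↦ |Du|_w`. -/
def diffMinus {X : Type*} (N : (X → ℝ) → X → ℝ) (p : ℝ) (f g : X → ℝ) (x : X) : ℝ :=
  if N g x = 0 then 0 else
    limsup (fun ε : ℚ => ((N (fun y => g y + (ε : ℝ) * f y) x) ^ p - (N g x) ^ p) /
      (p * (ε : ℝ) * (N g x) ^ (p - 2))) (𝓝[<] (0 : ℚ))

/-- `q₀`-infinitesimal strict convexity, stated through the exponent `p₀` conjugate to `q₀`:
`∫ D⁺f(∇g) |Dg|_w^{p₀-2} dm = ∫ D⁻f(∇g) |Dg|_w^{p₀-2} dm` for all `f, g ∈ S^{p₀}(X, d, m)`. -/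
def IsInfStrictlyConvex {X : Type*} [MetricSpace X] [MeasurableSpace X] (m : Measure X)
    (p₀ : ℝ) : Prop :=
  ∀ f g : X → ℝ, MemSobolev m p₀ f → MemSobolev m p₀ g →
    ∫ x, diffPlus (minGradient m p₀) p₀ f g x * (minGradient m p₀ g x) ^ (p₀ - 2) ∂m =
      ∫ x, diffMinus (minGradient m p₀) p₀ f g x * (minGradient m p₀ g x) ^ (p₀ - 2) ∂m

/-! ## Radon measures on open sets -/

/-- A (signed) Radon measure on the open set `Ω` of a space in which closed balls are compact: a
difference of two mutually singular Borel measures on `Ω` (realised as measures on `X` giving no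
mass to the complement of `Ω`) that are finite on the compact subsets of `Ω`. The total positive and
negative masses may both be infinite. By uniqueness of the Jordan decomposition, equality of two
such objects is equality of signed Radon measures. -/
@[ext]
structure SignedRadon {X : Type*} [MetricSpace X] [MeasurableSpace X] (Ω : Opens X) where
  pos : Measure X
  neg : Measure X
  mutuallySingular : pos ⟂ₘ neg
  pos_compl : pos (Ω : Set X)ᶜ = 0
  neg_compl : neg (Ω : Set X)ᶜ = 0
  pos_lt_top : ∀ K : Set X, IsCompact K → K ⊆ Ω → pos K < ∞
  neg_lt_top : ∀ K : Set X, IsCompact K → K ⊆ Ω → neg K < ∞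

namespace SignedRadon

variable {X : Type*} [MetricSpace X] [MeasurableSpace X] {Ω : Opens X}

/-- The integral `∫ f dμ = ∫ f dμ⁺ - ∫ f dμ⁻`, for `f` integrable with respect to both. -/
def integral (μ : SignedRadon Ω) (f : X → ℝ) : ℝ :=
  (∫ x, f x ∂μ.pos) - ∫ x, f x ∂μ.neg

/-- The restriction of a signed Radon measure to a smaller open set. -/
def restrict [OpensMeasurableSpace X] (μ : SignedRadon Ω) (U : Opens X) (hU : U ≤ Ω) :
    SignedRadon U where
  pos := μ.pos.restrict U
  neg := μ.neg.restrict U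
  mutuallySingular := μ.mutuallySingular.mono Measure.restrict_le_self Measure.restrict_le_self
  pos_compl := by
    rw [Measure.restrict_apply U.isOpen.measurableSet.compl]; simp
  neg_compl := by
    rw [Measure.restrict_apply U.isOpen.measurableSet.compl]; simp
  pos_lt_top := fun K hK hKU =>
    (Measure.restrict_le_self K).trans_lt (μ.pos_lt_top K hK (hKU.trans hU))
  neg_lt_top := fun K hK hKU =>
    (Measure.restrict_le_self K).trans_lt (μ.neg_lt_top K hK (hKU.trans hU))

end SignedRadon

/-! ## The divergence -/

/-- Test functions: Lipschitz functions on `X` with compact support contained in `Ω`. -/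
structure IsTest {X : Type*} [MetricSpace X] (Ω : Opens X) (f : X → ℝ) : Prop where
  lipschitz : ∃ K : ℝ≥0, LipschitzWith K f
  hasCompactSupport : HasCompactSupport f
  tsupport_subset : tsupport f ⊆ Ω

/-- The product `D^{sign h}f(∇g) h` on `Ω`; where `h = 0` it is `0`. -/
def signPlus {X : Type*} [MetricSpace X] [MeasurableSpace X] (m : Measure X) (p₀ p : ℝ)
    (Ω : Opens X) (h g f : X → ℝ) (x : X) : ℝ :=
  if 0 < h x then diffPlus (minGradientOn m p₀ Ω) p f g x * h x
  else diffMinus (minGradientOn m p₀ Ω) p f g x * h x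

/-- The product `D^{-sign h}f(∇g) h` on `Ω`; where `h = 0` it is `0`. -/
def signMinus {X : Type*} [MetricSpace X] [MeasurableSpace X] (m : Measure X) (p₀ p : ℝ)
    (Ω : Opens X) (h g f : X → ℝ) (x : X) : ℝ :=
  if 0 < h x then diffMinus (minGradientOn m p₀ Ω) p f g x * h x
  else diffPlus (minGradientOn m p₀ Ω) p f g x * h x

/-- The set of Radon measures `div(h∇g)` on `Ω`, for `g ∈ S^p_loc(Ω)`, `h ∈ L^q_loc(Ω)`,
`p ≥ p₀`, on a space supporting a `p₀`-Poincaré inequality. On such a space the minimal weak upper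
gradient does not depend on the exponent in `[p₀, ∞)`, and `|D · |_w` is the one of exponent `p₀`,
the exponent for which it is defined on all functions that occur. -/
def divergence {X : Type*} [MetricSpace X] [MeasurableSpace X] (m : Measure X) (p₀ p : ℝ)
    (Ω : Opens X) (h g : X → ℝ) : Set (SignedRadon Ω) :=
  {μ | ∀ f : X → ℝ, IsTest Ω f →
    -(∫ x in (Ω : Set X), signPlus m p₀ p Ω h g f x ∂m) ≤ μ.integral f ∧
      μ.integral f ≤ -(∫ x in (Ω : Set X), signMinus m p₀ p Ω h g f x ∂m)}

/-- `h∇g ∈ D(div, Ω)`. -/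
def InDomainDiv {X : Type*} [MetricSpace X] [MeasurableSpace X] (m : Measure X) (p₀ p : ℝ)
    (Ω : Opens X) (h g : X → ℝ) : Prop :=
  (divergence m p₀ p Ω h g).Nonempty

end MetricDivergence

end

open MetricDivergence

open MeasureTheory Filter Topology TopologicalSpace Set
open scoped NNReal ENNReal unitInterval

set_option linter.unusedSectionVars false

noncomputable section

namespace MetricDivergence

/-! ## Absolutely continuous functions of one variable -/

/-! The two inequalities defining the divergence bracket `∫ f dμ` between integrals of `D⁺f(∇g) h`
and `D⁻f(∇g) h`. Strict convexity makes the two differentials agree a.e., so membership becomes the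
equation `∫ f dμ = -∫ Df(∇g) h dm` for all test functions (`mem_divergence_iff`). The right side is
local in `Ω` (`divFunctional_restrict`) and additive in `f` (`divFunctional_add`): convexity of `ε ↦
|D(g + εf)|` makes `D⁺` subadditive and `D⁻` superadditive, and the two coincide.

The rest is sheaf theory. Lipschitz test functions determine a signed Radon measure
(`SignedRadon.ext_of_integral`), so divergences are unique. Restrictions of divergences are
divergences, so the `μ i` agree on overlaps and can be glued along a countable subcover
(`SignedRadon.exists_glue`). The glued measure is a divergence on `Ω`: the compact support of a test
function meets a finite subcover, and cut-offs split the function into pieces, each supported in one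
member (`mem_divergence_of_forall_restrict`).

Strict convexity is assumed only for globally Sobolev functions, so it must be localised by
multiplying with cut-offs. This rests on strong locality: `|Df| = |Df'|` a.e. on `{f = f'}`
(`minGradient_eq_of_eq`). Along almost every curve a Sobolev function agrees a.e. with an absolutely
continuous function whose derivative is bounded by the gradient times the speed, and two such
functions have equal derivatives a.e. where they coincide (`IncrementBound.enorm_sub_le`).
Compactness arguments use that a complete doubling space is proper (`IsDoubling.properSpace`). -/

lemma exists_lipschitz_factor {S : Set ℝ} {A u : ℝ → ℝ}
    (h : ∀ s ∈ S, ∀ t ∈ S, |u t - u s| ≤ |A t - A s|) :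
    ∃ v : ℝ → ℝ, LipschitzWith 1 v ∧ ∀ s ∈ S, v (A s) = u s := by
  have key : ∀ s ∈ S, u (Function.invFunOn A S (A s)) = u s := by
    intro s hs
    have h1 := Function.invFunOn_mem (f := A) (s := S) ⟨s, hs, rfl⟩
    have h2 := Function.invFunOn_eq (f := A) (s := S) ⟨s, hs, rfl⟩
    have := h s hs _ h1
    rw [h2, sub_self, abs_zero] at this
    have := abs_nonpos_iff.1 this
    linarith
  have hl : LipschitzOnWith 1 (fun y => u (Function.invFunOn A S y)) (A '' S) := by
    refine LipschitzOnWith.of_dist_le_mul ?_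
    rintro _ ⟨s, hs, rfl⟩ _ ⟨t, ht, rfl⟩
    simp only [key s hs, key t ht, NNReal.coe_one, one_mul, Real.dist_eq]
    exact h t ht s hs
  obtain ⟨v, hv, hv'⟩ := hl.extend_real
  exact ⟨v, hv, fun s hs => by rw [← hv' ⟨s, hs, rfl⟩]; exact key s hs⟩

lemma absolutelyContinuous_of_dist_le {F A : ℝ → ℝ} {a b : ℝ}
    (hA : AbsolutelyContinuousOnInterval A a b) (h : ∀ s t, dist (F s) (F t) ≤ dist (A s) (A t)) :
    AbsolutelyContinuousOnInterval F a b := by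
  refine squeeze_zero (fun E => Finset.sum_nonneg fun _ _ => dist_nonneg) ?_ hA
  exact fun E => Finset.sum_le_sum fun i _ => h _ _

lemma abs_deriv_le_of_dist_le {F A : ℝ → ℝ} {x d e : ℝ} (hF : HasDerivAt F d x)
    (hA : HasDerivAt A e x) (h : ∀ s t, dist (F s) (F t) ≤ dist (A s) (A t)) : |d| ≤ |e| := by
  have h1 := (hasDerivAt_iff_tendsto_slope.1 hF).abs
  have h2 := (hasDerivAt_iff_tendsto_slope.1 hA).abs
  refine le_of_tendsto_of_tendsto' h1 h2 fun y => ?_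
  rw [slope_def_field, slope_def_field, abs_div, abs_div]
  exact div_le_div_of_nonneg_right (by simpa [Real.dist_eq] using h y x) (abs_nonneg _)

/-- A function whose increments on `S` are controlled by the integrals of `a` is the restriction
to `S` of an absolutely continuous function, whose derivative is bounded by `a`. -/
lemma exists_absolutelyContinuous_extension {a : ℝ → ℝ} (ha0 : ∀ x, 0 ≤ a x)
    (ha : IntervalIntegrable a volume 0 1) {S : Set ℝ} (hS : S ⊆ Icc 0 1) {u : ℝ → ℝ}
    (hu : ∀ s ∈ S, ∀ t ∈ S, s < t → |u t - u s| ≤ ∫ r in s..t, a r) :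
    ∃ F : ℝ → ℝ, AbsolutelyContinuousOnInterval F 0 1 ∧ EqOn F u S ∧
      ∀ᵐ x, x ∈ Icc (0 : ℝ) 1 → ∃ d, HasDerivAt F d x ∧ |d| ≤ a x := by
  set A : ℝ → ℝ := fun t => ∫ r in (0 : ℝ)..t, a r with hAdef
  have hI : ∀ t ∈ Icc (0 : ℝ) 1, IntervalIntegrable a volume 0 t := fun t ht =>
    ha.mono_set (by rw [uIcc_of_le ht.1, uIcc_of_le zero_le_one]; exact Icc_subset_Icc_right ht.2)
  have hAsub : ∀ s ∈ Icc (0 : ℝ) 1, ∀ t ∈ Icc (0 : ℝ) 1, A t - A s = ∫ r in s..t, a r :=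
    fun s hs t ht => intervalIntegral.integral_interval_sub_left (hI t ht) (hI s hs)
  have hlt : ∀ s ∈ S, ∀ t ∈ S, s < t → |u t - u s| ≤ |A t - A s| := fun s hs t ht hst => by
    rw [hAsub s (hS hs) t (hS ht)]
    exact (hu s hs t ht hst).trans (le_abs_self _)
  -- Since `u` varies less than the primitive `A` of `a`, it factors on `S` as `v ∘ A` with `v`
  -- 1-Lipschitz on all of `ℝ`. Then `F = v ∘ A` inherits absolute continuity from `A`, and `|F'| ≤
  -- |A'| = a` a.e.
  obtain ⟨v, hv, hvu⟩ := exists_lipschitz_factor (S := S) (A := A) (u := u) (by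
    intro s hs t ht
    rcases lt_trichotomy s t with h | h | h
    · exact hlt s hs t ht h
    · simp [h]
    · rw [abs_sub_comm, abs_sub_comm (A t)]; exact hlt t ht s hs h)
  have hd : ∀ s t, dist (v (A s)) (v (A t)) ≤ dist (A s) (A t) := fun s t => by
    simpa using hv.dist_le_mul (A s) (A t)
  have hAac : AbsolutelyContinuousOnInterval A 0 1 :=
    ha.absolutelyContinuousOnInterval_intervalIntegral (by simp)
  have hFac := absolutelyContinuous_of_dist_le (F := fun x => v (A x)) hAac hd
  refine ⟨fun x => v (A x), hFac, fun s hs => hvu s hs, ?_⟩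
  filter_upwards [hFac.ae_differentiableAt, ha.ae_hasDerivAt_integral] with x h1 h2 hx
  rw [uIcc_of_le zero_le_one] at h1 h2
  refine ⟨_, (h1 hx).hasDerivAt, ?_⟩
  have := abs_deriv_le_of_dist_le (h1 hx).hasDerivAt
    (h2 hx 0 (by simp)) hd
  rwa [abs_of_nonneg (ha0 x)] at this

/-- At almost every zero of a function, its derivative vanishes if it exists. -/
lemma ae_deriv_eq_zero_of_zero (Z : ℝ → ℝ) (T : Set ℝ) (hZ : ∀ x ∈ T, Z x = 0) :
    ∀ᵐ x, x ∈ T → ∀ d, HasDerivAt Z d x → d = 0 := by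
  -- Only countably many points of `T` are isolated from the right in `T`. At any other point the
  -- derivative can be computed along a sequence of zeros.
  have hc : ({x ∈ T | 𝓝[T ∩ Ioi x] x = ⊥} : Set ℝ).Countable :=
    countable_setOfPred_isolated_right_within
  filter_upwards [hc.ae_notMem volume] with x hx hxT d hd
  have hne : (𝓝[T ∩ Ioi x] x).NeBot := ⟨fun h => hx ⟨hxT, h⟩⟩
  have h1 := (hasDerivAt_iff_tendsto_slope.1 hd).mono_left
    (nhdsWithin_mono x (show T ∩ Ioi x ⊆ {x}ᶜ from fun y hy => (ne_of_gt hy.2 : y ≠ x)))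
  refine tendsto_nhds_unique_of_eventuallyEq h1 tendsto_const_nhds ?_
  filter_upwards [self_mem_nhdsWithin] with y hy
  simp [slope_def_field, hZ x hxT, hZ y hy.1]

lemma enorm_sub_le_of_ae_deriv {F : ℝ → ℝ} (hF : AbsolutelyContinuousOnInterval F 0 1)
    {c : ℝ → ℝ≥0∞}
    (hc : ∀ᵐ x, x ∈ Icc (0 : ℝ) 1 → ∃ d, HasDerivAt F d x ∧ ENNReal.ofReal |d| ≤ c x) :
    ‖F 1 - F 0‖ₑ ≤ ∫⁻ x in Icc (0 : ℝ) 1, c x := by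
  rw [← hF.integral_deriv_eq_sub, intervalIntegral.integral_of_le zero_le_one,
    ← integral_Icc_eq_integral_Ioc]
  refine (enorm_integral_le_lintegral_enorm _).trans (lintegral_mono_ae ?_)
  rw [ae_restrict_iff' measurableSet_Icc]
  filter_upwards [hc] with x hx hxI
  obtain ⟨d, hd, hdc⟩ := hx hxI
  rwa [hd.deriv, Real.enorm_eq_ofReal_abs]

/-! ### Functions on the unit interval -/

lemma lintegral_unitInterval (a : I → ℝ≥0∞) :
    ∫⁻ r, a r = ∫⁻ x in Icc (0 : ℝ) 1, a (projIcc 0 1 zero_le_one x) := by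
  have h := unitInterval.measurePreserving_coe.lintegral_comp_emb
    unitInterval.measurableEmbedding_coe
    (fun x => a (projIcc 0 1 zero_le_one x))
  rw [← h]
  exact lintegral_congr fun x => by rw [projIcc_val]

lemma setLIntegral_Ioc_unitInterval (a : I → ℝ≥0∞) (s t : I) :
    ∫⁻ r in Ioc s t, a r =
      ∫⁻ x in Ioc (s : ℝ) t, a (projIcc 0 1 zero_le_one x) := by
  rw [← lintegral_indicator measurableSet_Ioc, lintegral_unitInterval,
    ← lintegral_indicator measurableSet_Icc, ← lintegral_indicator measurableSet_Ioc]
  refine lintegral_congr fun x => ?_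
  by_cases hx : x ∈ Icc (0 : ℝ) 1
  · rw [indicator_of_mem hx]
    simp only [indicator_apply, mem_Ioc]
    simp only [← Subtype.coe_lt_coe, ← Subtype.coe_le_coe, projIcc_of_mem zero_le_one hx]
  · rw [indicator_of_notMem hx, indicator_of_notMem]
    exact fun h => hx ⟨s.2.1.trans h.1.le, h.2.trans t.2.2⟩

/-- `u` has increments bounded on `S` by the integrals of `a`. -/
def IncrementBound (S : Set I) (u : I → ℝ) (a : I → ℝ≥0∞) : Prop :=
  ∀ s ∈ S, ∀ t ∈ S, s < t → ‖u t - u s‖ₑ ≤ ∫⁻ r in Ioc s t, a r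

lemma IncrementBound.exists_extension {S : Set I} {u : I → ℝ} {a : I → ℝ≥0∞}
    (h : IncrementBound S u a) (ha : Measurable a) (hfin : ∫⁻ r, a r ≠ ∞) :
    ∃ F : ℝ → ℝ, AbsolutelyContinuousOnInterval F 0 1 ∧ (∀ s ∈ S, F s = u s) ∧
      ∀ᵐ x, x ∈ Icc (0 : ℝ) 1 →
        ∃ d, HasDerivAt F d x ∧ ENNReal.ofReal |d| ≤ a (projIcc 0 1 zero_le_one x) := by
  set b : ℝ → ℝ≥0∞ := fun x => a (projIcc 0 1 zero_le_one x) with hb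
  have hbm : Measurable b := ha.comp continuous_projIcc.measurable
  have hbfin : ∫⁻ x in Icc (0 : ℝ) 1, b x ≠ ∞ := by rwa [← lintegral_unitInterval]
  have hint : IntegrableOn (fun x => (b x).toReal) (Icc 0 1) :=
    integrable_toReal_of_lintegral_ne_top hbm.aemeasurable hbfin
  have hii : IntervalIntegrable (fun x => (b x).toReal) volume 0 1 := by
    rw [intervalIntegrable_iff_integrableOn_Ioc_of_le zero_le_one]
    exact hint.mono_set Ioc_subset_Icc_self
  obtain ⟨F, hF, hFu, hFd⟩ := exists_absolutelyContinuous_extension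
    (a := fun x => (b x).toReal) (fun _ => ENNReal.toReal_nonneg) hii
    (S := Subtype.val '' S) (u := fun x => u (projIcc 0 1 zero_le_one x)) (by
      rintro _ ⟨s, -, rfl⟩; exact s.2) (by
      rintro _ ⟨s, hs, rfl⟩ _ ⟨t, ht, rfl⟩ hst
      have hst' : s < t := hst
      have h1 := h s hs t ht hst'
      rw [setLIntegral_Ioc_unitInterval] at h1
      have hsub : Ioc (s : ℝ) t ⊆ Icc 0 1 := fun x hx =>
        ⟨s.2.1.trans hx.1.le, hx.2.trans t.2.2⟩
      have hf : ∫⁻ x in Ioc (s : ℝ) t, b x ≠ ∞ :=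
        ne_top_of_le_ne_top hbfin (lintegral_mono_set hsub)
      rw [projIcc_val, projIcc_val, intervalIntegral.integral_of_le hst.le,
        integral_toReal hbm.aemeasurable (ae_lt_top hbm hf)]
      rw [← ENNReal.ofReal_le_iff_le_toReal hf, ← Real.enorm_eq_ofReal_abs]
      exact h1)
  refine ⟨F, hF, fun s hs => ?_, ?_⟩
  · simpa using hFu ⟨s, hs, rfl⟩
  · filter_upwards [hFd] with x hx hxI
    obtain ⟨d, hd, hdb⟩ := hx hxI
    exact ⟨d, hd, ENNReal.ofReal_le_of_le_toReal hdb⟩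

open Classical in
/-- Two functions with controlled increments have equal derivatives a.e. where they agree. -/
lemma IncrementBound.enorm_sub_le {S : Set I} {u w : I → ℝ} {a b : I → ℝ≥0∞}
    (hu : IncrementBound S u a) (hw : IncrementBound S w b) (ha : Measurable a)
    (hb : Measurable b) (hafin : ∫⁻ r, a r ≠ ∞) (hbfin : ∫⁻ r, b r ≠ ∞)
    (hS : ∀ᵐ t, t ∈ S) (h0 : 0 ∈ S) (h1 : 1 ∈ S) :
    ‖u 1 - u 0‖ₑ ≤ ∫⁻ r, if u r = w r then min (a r) (b r) else a r := by
  obtain ⟨F, hF, hFu, hFd⟩ := hu.exists_extension ha hafin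
  obtain ⟨H, hH, hHw, hHd⟩ := hw.exists_extension hb hbfin
  have e0 : F 0 = u 0 := hFu 0 h0
  have e1 : F 1 = u 1 := hFu 1 h1
  rw [← e0, ← e1, lintegral_unitInterval]
  refine enorm_sub_le_of_ae_deriv hF ?_
  have hSR : ∀ᵐ x : ℝ, x ∈ Icc (0 : ℝ) 1 → projIcc 0 1 zero_le_one x ∈ S := by
    have h0 : volume (Subtype.val '' Sᶜ : Set ℝ) = 0 := by
      rw [← unitInterval.volume_apply]; exact hS
    filter_upwards [measure_eq_zero_iff_ae_notMem.1 h0] with x hx hxI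
    by_contra hc
    exact hx ⟨_, hc, by rw [projIcc_of_mem zero_le_one hxI]⟩
  -- `F` and `H` represent `u` and `w` only on `S`, which has full measure. At almost every point
  -- where they agree, `F - H` has derivative zero, so `F'` obeys both bounds there.
  filter_upwards [hFd, hHd, hSR, ae_deriv_eq_zero_of_zero (fun x => F x - H x)
    {x | x ∈ Icc (0 : ℝ) 1 ∧ F x = H x} (fun x hx => sub_eq_zero.2 hx.2)]
    with x hx1 hx2 hx3 hx4 hxI
  obtain ⟨d, hd, hda⟩ := hx1 hxI
  obtain ⟨e, he, heb⟩ := hx2 hxI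
  refine ⟨d, hd, ?_⟩
  split_ifs with hT
  · have hz := hx4 ⟨hxI, by
      have := hFu _ (hx3 hxI)
      have h' := hHw _ (hx3 hxI)
      rw [projIcc_of_mem zero_le_one hxI] at this h' hT
      simp only at this h'
      rw [this, h', hT]⟩ _ (hd.sub he)
    have : d = e := by linarith
    exact le_min hda (this ▸ heb)
  · exact hda

/-! ## Metric speed -/

section Speed

variable {X : Type*} [MetricSpace X]

/-- This form yields joint Borel measurability: arbitrary suprema keep lower semicontinuity, and the
remaining infimum is countable. -/
lemma metricSpeed_eq_iInf_iSup (γ : C(I, X)) (t : I) :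
    metricSpeed γ t = ⨅ n : ℕ, ⨆ s : I,
      if 0 < dist s t ∧ dist s t < 1 / ((n : ℝ) + 1) then edist (γ s) (γ t) / edist s t else 0 := by
  have hb : (𝓝[≠] t).HasBasis (fun _ : ℕ => True)
      (fun n => Metric.ball t (1 / ((n : ℝ) + 1)) ∩ {t}ᶜ) :=
    nhdsWithin_hasBasis Metric.nhds_basis_ball_inv_nat_succ _
  rw [metricSpeed, hb.limsup_eq_iInf_iSup]
  simp only [iInf_true]
  refine iInf_congr fun n => ?_
  refine iSup_congr fun s => ?_
  by_cases h : 0 < dist s t ∧ dist s t < 1 / ((n : ℝ) + 1)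
  · rw [if_pos h, iSup_pos]
    exact ⟨h.2, fun he => by simp [show s = t from he] at h⟩
  · rw [if_neg h, iSup_neg]
    · rfl
    · exact fun hs => h ⟨dist_pos.2 hs.2, hs.1⟩

/-- The strict inequalities cut out an open set on which the quotient is continuous. Extending a
non-negative function by zero off an open set preserves lower semicontinuity. -/
lemma lowerSemicontinuous_quotient (s : I) (δ : ℝ) :
    LowerSemicontinuous fun z : C(I, X) × I =>
      if 0 < dist s z.2 ∧ dist s z.2 < δ then edist (z.1 s) (z.1 z.2) / edist s z.2 else 0 := by
  rw [lowerSemicontinuous_iff_isOpen_preimage]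
  intro y
  have hcd : Continuous fun z : C(I, X) × I => dist s z.2 := by fun_prop
  have hU : IsOpen {z : C(I, X) × I | 0 < dist s z.2 ∧ dist s z.2 < δ} :=
    (isOpen_lt continuous_const hcd).and (isOpen_lt hcd continuous_const)
  have hc : ContinuousOn (fun z : C(I, X) × I => edist (z.1 s) (z.1 z.2) / edist s z.2)
      {z : C(I, X) × I | 0 < dist s z.2 ∧ dist s z.2 < δ} := by
    intro z hz
    refine ContinuousAt.continuousWithinAt ?_
    refine ENNReal.Tendsto.div ?_ (Or.inr ?_) ?_ (Or.inl (edist_ne_top _ _))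
    · have : Continuous fun z : C(I, X) × I => edist (z.1 s) (z.1 z.2) := by fun_prop
      exact this.tendsto z
    · exact (edist_pos.2 (dist_pos.1 hz.1)).ne'
    · have : Continuous fun z : C(I, X) × I => edist s z.2 := by fun_prop
      exact this.tendsto z
  convert hc.isOpen_inter_preimage hU (isOpen_Ioi (a := y)) using 1
  ext z
  simp only [mem_preimage, mem_Ioi, mem_inter_iff, mem_ofPred_eq]
  split_ifs with h
  · exact ⟨fun hy => ⟨h, hy⟩, fun hy => hy.2⟩
  · exact ⟨fun hy => absurd hy not_lt_zero, fun hy => absurd hy.1 h⟩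


lemma measurable_metricSpeed :
    Measurable fun z : C(I, X) × I => metricSpeed z.1 z.2 := by
  simp only [metricSpeed_eq_iInf_iSup]
  exact Measurable.iInf fun n =>
    (lowerSemicontinuous_iSup fun s => lowerSemicontinuous_quotient s _).measurable

lemma measurable_metricSpeed_apply (γ : C(I, X)) : Measurable (metricSpeed γ) := by
  have h : Measurable ((fun z : C(I, X) × I => metricSpeed z.1 z.2) ∘ Prod.mk γ) :=
    measurable_metricSpeed.comp measurable_prodMk_left
  exact h

lemma ofReal_abs_deriv_le_metricSpeed {γ : C(I, X)} {F : ℝ → ℝ}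
    (hF : ∀ s t : I, |F s - F t| ≤ dist (γ s) (γ t)) {t : I} {d : ℝ} (hd : HasDerivAt F d t) :
    ENNReal.ofReal |d| ≤ metricSpeed γ t := by
  have h1 : Tendsto (fun s : I => slope F (t : ℝ) s) (𝓝[≠] t) (𝓝 d) := by
    refine (hasDerivAt_iff_tendsto_slope.1 hd).comp ?_
    refine tendsto_nhdsWithin_iff.2 ⟨?_, ?_⟩
    · exact (continuous_subtype_val.tendsto t).mono_left nhdsWithin_le_nhds
    · filter_upwards [self_mem_nhdsWithin] with s hs
      exact fun h => hs (Subtype.ext h)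
  have h2 : Tendsto (fun s : I => ENNReal.ofReal |slope F (t : ℝ) s|) (𝓝[≠] t)
      (𝓝 (ENNReal.ofReal |d|)) := ENNReal.tendsto_ofReal h1.abs
  rw [← h2.limsup_eq, metricSpeed]
  refine limsup_le_limsup ?_ (by isBoundedDefault) (by isBoundedDefault)
  filter_upwards [self_mem_nhdsWithin] with s hs
  have hst : 0 < |(s : ℝ) - t| := abs_pos.2 (sub_ne_zero.2 fun h => hs (Subtype.ext h))
  rw [slope_def_field, abs_div, ENNReal.ofReal_div_of_pos hst, edist_dist, edist_dist,
    Subtype.dist_eq, Real.dist_eq]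
  gcongr
  exact hF s t

lemma IsAC.exists_nonneg {q : ℝ} (hq : 1 ≤ q) {γ : C(I, X)} (h : IsAC q γ) :
    ∃ φ : I → ℝ, Measurable φ ∧ (∀ r, 0 ≤ φ r) ∧ MemLp φ (ENNReal.ofReal q) volume ∧
      ∀ s t : I, s < t → dist (γ t) (γ s) ≤ ∫ r in Ioc s t, φ r := by
  obtain ⟨φ, hφ, hd⟩ := h
  have hq' : 1 ≤ ENNReal.ofReal q := ENNReal.one_le_ofReal.2 hq
  have hi : Integrable φ := hφ.integrable hq'
  have he : (fun r => |hφ.1.mk φ r|) =ᵐ[volume] fun r => |φ r| := by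
    filter_upwards [hφ.1.ae_eq_mk] with r hr
    rw [hr]
  refine ⟨fun r => |hφ.1.mk φ r|, hφ.1.stronglyMeasurable_mk.measurable.abs,
    fun _ => abs_nonneg _, (memLp_congr_ae he).2 hφ.abs, fun s t hst => (hd s t hst).trans ?_⟩
  rw [integral_congr_ae (ae_restrict_of_ae he)]
  exact integral_mono hi.integrableOn hi.abs.integrableOn fun r => le_abs_self _

/-- The density in `IsAC` serves only to make `t ↦ dist (γ t) (γ 0)` absolutely continuous. The
derivative of this function is then bounded by the metric speed. -/
lemma IsAC.edist_le {q : ℝ} (hq : 1 ≤ q) {γ : C(I, X)} (h : IsAC q γ) :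
    edist (γ 1) (γ 0) ≤ ∫⁻ r, metricSpeed γ r := by
  obtain ⟨φ, hφm, hφ0, hφ, hd⟩ := h.exists_nonneg hq
  have hi : Integrable φ := hφ.integrable (ENNReal.one_le_ofReal.2 hq)
  have hb : IncrementBound univ (fun t => dist (γ t) (γ 0)) (fun r => ENNReal.ofReal (φ r)) := by
    intro s _ t _ hst
    rw [← ofReal_integral_eq_lintegral_ofReal hi.integrableOn (ae_of_all _ hφ0),
      Real.enorm_eq_ofReal_abs]
    exact ENNReal.ofReal_le_ofReal ((abs_dist_sub_le _ _ _).trans (hd s t hst))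
  obtain ⟨F, hF, hFu, hFd⟩ := hb.exists_extension hφm.ennreal_ofReal
    ((hasFiniteIntegral_iff_ofReal (ae_of_all _ hφ0)).1 hi.2).ne
  have hFu' : ∀ s : I, F s = dist (γ s) (γ 0) := fun s => hFu s (mem_univ s)
  have := enorm_sub_le_of_ae_deriv hF (c := fun x => metricSpeed γ (projIcc 0 1 zero_le_one x)) (by
    filter_upwards [hFd] with x hx hxI
    obtain ⟨d, hd, -⟩ := hx hxI
    refine ⟨d, hd, ?_⟩
    rw [projIcc_of_mem zero_le_one hxI]
    refine ofReal_abs_deriv_le_metricSpeed (fun s t => ?_) hd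
    rw [hFu', hFu']
    exact abs_dist_sub_le _ _ _)
  rw [← lintegral_unitInterval] at this
  have e1 : F 1 = dist (γ 1) (γ 0) := hFu' 1
  have e0 : F 0 = 0 := (hFu' 0).trans (dist_self _)
  rwa [e1, e0, sub_zero, Real.enorm_of_nonneg dist_nonneg, ← edist_dist] at this

/-! ### Stopped curves -/

/-- The curve that follows `γ` on `[s, t]` and is constant before and after. -/
def stopCurve (s t : I) (γ : C(I, X)) : C(I, X) :=
  γ.comp ⟨fun r => max s (min t r), by fun_prop⟩

@[simp] lemma stop_apply (s t : I) (γ : C(I, X)) (r : I) : stopCurve s t γ r = γ (max s (min t r)) := rfl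

lemma measurable_stop (s t : I) : Measurable (stopCurve s t : C(I, X) → C(I, X)) :=
  (ContinuousMap.continuous_precomp _).measurable

lemma metricSpeed_congr {γ η : C(I, X)} {r : I} (h : ∀ᶠ a in 𝓝 r, γ a = η a) :
    metricSpeed γ r = metricSpeed η r := by
  refine limsup_congr ?_
  filter_upwards [h.filter_mono nhdsWithin_le_nhds] with a ha
  rw [ha, h.self_of_nhds]

lemma metricSpeed_const {γ : C(I, X)} {r : I} {z : X} (h : ∀ᶠ a in 𝓝 r, γ a = z) :
    metricSpeed γ r = 0 := by
  rw [metricSpeed_congr (η := ContinuousMap.const I z) h]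
  simp [metricSpeed]

lemma metricSpeed_stop {s t : I} (hst : s ≤ t) (γ : C(I, X)) :
    ∀ᵐ r, metricSpeed (stopCurve s t γ) r = (Ioc s t).indicator (metricSpeed γ) r := by
  have h1 : ∀ᵐ r : I, r ≠ s := by simp [ae_iff]
  have h2 : ∀ᵐ r : I, r ≠ t := by simp [ae_iff]
  filter_upwards [h1, h2] with r hs ht
  rcases lt_or_gt_of_ne hs with hs | hs
  · rw [indicator_of_notMem (fun h => absurd h.1 hs.le.not_gt)]
    refine metricSpeed_const (z := γ s) ?_
    filter_upwards [Iio_mem_nhds hs] with a ha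
    rw [stop_apply, max_eq_left ((min_le_right _ _).trans (le_of_lt ha))]
  rcases lt_or_gt_of_ne ht with ht | ht
  · rw [indicator_of_mem (show r ∈ Ioc s t from ⟨hs, ht.le⟩)]
    refine metricSpeed_congr ?_
    filter_upwards [Ioo_mem_nhds hs ht] with a ha
    rw [stop_apply, min_eq_right ha.2.le, max_eq_right ha.1.le]
  · rw [indicator_of_notMem (fun h => absurd h.2 ht.not_ge)]
    refine metricSpeed_const (z := γ t) ?_
    filter_upwards [Ioi_mem_nhds ht] with a ha
    rw [stop_apply, min_eq_left (le_of_lt ha), max_eq_right hst]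

lemma IsAC.stopCurve {q : ℝ} (hq : 1 ≤ q) {γ : C(I, X)} (h : IsAC q γ) (s t : I) :
    IsAC q (stopCurve s t γ) := by
  obtain ⟨φ, hφm, hφ0, hφ, hd⟩ := h.exists_nonneg hq
  refine ⟨(Ioc s t).indicator φ, hφ.indicator measurableSet_Ioc, fun a b hab => ?_⟩
  rw [setIntegral_indicator measurableSet_Ioc, stop_apply, stop_apply]
  have hle : max s (min t a) ≤ max s (min t b) := max_le_max_left _ (min_le_min_left _ hab.le)
  rcases hle.eq_or_lt with he | hlt
  · rw [he, dist_self]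
    exact integral_nonneg hφ0
  · have : Ioc a b ∩ Ioc s t = Ioc (max s (min t a)) (max s (min t b)) := by
      ext r
      simp only [mem_inter_iff, mem_Ioc, max_lt_iff, le_max_iff, min_lt_iff, le_min_iff,
        lt_max_iff, lt_min_iff] at hlt ⊢
      grind
    rw [this]
    exact hd _ _ hlt

lemma IsAC.edist_le_setLIntegral {q : ℝ} (hq : 1 ≤ q) {γ : C(I, X)} (h : IsAC q γ) {s t : I}
    (hst : s ≤ t) : edist (γ t) (γ s) ≤ ∫⁻ r in Ioc s t, metricSpeed γ r := by
  have := (h.stopCurve hq s t).edist_le hq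
  rw [lintegral_congr_ae (metricSpeed_stop hst γ), lintegral_indicator measurableSet_Ioc] at this
  rwa [stop_apply, stop_apply, min_eq_left (show t ≤ 1 from t.2.2), max_eq_right hst,
    min_eq_right (show 0 ≤ t from t.2.1), max_eq_left (show 0 ≤ s from s.2.1)] at this

/-- Curves of finite `q`-energy which are integrals of their metric speed, tested on `D`. -/
def energyCurves (X : Type*) [MetricSpace X] (q : ℝ) (D : Set I) : Set C(I, X) :=
  {γ | ∫⁻ r, metricSpeed γ r ^ q < ∞ ∧
    ∀ s ∈ D, ∀ t ∈ D, s < t → edist (γ t) (γ s) ≤ ∫⁻ r in Ioc s t, metricSpeed γ r}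

lemma measurable_setLIntegral_curve {k : C(I, X) × I → ℝ≥0∞} (hk : Measurable k) (A : Set I) :
    Measurable fun γ : C(I, X) => ∫⁻ r in A, k (γ, r) :=
  hk.lintegral_prod_right'

/-- `IsAC` quantifies over densities and is not visibly a measurable condition. `energyCurves` is a
Borel substitute: measurable for countable `D`, and made of absolutely continuous curves for dense
`D`. It is what carries "almost every curve is absolutely continuous" through the push-forward by
`stopCurve`. -/
lemma measurableSet_energyCurves (q : ℝ) {D : Set I} (hD : D.Countable) :
    MeasurableSet (energyCurves X q D) := by
  refine MeasurableSet.inter ?_ ?_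
  · exact measurableSet_lt ((measurable_metricSpeed.pow_const q).lintegral_prod_right')
      measurable_const
  · have : {γ : C(I, X) | ∀ s ∈ D, ∀ t ∈ D, s < t →
        edist (γ t) (γ s) ≤ ∫⁻ r in Ioc s t, metricSpeed γ r} = ⋂ s ∈ D, ⋂ t ∈ D, ⋂ _ : s < t,
          {γ | edist (γ t) (γ s) ≤ ∫⁻ r in Ioc s t, metricSpeed γ r} := by
      ext γ
      simp only [mem_iInter]
      rfl
    change MeasurableSet {γ : C(I, X) | ∀ s ∈ D, ∀ t ∈ D, s < t →
        edist (γ t) (γ s) ≤ ∫⁻ r in Ioc s t, metricSpeed γ r}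
    rw [this]
    refine MeasurableSet.biInter hD fun s _ => MeasurableSet.biInter hD fun t _ =>
      MeasurableSet.iInter fun _ => measurableSet_le ?_
        (measurable_setLIntegral_curve measurable_metricSpeed _)
    exact Continuous.measurable (by fun_prop)

lemma isAC_of_mem_energyCurves {q : ℝ} (hq : 1 ≤ q) {D : Set I} (hD : Dense D) {γ : C(I, X)}
    (h : γ ∈ energyCurves X q D) : IsAC q γ := by
  obtain ⟨hfin, hd⟩ := h
  have hq0 : 0 < q := zero_lt_one.trans_le hq
  have hm := measurable_metricSpeed_apply γ
  have hlt : ∀ᵐ r, metricSpeed γ r < ∞ := by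
    filter_upwards [ae_lt_top (hm.pow_const q) hfin.ne] with r hr
    exact (ENNReal.rpow_lt_top_iff_of_pos hq0).1 hr
  have hL : MemLp (fun r => (metricSpeed γ r).toReal) (ENNReal.ofReal q) volume := by
    refine ⟨hm.ennreal_toReal.aestronglyMeasurable, ?_⟩
    rw [eLpNorm_lt_top_iff_lintegral_rpow_enorm_lt_top (by simpa using hq0) ENNReal.ofReal_ne_top,
      ENNReal.toReal_ofReal hq0.le]
    refine lt_of_le_of_lt (lintegral_mono fun r => ?_) hfin
    gcongr
    rw [Real.enorm_of_nonneg ENNReal.toReal_nonneg]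
    exact ENNReal.ofReal_toReal_le
  refine ⟨_, hL, fun s t hst => ?_⟩
  have hi : Integrable (fun r => (metricSpeed γ r).toReal) :=
    hL.integrable (ENNReal.one_le_ofReal.2 hq)
  have hne : ∫⁻ r in Ioc s t, metricSpeed γ r ≠ ∞ := by
    have h2 := hi.2
    rw [hasFiniteIntegral_iff_ofReal (ae_of_all _ fun _ => ENNReal.toReal_nonneg)] at h2
    refine ne_top_of_le_ne_top h2.ne ((setLIntegral_le_lintegral _ _).trans ?_)
    exact lintegral_mono_ae (by
      filter_upwards [hlt] with r hr
      rw [ENNReal.ofReal_toReal hr.ne])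
  rw [integral_toReal hm.aemeasurable (ae_restrict_of_ae hlt), ← ENNReal.ofReal_le_iff_le_toReal hne,
    ← edist_dist]
  -- A strict failure at `(s, t)` persists at nearby endpoints by continuity of `γ`. Taking them in
  -- `D` and inside `(s, t)` only shrinks the domain of integration, which contradicts the bound on
  -- `D`.
  by_contra! hlt'
  have hopen : IsOpen {z : I × I | ∫⁻ r in Ioc s t, metricSpeed γ r < edist (γ z.2) (γ z.1)} :=
    isOpen_lt continuous_const (by fun_prop)
  obtain ⟨U, V, hU, hV, hsU, htV, hUV⟩ := isOpen_prod_iff.1 hopen s t hlt'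
  obtain ⟨s', ⟨hs'U, hs'⟩, hs'D⟩ : ((U ∩ Ioo s t) ∩ D).Nonempty := by
    refine hD.inter_open_nonempty _ (hU.inter isOpen_Ioo) ?_
    have : (𝓝[>] s).NeBot := nhdsGT_neBot_of_exists_gt ⟨t, hst⟩
    exact Filter.nonempty_of_mem (inter_mem (mem_nhdsWithin_of_mem_nhds (hU.mem_nhds hsU))
      (Ioo_mem_nhdsGT hst))
  obtain ⟨t', ⟨ht'V, ht'⟩, ht'D⟩ : ((V ∩ Ioo s' t) ∩ D).Nonempty := by
    refine hD.inter_open_nonempty _ (hV.inter isOpen_Ioo) ?_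
    have : (𝓝[<] t).NeBot := nhdsLT_neBot_of_exists_lt ⟨s', hs'.2⟩
    exact Filter.nonempty_of_mem (inter_mem (mem_nhdsWithin_of_mem_nhds (hV.mem_nhds htV))
      (Ioo_mem_nhdsLT hs'.2))
  have h1 := hUV (mk_mem_prod hs'U ht'V)
  have h2 := hd s' hs'D t' ht'D ht'.1
  refine absurd (h2.trans (lintegral_mono_set ?_)) (not_le.2 h1)
  exact Ioc_subset_Ioc hs'.1.le ht'.2.le

lemma IsAC.mem_energyCurves {q : ℝ} (hq : 1 ≤ q) {γ : C(I, X)} (h : IsAC q γ)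
    (hfin : ∫⁻ r, metricSpeed γ r ^ q < ∞) (D : Set I) : γ ∈ energyCurves X q D :=
  ⟨hfin, fun _ _ _ _ hst => h.edist_le_setLIntegral hq hst.le⟩

end Speed

/-! ## Test plans -/

section Plans

variable {X : Type*} [MetricSpace X] [MeasurableSpace X] [BorelSpace X] {m : Measure X}

lemma measurable_eval_curve (t : I) : Measurable fun γ : C(I, X) => γ t :=
  (show Continuous fun γ : C(I, X) => γ t by fun_prop).measurable

lemma measurable_uncurry_curve : Measurable fun z : C(I, X) × I => z.1 z.2 :=
  (show Continuous fun z : C(I, X) × I => z.1 z.2 by fun_prop).measurable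

lemma IsTestPlan.cond {q : ℝ} {π : Measure C(I, X)} (hπ : IsTestPlan m q π) {A : Set C(I, X)}
    (hA : π A ≠ 0) : IsTestPlan m q (ProbabilityTheory.cond π A) := by
  have := hπ.isProbabilityMeasure
  have hinv : (π A)⁻¹ ≠ ∞ := ENNReal.inv_ne_top.2 hA
  refine ⟨ProbabilityTheory.cond_isProbabilityMeasure hA, ?_, ?_, ?_⟩
  · obtain ⟨C, hC⟩ := hπ.boundedCompression
    refine ⟨(π A)⁻¹.toNNReal * C, fun t => ?_⟩
    rw [ProbabilityTheory.cond, Measure.map_smul, mul_smul]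
    have h1 : (π.restrict A).map (fun γ => γ t) ≤ C • m :=
      (Measure.map_mono Measure.restrict_le_self (measurable_eval_curve t)).trans (hC t)
    have h2 : ((π A)⁻¹.toNNReal • (C • m) : Measure X) = (π A)⁻¹ • (C • m) := by
      nth_rw 2 [← ENNReal.coe_toNNReal hinv]
      rfl
    rw [h2]
    intro E
    rw [Measure.smul_apply, Measure.smul_apply]
    exact mul_le_mul_right (h1 E) _
  · exact ProbabilityTheory.cond_absolutelyContinuous.ae_le hπ.ae_isAC
  · rw [ProbabilityTheory.cond, lintegral_smul_measure]
    refine ENNReal.mul_lt_top hinv.lt_top ?_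
    exact (lintegral_mono' Measure.restrict_le_self le_rfl).trans_lt hπ.finite_energy

lemma measurable_energy (q : ℝ) : Measurable fun γ : C(I, X) => ∫⁻ t, metricSpeed γ t ^ q :=
  (measurable_metricSpeed.pow_const q).lintegral_prod_right'

lemma IsTestPlan.ae_energy_lt_top {q : ℝ} {π : Measure C(I, X)} (hπ : IsTestPlan m q π) :
    ∀ᵐ γ ∂π, ∫⁻ t, metricSpeed γ t ^ q < ∞ :=
  ae_lt_top (measurable_energy q) hπ.finite_energy.ne

lemma lintegral_metricSpeed_stop_le {q : ℝ} (hq : 0 < q) {s t : I} (hst : s ≤ t) (γ : C(I, X)) :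
    ∫⁻ r, metricSpeed (stopCurve s t γ) r ^ q ≤ ∫⁻ r, metricSpeed γ r ^ q := by
  refine lintegral_mono_ae ?_
  filter_upwards [metricSpeed_stop hst γ] with r hr
  rw [hr]
  gcongr
  exact indicator_le_self' (fun _ _ => zero_le) r

lemma IsTestPlan.stopCurve {q : ℝ} (hq : 1 ≤ q) {π : Measure C(I, X)} (hπ : IsTestPlan m q π)
    {s t : I} (hst : s ≤ t) : IsTestPlan m q (π.map (stopCurve s t)) := by
  have := hπ.isProbabilityMeasure
  have hms := measurable_stop (X := X) s t
  have hq0 : 0 < q := zero_lt_one.trans_le hq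
  refine ⟨Measure.isProbabilityMeasure_map hms.aemeasurable, ?_, ?_, ?_⟩
  · obtain ⟨C, hC⟩ := hπ.boundedCompression
    refine ⟨C, fun r => ?_⟩
    rw [Measure.map_map (measurable_eval_curve r) hms]
    exact hC _
  · have hD := exists_countable_dense I
    obtain ⟨D, hDc, hDd⟩ := hD
    have : ∀ᵐ γ ∂π.map (MetricDivergence.stopCurve s t), γ ∈ energyCurves X q D := by
      refine (ae_map_iff hms.aemeasurable (p := fun γ => γ ∈ energyCurves X q D)
        (measurableSet_energyCurves q hDc)).2 ?_
      filter_upwards [hπ.ae_isAC, hπ.ae_energy_lt_top] with γ h1 h2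
      exact (h1.stopCurve hq s t).mem_energyCurves hq
        ((lintegral_metricSpeed_stop_le hq0 hst γ).trans_lt h2) D
    filter_upwards [this] with γ hγ
    exact isAC_of_mem_energyCurves hq hDd hγ
  · rw [lintegral_map (measurable_energy q) hms]
    exact (lintegral_mono fun γ => lintegral_metricSpeed_stop_le hq0 hst γ).trans_lt
      hπ.finite_energy

/-- A test plan for an exponent is a test plan for every smaller exponent. -/
lemma IsTestPlan.mono {q q' : ℝ} (hq : 0 < q) (hqq : q ≤ q') {π : Measure C(I, X)}
    (hπ : IsTestPlan m q' π) : IsTestPlan m q π := by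
  have := hπ.isProbabilityMeasure
  refine ⟨this, hπ.boundedCompression, ?_, ?_⟩
  · filter_upwards [hπ.ae_isAC] with γ ⟨φ, hφ, hd⟩
    exact ⟨φ, hφ.mono_exponent (ENNReal.ofReal_le_ofReal hqq), hd⟩
  · refine lt_of_le_of_lt (lintegral_mono fun γ => lintegral_mono fun r =>
      (show metricSpeed γ r ^ q ≤ 1 + metricSpeed γ r ^ q' from ?_)) ?_
    · rcases le_total (metricSpeed γ r) 1 with h | h
      · exact (ENNReal.rpow_le_one h hq.le).trans le_self_add
      · exact (ENNReal.rpow_le_rpow_of_exponent_le h hqq).trans le_add_self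
    · simp only [lintegral_add_left measurable_const, lintegral_const, measure_univ, mul_one]
      exact ENNReal.add_lt_top.2 ⟨ENNReal.one_lt_top, hπ.finite_energy⟩

/-! ## Weak upper gradients along curves -/

/-- The integrand of the line integral of `G` along `γ`. -/
def lineDensity (G : X → ℝ) (γ : C(I, X)) (r : I) : ℝ≥0∞ :=
  ENNReal.ofReal (G (γ r)) * metricSpeed γ r

lemma measurable_lineDensity {G : X → ℝ} (hG : Measurable G) :
    Measurable fun z : C(I, X) × I => lineDensity G z.1 z.2 :=
  (hG.comp measurable_uncurry_curve).ennreal_ofReal.mul measurable_metricSpeed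

lemma measurable_lineDensity_apply {G : X → ℝ} (hG : Measurable G) (γ : C(I, X)) :
    Measurable (lineDensity G γ) :=
  (hG.comp γ.continuous.measurable).ennreal_ofReal.mul (measurable_metricSpeed_apply γ)

lemma measurable_lintegral_lineDensity {G : X → ℝ} (hG : Measurable G) :
    Measurable fun γ : C(I, X) => ∫⁻ r, lineDensity G γ r :=
  (measurable_lineDensity hG).lintegral_prod_right'

lemma lintegral_lineDensity_stop {G : X → ℝ} {s t : I} (hst : s ≤ t) (γ : C(I, X)) :
    ∫⁻ r, lineDensity G (stopCurve s t γ) r = ∫⁻ r in Ioc s t, lineDensity G γ r := by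
  rw [← lintegral_indicator measurableSet_Ioc]
  refine lintegral_congr_ae ?_
  filter_upwards [metricSpeed_stop hst γ] with r hr
  rw [lineDensity, hr]
  by_cases h : r ∈ Ioc s t
  · rw [indicator_of_mem h, indicator_of_mem h, stop_apply, min_eq_right h.2, max_eq_right h.1.le]
    rfl
  · rw [indicator_of_notMem h, indicator_of_notMem h, mul_zero]

lemma one_le_conjExponent {p : ℝ} (hp : 1 < p) : 1 ≤ Real.conjExponent p :=
  (Real.HolderConjugate.conjExponent hp).symm.lt.le

/-- Test plans are stable under conditioning on a set `A` of curves and under stopping. Testing on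
the plan conditioned to `A` and stopped to `[s, t]`, with `A` arbitrary, turns the integrated
inequality into one for almost every curve. -/
lemma IsWeakUpperGradient.ae_enorm_sub_le {p : ℝ} (hp : 1 < p) {f G : X → ℝ} (hf : Measurable f)
    (hG : IsWeakUpperGradient m p f G) {π : Measure C(I, X)}
    (hπ : IsTestPlan m (Real.conjExponent p) π) {s t : I} (hst : s ≤ t) :
    ∀ᵐ γ ∂π, ‖f (γ t) - f (γ s)‖ₑ ≤ ∫⁻ r in Ioc s t, lineDensity G γ r := by
  have := hπ.isProbabilityMeasure
  have hf' : ∀ a b : I, Measurable fun γ : C(I, X) => ‖f (γ a) - f (γ b)‖ₑ := fun a b =>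
    ((hf.comp (measurable_eval_curve a)).sub (hf.comp (measurable_eval_curve b))).enorm
  refine ae_le_of_forall_setLIntegral_le_of_sigmaFinite (hf' t s) fun A hA _ => ?_
  by_cases h0 : π A = 0
  · simp [Measure.restrict_eq_zero.2 h0]
  have h := hG.le _ ((hπ.cond h0).stopCurve (one_le_conjExponent hp) hst)
  rw [lintegral_map (hf' 1 0) (measurable_stop s t)] at h
  change _ ≤ ∫⁻ γ, (∫⁻ r, lineDensity G γ r) ∂_ at h
  rw [lintegral_map (measurable_lintegral_lineDensity hG.measurable) (measurable_stop s t)] at h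
  simp only [lintegral_lineDensity_stop hst, ProbabilityTheory.cond, lintegral_smul_measure,
    smul_eq_mul] at h
  rw [ENNReal.mul_le_mul_iff_right (ENNReal.inv_ne_zero.2 (measure_ne_top _ _))
    (ENNReal.inv_ne_top.2 h0)] at h
  simp only [stop_apply, min_eq_left (show t ≤ 1 from t.2.2), max_eq_right hst,
    min_eq_right (show 0 ≤ t from t.2.1), max_eq_left (show 0 ≤ s from s.2.1)] at h
  exact h

lemma exists_countable_dense_unitInterval :
    ∃ D : Set I, D.Countable ∧ Dense D ∧ 0 ∈ D ∧ 1 ∈ D := by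
  obtain ⟨D, hDc, hDd⟩ := exists_countable_dense I
  exact ⟨insert 0 (insert 1 D), (hDc.insert _).insert _,
    hDd.mono ((subset_insert _ _).trans (subset_insert _ _)), by simp, by simp⟩

lemma IncrementBound.mono {S T : Set I} {u : I → ℝ} {a : I → ℝ≥0∞} (h : IncrementBound S u a)
    (hT : T ⊆ S) : IncrementBound T u a := fun s hs t ht hst => h s (hT hs) t (hT ht) hst

/-- Increments tested against a dense set are controlled everywhere. -/
lemma incrementBound_of_dense {D : Set I} (hD : Dense D) {u : I → ℝ} {a : I → ℝ≥0∞} :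
    IncrementBound {t | ∀ s ∈ D, ‖u t - u s‖ₑ ≤ ∫⁻ r in Ioc (min s t) (max s t), a r} u a := by
  intro s hs t ht hst
  -- A point of `D` strictly between `s` and `t` makes the two controlled intervals adjacent, so
  -- that their integrals add up exactly.
  obtain ⟨c, hcD, hsc, hct⟩ := hD.exists_between hst
  have h1 := hs c hcD
  have h2 := ht c hcD
  rw [min_eq_right hsc.le, max_eq_left hsc.le] at h1
  rw [min_eq_left hct.le, max_eq_right hct.le] at h2
  rw [← Ioc_union_Ioc_eq_Ioc hsc.le hct.le, lintegral_union measurableSet_Ioc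
    (Ioc_disjoint_Ioc_of_le le_rfl)]
  calc ‖u t - u s‖ₑ = ‖(u t - u c) - (u s - u c)‖ₑ := by rw [sub_sub_sub_cancel_right]
    _ ≤ ‖u t - u c‖ₑ + ‖u s - u c‖ₑ := enorm_sub_le
    _ ≤ _ := by rw [add_comm]; exact add_le_add h1 h2

lemma measurable_lintegral_between {k : C(I, X) × I → ℝ≥0∞} (hk : Measurable k) (s : I) :
    Measurable fun z : C(I, X) × I => ∫⁻ r in Ioc (min s z.2) (max s z.2), k (z.1, r) := by
  have hA : MeasurableSet {w : (C(I, X) × I) × I | min s w.1.2 < w.2 ∧ w.2 ≤ max s w.1.2} := by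
    refine MeasurableSet.inter ?_ ?_
    · exact measurableSet_lt (by fun_prop) (by fun_prop)
    · exact measurableSet_le (by fun_prop) (by fun_prop)
  have h : Measurable fun z : C(I, X) × I => ∫⁻ r, {w : (C(I, X) × I) × I |
      min s w.1.2 < w.2 ∧ w.2 ≤ max s w.1.2}.indicator (fun w => k (w.1.1, w.2)) (z, r) :=
    ((hk.comp (show Measurable fun w : (C(I, X) × I) × I => (w.1.1, w.2) by
      fun_prop)).indicator hA).lintegral_prod_right'
  have he : (fun z : C(I, X) × I => ∫⁻ r in Ioc (min s z.2) (max s z.2), k (z.1, r)) =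
      fun z => ∫⁻ r, {w : (C(I, X) × I) × I |
        min s w.1.2 < w.2 ∧ w.2 ≤ max s w.1.2}.indicator (fun w => k (w.1.1, w.2)) (z, r) := by
    funext z
    rw [← lintegral_indicator measurableSet_Ioc]
    rfl
  rw [he]
  exact h

/-- For each fixed `t` the bounds against a countable dense set hold for almost every `γ`; Fubini
exchanges the quantifiers. The times `0` and `1` are treated separately because they form a null
set, yet are the ones that matter in the upper gradient inequality. -/
lemma IsWeakUpperGradient.ae_exists_incrementBound {p : ℝ} (hp : 1 < p) {f G : X → ℝ}
    (hf : Measurable f) (hG : IsWeakUpperGradient m p f G) {π : Measure C(I, X)}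
    (hπ : IsTestPlan m (Real.conjExponent p) π) :
    ∀ᵐ γ ∂π, ∃ S : Set I, (∀ᵐ t, t ∈ S) ∧ 0 ∈ S ∧ 1 ∈ S ∧
      IncrementBound S (fun t => f (γ t)) (lineDensity G γ) := by
  have := hπ.isProbabilityMeasure
  obtain ⟨D, hDc, hDd, hD0, hD1⟩ := exists_countable_dense_unitInterval
  have hpt : ∀ t : I, ∀ᵐ γ ∂π, ∀ s ∈ D,
      ‖f (γ t) - f (γ s)‖ₑ ≤ ∫⁻ r in Ioc (min s t) (max s t), lineDensity G γ r := by
    intro t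
    rw [ae_ball_iff hDc]
    intro s _
    rcases le_total s t with h | h
    · rw [min_eq_left h, max_eq_right h]
      exact hG.ae_enorm_sub_le hp hf hπ h
    · rw [min_eq_right h, max_eq_left h]
      filter_upwards [hG.ae_enorm_sub_le hp hf hπ h] with γ hγ
      rwa [← enorm_neg, neg_sub]
  have hmeas : MeasurableSet {z : C(I, X) × I | ∀ s ∈ D, ‖f (z.1 z.2) - f (z.1 s)‖ₑ ≤
      ∫⁻ r in Ioc (min s z.2) (max s z.2), lineDensity G z.1 r} := by
    have : {z : C(I, X) × I | ∀ s ∈ D, ‖f (z.1 z.2) - f (z.1 s)‖ₑ ≤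
      ∫⁻ r in Ioc (min s z.2) (max s z.2), lineDensity G z.1 r} =
      ⋂ s ∈ D, {z | ‖f (z.1 z.2) - f (z.1 s)‖ₑ ≤
        ∫⁻ r in Ioc (min s z.2) (max s z.2), lineDensity G z.1 r} := by
      ext z
      simp only [mem_iInter]
      rfl
    rw [this]
    refine MeasurableSet.biInter hDc fun s _ => measurableSet_le ?_
      (measurable_lintegral_between (measurable_lineDensity hG.measurable) s)
    exact ((hf.comp measurable_uncurry_curve).sub
      (hf.comp ((measurable_eval_curve s).comp measurable_fst))).enorm
  have h1 := (Measure.ae_ae_comm (μ := π) (ν := (volume : Measure I)) hmeas).2 (ae_of_all _ hpt)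
  filter_upwards [h1, hpt 0, hpt 1] with γ hγ hγ0 hγ1
  exact ⟨_, hγ, hγ0, hγ1, incrementBound_of_dense hDd⟩

/-- `G` is only locally `p`-integrable, but every curve stays in some compact `K n`. Bounded
compression makes `G ^ p` integrable along almost every curve inside each `K n`, and Hölder against
the finite `q`-energy concludes. -/
lemma ae_lintegral_lineDensity_lt_top [ProperSpace X] {p : ℝ} (hp : 1 < p) {G : X → ℝ}
    (hG : Measurable G) (hGp : MemLpLoc m p ⊤ G) {π : Measure C(I, X)}
    (hπ : IsTestPlan m (Real.conjExponent p) π) :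
    ∀ᵐ γ ∂π, ∫⁻ r, lineDensity G γ r < ∞ := by
  have := hπ.isProbabilityMeasure
  obtain ⟨C, hC⟩ := hπ.boundedCompression
  have hp0 : 0 < p := zero_lt_one.trans hp
  let K : CompactExhaustion X := default
  have hKm : ∀ n, MeasurableSet (K n) := fun n => (K.isCompact n).measurableSet
  have hfinK : ∀ n, ∫⁻ x in K n, ENNReal.ofReal (G x) ^ p ∂m < ∞ := by
    intro n
    have h := (hGp (K n) (K.isCompact n) (fun _ _ => trivial)).2
    rw [eLpNorm_lt_top_iff_lintegral_rpow_enorm_lt_top (by simpa using hp0)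
      ENNReal.ofReal_ne_top, ENNReal.toReal_ofReal hp0.le] at h
    refine lt_of_le_of_lt (lintegral_mono fun x => ?_) h
    gcongr
    exact Real.ofReal_le_enorm _
  have hgm : ∀ n, Measurable ((K n).indicator fun x => ENNReal.ofReal (G x) ^ p) := fun n =>
    (hG.ennreal_ofReal.pow_const p).indicator (hKm n)
  have hn : ∀ n, ∀ᵐ γ ∂π,
      ∫⁻ r : I, (K n).indicator (fun x => ENNReal.ofReal (G x) ^ p) (γ r) < ∞ := by
    intro n
    refine ae_lt_top ((hgm n).comp measurable_uncurry_curve).lintegral_prod_right' ?_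
    rw [lintegral_lintegral_swap (show AEMeasurable (Function.uncurry fun (γ : C(I, X)) (r : I) =>
      (K n).indicator (fun x => ENNReal.ofReal (G x) ^ p) (γ r)) (π.prod volume) from
      ((hgm n).comp measurable_uncurry_curve).aemeasurable)]
    have hle : ∀ r : I, ∫⁻ γ, (K n).indicator (fun x => ENNReal.ofReal (G x) ^ p) (γ r) ∂π ≤
        C * ∫⁻ x in K n, ENNReal.ofReal (G x) ^ p ∂m := by
      intro r
      rw [← lintegral_map (hgm n) (measurable_eval_curve r), ← lintegral_indicator (hKm n)]
      refine (lintegral_mono' (hC r) le_rfl).trans ?_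
      rw [lintegral_smul_measure]
      rfl
    refine ne_top_of_le_ne_top ?_ (lintegral_mono hle)
    simpa using ENNReal.mul_ne_top ENNReal.coe_ne_top (hfinK n).ne
  filter_upwards [ae_all_iff.2 hn, hπ.ae_energy_lt_top] with γ h1 h2
  obtain ⟨n, hn⟩ := K.exists_superset_of_isCompact (isCompact_range γ.continuous)
  have h3 : ∫⁻ r : I, ENNReal.ofReal (G (γ r)) ^ p < ∞ := by
    refine lt_of_le_of_lt (lintegral_mono fun r => ?_) (h1 n)
    rw [indicator_of_mem (hn (mem_range_self r))]
  have hH := ENNReal.lintegral_mul_le_Lp_mul_Lq volume (Real.HolderConjugate.conjExponent hp)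
    (hG.comp γ.continuous.measurable).ennreal_ofReal.aemeasurable
    (measurable_metricSpeed_apply γ).aemeasurable
  refine lt_of_le_of_lt hH (ENNReal.mul_lt_top ?_ ?_)
  · exact ENNReal.rpow_lt_top_of_nonneg (by positivity) h3.ne
  · exact ENNReal.rpow_lt_top_of_nonneg
      (one_div_nonneg.2 (zero_le_one.trans (one_le_conjExponent hp))) h2.ne

end Plans

/-! ## Calculus of weak upper gradients -/

section Gradients

variable {X : Type*} [MetricSpace X] [MeasurableSpace X] [BorelSpace X] {m : Measure X} {p : ℝ}

lemma MemLpLoc.of_abs_le {Ω : Opens X} {G H : X → ℝ} (hG : MemLpLoc m p Ω G)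
    (hH : Measurable H) (h : ∀ x, |H x| ≤ |G x|) : MemLpLoc m p Ω H := fun K hK hKΩ =>
  (hG K hK hKΩ).mono hH.aestronglyMeasurable (ae_of_all _ h)

lemma MemLpLoc.mono_exponent [IsFiniteMeasureOnCompacts m] {p' : ℝ} (hp : p ≤ p') {Ω : Opens X}
    {G : X → ℝ} (hG : MemLpLoc m p' Ω G) : MemLpLoc m p Ω G := fun K hK hKΩ => by
  have : IsFiniteMeasure (m.restrict K) := ⟨by simpa using hK.measure_lt_top⟩
  exact (hG K hK hKΩ).mono_exponent (ENNReal.ofReal_le_ofReal hp)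

/-- Conjugation reverses the order of exponents, so there are fewer test plans for `p` than for
`p'`. -/
lemma IsWeakUpperGradient.mono_exponent {p' : ℝ} (hp : 1 < p) (hpp : p ≤ p') {f G : X → ℝ}
    (hG : IsWeakUpperGradient m p' f G) : IsWeakUpperGradient m p f G := by
  refine ⟨hG.measurable, hG.nonneg, fun π hπ => hG.le π (hπ.mono ?_ ?_)⟩
  · exact zero_lt_one.trans_le (one_le_conjExponent (hp.trans_le hpp))
  · rw [Real.conjExponent, Real.conjExponent, div_le_div_iff₀ (by linarith) (by linarith)]
    nlinarith

lemma IsWeakUpperGradient.linear {f f' G G' : X → ℝ} (hG : IsWeakUpperGradient m p f G)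
    (hG' : IsWeakUpperGradient m p f' G') (hf : Measurable f) (c d : ℝ) :
    IsWeakUpperGradient m p (fun x => c * f x + d * f' x) (fun x => |c| * G x + |d| * G' x) := by
  refine ⟨(hG.measurable.const_mul _).add (hG'.measurable.const_mul _), fun x =>
    add_nonneg (mul_nonneg (abs_nonneg _) (hG.nonneg x))
      (mul_nonneg (abs_nonneg _) (hG'.nonneg x)), fun π hπ => ?_⟩
  have hm : Measurable fun γ : C(I, X) => ‖f (γ 1) - f (γ 0)‖ₑ :=
    ((hf.comp (measurable_eval_curve 1)).sub (hf.comp (measurable_eval_curve 0))).enorm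
  have hd : ∀ (γ : C(I, X)) (r : I),
      ENNReal.ofReal (|c| * G (γ r) + |d| * G' (γ r)) * metricSpeed γ r =
        ‖c‖ₑ * lineDensity G γ r + ‖d‖ₑ * lineDensity G' γ r := by
    intro γ r
    rw [ENNReal.ofReal_add (mul_nonneg (abs_nonneg _) (hG.nonneg _))
      (mul_nonneg (abs_nonneg _) (hG'.nonneg _)), ENNReal.ofReal_mul (abs_nonneg _),
      ENNReal.ofReal_mul (abs_nonneg _), add_mul, mul_assoc, mul_assoc, Real.enorm_eq_ofReal_abs,
      Real.enorm_eq_ofReal_abs]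
    rfl
  calc ∫⁻ γ, ‖(c * f (γ 1) + d * f' (γ 1)) - (c * f (γ 0) + d * f' (γ 0))‖ₑ ∂π
      ≤ ∫⁻ γ, ‖c‖ₑ * ‖f (γ 1) - f (γ 0)‖ₑ + ‖d‖ₑ * ‖f' (γ 1) - f' (γ 0)‖ₑ ∂π := by
        refine lintegral_mono fun γ => ?_
        rw [← enorm_mul, ← enorm_mul]
        refine le_trans (le_of_eq ?_) (enorm_add_le _ _)
        congr 1
        ring
    _ = ‖c‖ₑ * ∫⁻ γ, ‖f (γ 1) - f (γ 0)‖ₑ ∂π + ‖d‖ₑ * ∫⁻ γ, ‖f' (γ 1) - f' (γ 0)‖ₑ ∂π := by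
        rw [lintegral_add_left (hm.const_mul _), lintegral_const_mul' _ _ enorm_ne_top,
          lintegral_const_mul' _ _ enorm_ne_top]
    _ ≤ ‖c‖ₑ * ∫⁻ γ, (∫⁻ r, lineDensity G γ r) ∂π +
          ‖d‖ₑ * ∫⁻ γ, (∫⁻ r, lineDensity G' γ r) ∂π := by
        exact add_le_add (mul_le_mul_right (hG.le π hπ) _) (mul_le_mul_right (hG'.le π hπ) _)
    _ = _ := by
        simp only [hd]
        rw [← lintegral_const_mul' _ _ enorm_ne_top, ← lintegral_const_mul' _ _ enorm_ne_top,
          ← lintegral_add_left ((measurable_lintegral_lineDensity hG.measurable).const_mul _)]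
        refine lintegral_congr fun γ => ?_
        rw [lintegral_add_left ((measurable_lineDensity_apply hG.measurable γ).const_mul _),
          lintegral_const_mul' _ _ enorm_ne_top, lintegral_const_mul' _ _ enorm_ne_top]

lemma LipschitzWith.isWeakUpperGradient (hp : 1 < p) {f : X → ℝ} {L : ℝ≥0}
    (hf : LipschitzWith L f) : IsWeakUpperGradient m p f (fun _ => (L : ℝ)) := by
  refine ⟨measurable_const, fun _ => L.2, fun π hπ => lintegral_mono_ae ?_⟩
  filter_upwards [hπ.ae_isAC] with γ hγ
  rw [ENNReal.ofReal_coe_nnreal, lintegral_const_mul _ (measurable_metricSpeed_apply γ),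
    ← edist_eq_enorm_sub]
  exact (hf _ _).trans (mul_le_mul_right (hγ.edist_le (one_le_conjExponent hp)) _)

open Classical in
/-- On the set where two functions agree, each of them may use the weak upper gradient of the
other. -/
lemma IsWeakUpperGradient.combine [ProperSpace X] (hp : 1 < p) {f f' G G' : X → ℝ}
    (hf : Measurable f) (hf' : Measurable f') (hG : IsWeakUpperGradient m p f G)
    (hG' : IsWeakUpperGradient m p f' G') (hGp : MemLpLoc m p ⊤ G) (hGp' : MemLpLoc m p ⊤ G') :
    IsWeakUpperGradient m p f (fun x => if f x = f' x then min (G x) (G' x) else G x) := by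
  refine ⟨Measurable.ite (measurableSet_eq_fun hf hf') (hG.measurable.min hG'.measurable)
    hG.measurable, fun x => ?_, fun π hπ => lintegral_mono_ae ?_⟩
  · split_ifs
    exacts [le_min (hG.nonneg x) (hG'.nonneg x), hG.nonneg x]
  filter_upwards [hG.ae_exists_incrementBound hp hf hπ, hG'.ae_exists_incrementBound hp hf' hπ,
    ae_lintegral_lineDensity_lt_top hp hG.measurable hGp hπ,
    ae_lintegral_lineDensity_lt_top hp hG'.measurable hGp' hπ]
    with γ ⟨S, hS, hS0, hS1, hb⟩ ⟨S', hS', hS0', hS1', hb'⟩ hfin hfin'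
  refine ((hb.mono inter_subset_left).enorm_sub_le (hb'.mono inter_subset_right)
    (measurable_lineDensity_apply hG.measurable γ) (measurable_lineDensity_apply hG'.measurable γ)
    hfin.ne hfin'.ne (hS.and hS') ⟨hS0, hS0'⟩ ⟨hS1, hS1'⟩).trans (lintegral_mono fun r => ?_)
  simp only [lineDensity]
  split_ifs
  · rcases le_total (G (γ r)) (G' (γ r)) with h | h
    · rw [min_eq_left h]; exact min_le_left _ _
    · rw [min_eq_right h]; exact min_le_right _ _
  · exact le_rfl

lemma MemLpLoc.combine {f f' G G' : X → ℝ} (hf : Measurable f) (hf' : Measurable f')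
    (hG : Measurable G) (hG' : Measurable G') (hG0 : ∀ x, 0 ≤ G x) (hG0' : ∀ x, 0 ≤ G' x)
    (hGp : MemLpLoc m p ⊤ G) [DecidablePred fun x => f x = f' x] :
    MemLpLoc m p ⊤ (fun x => if f x = f' x then min (G x) (G' x) else G x) := by
  refine hGp.of_abs_le (Measurable.ite (measurableSet_eq_fun hf hf') (hG.min hG') hG) fun x => ?_
  split_ifs
  · rw [abs_of_nonneg (le_min (hG0 x) (hG0' x)), abs_of_nonneg (hG0 x)]
    exact min_le_left _ _
  · exact le_rfl

lemma IsWeakUpperGradient.min [ProperSpace X] (hp : 1 < p) {f G G' : X → ℝ}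
    (hf : Measurable f) (hG : IsWeakUpperGradient m p f G)
    (hG' : IsWeakUpperGradient m p f G') (hGp : MemLpLoc m p ⊤ G) (hGp' : MemLpLoc m p ⊤ G') :
    IsWeakUpperGradient m p f (fun x => min (G x) (G' x)) := by
  simpa using hG.combine hp hf hf hG' hGp hGp'

/-- Dominated convergence is applied along each curve separately, with `lineDensity (G 0) γ` as the
majorant. -/
lemma IsWeakUpperGradient.iInf [ProperSpace X] (hp : 1 < p) {f : X → ℝ} {G : ℕ → X → ℝ}
    (hf : Measurable f) (hG : ∀ n, IsWeakUpperGradient m p f (G n)) (hanti : Antitone G)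
    (hGp : MemLpLoc m p ⊤ (G 0)) : IsWeakUpperGradient m p f (fun x => ⨅ n, G n x) := by
  have hbdd : ∀ x, BddBelow (range fun n => G n x) := fun x =>
    ⟨0, by rintro _ ⟨n, rfl⟩; exact (hG n).nonneg x⟩
  have hmeas : Measurable fun x => ⨅ n, G n x := Measurable.iInf fun n => (hG n).measurable
  refine ⟨hmeas, fun x => le_ciInf fun n => (hG n).nonneg x, fun π hπ => lintegral_mono_ae ?_⟩
  have hle : ∀ᵐ γ ∂π, ∀ n, ‖f (γ 1) - f (γ 0)‖ₑ ≤ ∫⁻ r, lineDensity (G n) γ r := by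
    rw [ae_all_iff]
    intro n
    filter_upwards [(hG n).ae_enorm_sub_le hp hf hπ (zero_le_one' I)] with γ hγ
    exact hγ.trans (setLIntegral_le_lintegral _ _)
  filter_upwards [hle, ae_lintegral_lineDensity_lt_top hp (hG 0).measurable hGp hπ,
    hπ.ae_energy_lt_top] with γ hγ hfin hE
  have hq0 : 0 < Real.conjExponent p := zero_lt_one.trans_le (one_le_conjExponent hp)
  have hlim : Tendsto (fun n => ∫⁻ r, lineDensity (G n) γ r) atTop
      (𝓝 (∫⁻ r, lineDensity (fun x => ⨅ n, G n x) γ r)) := by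
    refine tendsto_lintegral_of_dominated_convergence (lineDensity (G 0) γ)
      (fun n => measurable_lineDensity_apply (hG n).measurable γ)
      (fun n => ae_of_all _ fun r => ?_) hfin.ne ?_
    · exact mul_le_mul_left (ENNReal.ofReal_le_ofReal (hanti (Nat.zero_le n) (γ r))) _
    · filter_upwards [ae_lt_top ((measurable_metricSpeed_apply γ).pow_const _) hE.ne] with r hr
      have hr' : metricSpeed γ r < ∞ := (ENNReal.rpow_lt_top_iff_of_pos hq0).1 hr
      refine ENNReal.Tendsto.mul_const (ENNReal.tendsto_ofReal ?_) (Or.inr hr'.ne)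
      exact tendsto_atTop_ciInf (fun i j hij => hanti hij (γ r)) (hbdd (γ r))
  exact ge_of_tendsto' hlim hγ

/-! ### Existence and calculus of minimal weak upper gradients -/

/-- The direct method: minimise `∫ G / (1 + G)` against a finite measure with the same null sets as
`m`. The function `t / (1 + t)` is bounded, so no integrability is required of `G`, and strictly
increasing, so a minimiser over a class closed under minima lies a.e. below every competitor. -/
lemma exists_isMinimalGradient [ProperSpace X] [SFinite m] (hp : 1 < p) {f : X → ℝ}
    (hf : MemSobolevLoc m p f) : ∃ G, IsMinimalGradient m p f G := by
  obtain ⟨hfm, G₀, hG₀, hG₀p⟩ := hf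
  let W : Set (X → ℝ) := {G | IsWeakUpperGradient m p f G ∧ MemLpLoc m p ⊤ G}
  let Φ : (X → ℝ) → ℝ := fun G => ∫ x, G x / (1 + G x) ∂m.toFinite
  have hψ : ∀ {a b : ℝ}, 0 ≤ a → a ≤ b → a / (1 + a) ≤ b / (1 + b) := by
    intro a b ha hab
    rw [div_le_div_iff₀ (by linarith) (by linarith)]
    nlinarith
  have hint : ∀ {G : X → ℝ}, Measurable G → (∀ x, 0 ≤ G x) →
      Integrable (fun x => G x / (1 + G x)) m.toFinite := by
    intro G hG hG0
    refine (integrable_const (1 : ℝ)).mono (hG.div (hG.const_add 1)).aestronglyMeasurable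
      (ae_of_all _ fun x => ?_)
    have := hG0 x
    rw [Real.norm_of_nonneg (by positivity), norm_one, div_le_one (by positivity)]
    linarith
  have hΦmono : ∀ {G H : X → ℝ}, Measurable G → Measurable H → (∀ x, 0 ≤ G x) →
      (∀ x, G x ≤ H x) → Φ G ≤ Φ H := fun hG hH hG0 hGH =>
    integral_mono (hint hG hG0) (hint hH fun x => (hG0 x).trans (hGH x))
      fun x => hψ (hG0 x) (hGH x)
  have hΦ0 : BddBelow (Φ '' W) := by
    refine ⟨0, ?_⟩
    rintro _ ⟨G, hG, rfl⟩
    exact integral_nonneg fun x => by have := hG.1.nonneg x; positivity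
  obtain ⟨y, -, hylim, hy⟩ := exists_seq_tendsto_sInf (S := Φ '' W) ⟨_, G₀, ⟨hG₀, hG₀p⟩, rfl⟩ hΦ0
  choose G hGW hGy using hy
  have hminW : ∀ {G H : X → ℝ}, G ∈ W → H ∈ W → (fun x => min (G x) (H x)) ∈ W := by
    intro G H hG hH
    have h := hG.1.min hp hfm hH.1 hG.2 hH.2
    refine ⟨h, hG.2.of_abs_le h.measurable fun x => ?_⟩
    rw [abs_of_nonneg (h.nonneg x), abs_of_nonneg (hG.1.nonneg x)]
    exact min_le_left _ _
  -- Running minima turn the minimising sequence into a decreasing one, to which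
  -- `IsWeakUpperGradient.iInf` applies.
  let H : ℕ → X → ℝ := fun n => Nat.rec (G 0) (fun k Hk x => min (Hk x) (G (k + 1) x)) n
  have hHW : ∀ n, H n ∈ W := fun n => by
    induction n with
    | zero => exact hGW 0
    | succ k ih => exact hminW ih (hGW (k + 1))
  have hHG : ∀ n x, H n x ≤ G n x := fun n x => by
    cases n with
    | zero => exact le_rfl
    | succ k => exact min_le_right _ _
  have hanti : Antitone H := antitone_nat_of_succ_le fun n x => min_le_left _ _
  have hbdd : ∀ x, BddBelow (range fun n => H n x) := fun x =>
    ⟨0, by rintro _ ⟨n, rfl⟩; exact (hHW n).1.nonneg x⟩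
  have hinf := IsWeakUpperGradient.iInf hp hfm (fun n => (hHW n).1) hanti (hHW 0).2
  have hinfW : (fun x => ⨅ n, H n x) ∈ W := by
    refine ⟨hinf, (hHW 0).2.of_abs_le hinf.measurable fun x => ?_⟩
    rw [abs_of_nonneg (hinf.nonneg x), abs_of_nonneg ((hHW 0).1.nonneg x)]
    exact ciInf_le (hbdd x) 0
  have hΦinf : Φ (fun x => ⨅ n, H n x) ≤ sInf (Φ '' W) := by
    refine ge_of_tendsto' hylim fun n => ?_
    rw [← hGy n]
    exact hΦmono hinf.measurable (hGW n).1.measurable hinf.nonneg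
      fun x => (ciInf_le (hbdd x) n).trans (hHG n x)
  refine ⟨_, hinf, hinfW.2, fun G' hG' hG'p => ?_⟩
  have hmW := hminW hinfW ⟨hG', hG'p⟩
  -- Taking the minimum with `G'` cannot lower the already minimal `Φ`, so the ordered integrands
  -- must agree a.e.
  have heq : Φ (fun x => min (⨅ n, H n x) (G' x)) = Φ (fun x => ⨅ n, H n x) :=
    le_antisymm (hΦmono hmW.1.measurable hinf.measurable hmW.1.nonneg fun x => min_le_left _ _)
      (hΦinf.trans (csInf_le hΦ0 ⟨_, hmW, rfl⟩))
  have hae := (integral_eq_iff_of_ae_le (hint hmW.1.measurable hmW.1.nonneg)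
    (hint hinf.measurable hinf.nonneg)
    (ae_of_all _ fun x => hψ (hmW.1.nonneg x) (min_le_left _ _))).1 heq
  have hae' := Measure.AbsolutelyContinuous.ae_le (absolutelyContinuous_toFinite m) hae
  filter_upwards [hae'] with x hx
  by_contra! hlt
  have h0 := hG'.nonneg x
  rw [min_eq_right hlt.le, div_eq_div_iff (by linarith) (by linarith)] at hx
  linarith

lemma minGradient_spec [ProperSpace X] [SFinite m] (hp : 1 < p) {f : X → ℝ}
    (hf : MemSobolevLoc m p f) : IsMinimalGradient m p f (minGradient m p f) := by
  have h := exists_isMinimalGradient hp hf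
  rw [minGradient, dif_pos h]
  exact h.choose_spec

lemma measurable_minGradient (f : X → ℝ) : Measurable (minGradient m p f) := by
  rw [minGradient]
  split_ifs with h
  · exact h.choose_spec.weakUpperGradient.measurable
  · exact measurable_const

lemma minGradient_nonneg (f : X → ℝ) (x : X) : 0 ≤ minGradient m p f x := by
  rw [minGradient]
  split_ifs with h
  · exact h.choose_spec.weakUpperGradient.nonneg x
  · exact le_rfl

lemma MemLpLoc.linear {Ω : Opens X} {G G' : X → ℝ} (hG : MemLpLoc m p Ω G)
    (hG' : MemLpLoc m p Ω G') (c d : ℝ) : MemLpLoc m p Ω (fun x => c * G x + d * G' x) :=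
  fun K hK hKΩ => ((hG K hK hKΩ).const_mul c).add ((hG' K hK hKΩ).const_mul d)

lemma MemSobolevLoc.linear {f f' : X → ℝ} (hf : MemSobolevLoc m p f) (hf' : MemSobolevLoc m p f')
    (c d : ℝ) : MemSobolevLoc m p (fun x => c * f x + d * f' x) := by
  obtain ⟨hfm, G, hG, hGp⟩ := hf
  obtain ⟨hfm', G', hG', hGp'⟩ := hf'
  exact ⟨(hfm.const_mul c).add (hfm'.const_mul d), _, hG.linear hG' hfm c d, hGp.linear hGp' _ _⟩

lemma memLpLoc_const [IsFiniteMeasureOnCompacts m] (Ω : Opens X) (c : ℝ) :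
    MemLpLoc m p Ω (fun _ => c) := fun K hK _ => by
  have : IsFiniteMeasure (m.restrict K) := ⟨by simpa using hK.measure_lt_top⟩
  exact memLp_const c

lemma LipschitzWith.memSobolevLoc [IsFiniteMeasureOnCompacts m] (hp : 1 < p) {f : X → ℝ} {L : ℝ≥0}
    (hf : LipschitzWith L f) : MemSobolevLoc m p f :=
  ⟨hf.continuous.measurable, _, LipschitzWith.isWeakUpperGradient hp hf, memLpLoc_const _ _⟩

lemma MemSobolevLoc.mono_exponent [IsFiniteMeasureOnCompacts m] {p' : ℝ} (hp : 1 < p)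
    (hpp : p ≤ p') {f : X → ℝ} (hf : MemSobolevLoc m p' f) : MemSobolevLoc m p f := by
  obtain ⟨hfm, G, hG, hGp⟩ := hf
  exact ⟨hfm, G, hG.mono_exponent hp hpp, hGp.mono_exponent hpp⟩

variable [ProperSpace X] [SFinite m]

lemma minGradient_linear_le (hp : 1 < p) {f f' : X → ℝ} (hf : MemSobolevLoc m p f)
    (hf' : MemSobolevLoc m p f') (c d : ℝ) :
    ∀ᵐ x ∂m, minGradient m p (fun x => c * f x + d * f' x) x ≤
      |c| * minGradient m p f x + |d| * minGradient m p f' x := by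
  have h := minGradient_spec hp hf
  have h' := minGradient_spec hp hf'
  exact (minGradient_spec hp (hf.linear hf' c d)).minimal _
    (h.weakUpperGradient.linear h'.weakUpperGradient hf.1 c d) (h.memLpLoc.linear h'.memLpLoc _ _)

lemma minGradient_le_of_eq (hp : 1 < p) {f f' : X → ℝ} (hf : MemSobolevLoc m p f)
    (hf' : MemSobolevLoc m p f') :
    ∀ᵐ x ∂m, f x = f' x → minGradient m p f x ≤ minGradient m p f' x := by
  classical
  have h := minGradient_spec hp hf
  have h' := minGradient_spec hp hf'
  filter_upwards [h.minimal _ (h.weakUpperGradient.combine hp hf.1 hf'.1 h'.weakUpperGradient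
    h.memLpLoc h'.memLpLoc) (h.memLpLoc.combine hf.1 hf'.1 h.weakUpperGradient.measurable
      h'.weakUpperGradient.measurable h.weakUpperGradient.nonneg h'.weakUpperGradient.nonneg)]
    with x hx he
  rw [if_pos he] at hx
  exact hx.trans (min_le_right _ _)

/-- Strong locality of minimal weak upper gradients. -/
lemma minGradient_eq_of_eq (hp : 1 < p) {f f' : X → ℝ} (hf : MemSobolevLoc m p f)
    (hf' : MemSobolevLoc m p f') :
    ∀ᵐ x ∂m, f x = f' x → minGradient m p f x = minGradient m p f' x := by
  filter_upwards [minGradient_le_of_eq hp hf hf', minGradient_le_of_eq hp hf' hf] with x h h' he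
  exact le_antisymm (h he) (h' he.symm)

lemma minGradient_le_of_lipschitz [IsFiniteMeasureOnCompacts m] (hp : 1 < p) {f : X → ℝ} {L : ℝ≥0}
    (hf : LipschitzWith L f) : ∀ᵐ x ∂m, minGradient m p f x ≤ L :=
  (minGradient_spec hp (LipschitzWith.memSobolevLoc hp hf)).minimal _
    (LipschitzWith.isWeakUpperGradient hp hf) (memLpLoc_const _ _)

/-- The minimal `p`-weak upper gradient of a function in a smaller Sobolev class is integrable
with the larger exponent. -/
lemma MemSobolevLoc.memLpLoc_minGradient [IsFiniteMeasureOnCompacts m] {p' : ℝ} (hp : 1 < p)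
    (hpp : p ≤ p') {f : X → ℝ} (hf : MemSobolevLoc m p' f) :
    MemLpLoc m p' ⊤ (minGradient m p f) := by
  obtain ⟨hfm, G, hG, hGp⟩ := hf
  have h := (minGradient_spec hp (MemSobolevLoc.mono_exponent hp hpp ⟨hfm, G, hG, hGp⟩)).minimal G
    (hG.mono_exponent hp hpp) (hGp.mono_exponent hpp)
  intro K hK hKΩ
  refine (hGp K hK hKΩ).mono (measurable_minGradient f).aestronglyMeasurable
    (ae_restrict_of_ae ?_)
  filter_upwards [h] with x hx
  rwa [Real.norm_of_nonneg (minGradient_nonneg f x), Real.norm_of_nonneg (hG.nonneg x)]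

lemma memLp_of_forall_notMem_eq_zero {G : X → ℝ} (hG : MemLpLoc m p ⊤ G) {K : Set X}
    (hK : IsCompact K) (h0 : ∀ x ∉ K, G x = 0) : MemLp G (ENNReal.ofReal p) m := by
  have := (memLp_indicator_iff_restrict hK.measurableSet).2 (hG K hK fun _ _ => trivial)
  rwa [indicator_eq_self.2 (fun x hx => by_contra fun h => hx (h0 x h))] at this

/-- Combining with the zero function produces a weak upper gradient that vanishes wherever `f` does,
so local integrability becomes global. -/
lemma MemSobolevLoc.memSobolev_of_compact [IsFiniteMeasureOnCompacts m] (hp : 1 < p) {f : X → ℝ}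
    (hf : MemSobolevLoc m p f) {K : Set X} (hK : IsCompact K) (h0 : ∀ x ∉ K, f x = 0) :
    MemSobolev m p f := by
  classical
  obtain ⟨hfm, G, hG, hGp⟩ := hf
  have hz : IsWeakUpperGradient m p (fun _ : X => (0 : ℝ)) (fun _ => 0) := by
    simpa using LipschitzWith.isWeakUpperGradient (m := m) hp (LipschitzWith.const (0 : ℝ))
  have hz0 : MemLpLoc m p ⊤ (fun _ : X => (0 : ℝ)) := memLpLoc_const _ _
  refine ⟨hfm, _, hG.combine hp hfm measurable_const hz hGp hz0,
    memLp_of_forall_notMem_eq_zero (hGp.combine hfm measurable_const hG.measurable hz.measurable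
      hG.nonneg hz.nonneg) hK fun x hx => ?_⟩
  rw [if_pos (h0 x hx), min_eq_right (hG.nonneg x)]

lemma MemSobolev.memSobolevLoc {f : X → ℝ} (hf : MemSobolev m p f) : MemSobolevLoc m p f := by
  obtain ⟨hfm, G, hG, hGp⟩ := hf
  exact ⟨hfm, G, hG, fun K _ _ => hGp.restrict K⟩

lemma MemSobolev.memLp_minGradient (hp : 1 < p) {f : X → ℝ} (hf : MemSobolev m p f) :
    MemLp (minGradient m p f) (ENNReal.ofReal p) m := by
  have h := minGradient_spec hp hf.memSobolevLoc
  obtain ⟨hfm, G, hG, hGp⟩ := hf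
  refine hGp.mono (measurable_minGradient f).aestronglyMeasurable ?_
  filter_upwards [h.minimal G hG fun K _ _ => hGp.restrict K] with x hx
  rwa [Real.norm_of_nonneg (minGradient_nonneg f x), Real.norm_of_nonneg (hG.nonneg x)]

end Gradients

/-! ## Doubling spaces are proper -/

section Doubling

variable {X : Type*} [MetricSpace X] [MeasurableSpace X] {m : Measure X}

lemma IsDoubling.exists_ball_le (hm : IsDoubling m) : ∃ C : ℝ≥0, ∀ (k : ℕ) (x : X) (r : ℝ), 0 < r →
    m (Metric.ball x (2 ^ k * r)) ≤ (C : ℝ≥0∞) ^ k * m (Metric.ball x r) := by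
  obtain ⟨C, hC⟩ := hm.doubling
  refine ⟨C, fun k x r hr => ?_⟩
  induction k with
  | zero => simp
  | succ k ih =>
    calc m (Metric.ball x (2 ^ (k + 1) * r)) = m (Metric.ball x (2 * (2 ^ k * r))) := by
          rw [pow_succ']; ring_nf
      _ ≤ C * m (Metric.ball x (2 ^ k * r)) := hC x _ (by positivity)
      _ ≤ C * ((C : ℝ≥0∞) ^ k * m (Metric.ball x r)) := mul_le_mul_right ih _
      _ = _ := by rw [pow_succ', mul_assoc]

/-- Otherwise there is an infinite `ε`-separated sequence in the ball. The balls of radius `ε / 2`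
around its points are disjoint, lie in a ball of finite mass, and by iterated doubling have masses
bounded below by a common positive constant. -/
lemma IsDoubling.totallyBounded_closedBall [OpensMeasurableSpace X] (hm : IsDoubling m) (x : X)
    (R : ℝ) : TotallyBounded (Metric.closedBall x R) := by
  rw [Metric.totallyBounded_iff]
  intro ε hε
  by_contra! hcon
  obtain ⟨C, hC⟩ := hm.exists_ball_le
  obtain ⟨f, hf, hfd⟩ := exists_seq_of_forall_finset_exists
    (fun y : X => y ∈ Metric.closedBall x R) (fun y z => ε ≤ dist y z) (fun t _ => by
      obtain ⟨y, hy, hyt⟩ := not_subset.1 (hcon t t.finite_toSet)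
      refine ⟨y, hy, fun z hz => ?_⟩
      by_contra! hlt
      exact hyt (mem_biUnion hz (by rwa [Metric.mem_ball, dist_comm])))
  have hR : 0 ≤ R := dist_nonneg.trans (hf 0)
  -- Chosen so that `2 ^ k * (ε / 2) > 2 * R + ε`: a ball of that radius around any `f n` contains
  -- `ball x (R + ε)`.
  obtain ⟨k, hk⟩ := pow_unbounded_of_one_lt ((2 * R + ε) / (ε / 2)) one_lt_two
  rw [div_lt_iff₀ (by positivity)] at hk
  have hdisj : Pairwise (Function.onFun Disjoint fun n => Metric.ball (f n) (ε / 2)) := by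
    intro i j hij
    refine Metric.ball_disjoint_ball ?_
    rcases lt_or_gt_of_ne hij with h | h
    · linarith [hfd i j h]
    · linarith [hfd j i h, dist_comm (f i) (f j)]
  have hsub : ⋃ n, Metric.ball (f n) (ε / 2) ⊆ Metric.ball x (R + ε) :=
    iUnion_subset fun n => Metric.ball_subset_ball' (by
      have : dist (f n) x ≤ R := hf n
      linarith)
  have hlow : ∀ n, m (Metric.ball x (R + ε)) / (C : ℝ≥0∞) ^ k ≤ m (Metric.ball (f n) (ε / 2)) := by
    intro n
    refine ENNReal.div_le_of_le_mul' (le_trans (measure_mono ?_) (hC k (f n) (ε / 2) (by positivity)))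
    refine Metric.ball_subset_ball' ?_
    have : dist (f n) x ≤ R := hf n
    rw [dist_comm]
    linarith
  have hpos : 0 < m (Metric.ball x (R + ε)) / (C : ℝ≥0∞) ^ k :=
    ENNReal.div_pos (hm.ball_pos x _ (by linarith)).ne' (ENNReal.pow_ne_top ENNReal.coe_ne_top)
  have hfin := Measure.finite_const_le_meas_of_disjoint_iUnion m hpos
    (fun n => Metric.isOpen_ball.measurableSet) hdisj
    (ne_top_of_le_ne_top (hm.ball_lt_top x (R + ε)).ne (measure_mono hsub))
  exact infinite_univ (hfin.subset fun n _ => hlow n)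

lemma IsDoubling.properSpace [OpensMeasurableSpace X] [CompleteSpace X] (hm : IsDoubling m) :
    ProperSpace X :=
  ⟨fun x r => isCompact_iff_totallyBounded_isComplete.2
    ⟨hm.totallyBounded_closedBall x r, Metric.isClosed_closedBall.isComplete⟩⟩

lemma IsDoubling.isFiniteMeasureOnCompacts (hm : IsDoubling m) : IsFiniteMeasureOnCompacts m := by
  refine ⟨fun K hK => ?_⟩
  rcases K.eq_empty_or_nonempty with rfl | ⟨x, -⟩
  · simp
  obtain ⟨r, hr⟩ := hK.isBounded.subset_ball x
  exact (measure_mono hr).trans_lt (hm.ball_lt_top x r)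

end Doubling

/-! ## Cut-off functions -/

section Cutoff

variable {X : Type*} [MetricSpace X]

lemma IsCutoff.mono {U Ω : Opens X} (hU : U ≤ Ω) {χ : X → ℝ} (h : IsCutoff U χ) : IsCutoff Ω χ :=
  ⟨h.lipschitz, h.mem_Icc, h.hasCompactSupport, h.tsupport_subset.trans hU⟩

lemma IsTest.mono {U Ω : Opens X} (hU : U ≤ Ω) {f : X → ℝ} (h : IsTest U f) : IsTest Ω f :=
  ⟨h.lipschitz, h.hasCompactSupport, h.tsupport_subset.trans hU⟩

lemma IsTest.continuous {Ω : Opens X} {f : X → ℝ} (h : IsTest Ω f) : Continuous f :=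
  h.lipschitz.choose_spec.continuous

lemma IsCutoff.exists_lipschitzWith_mul {Ω U : Opens X} {χ f : X → ℝ} (hχ : IsCutoff Ω χ)
    (hf : IsTest U f) : ∃ L : ℝ≥0, LipschitzWith L fun x => χ x * f x := by
  obtain ⟨K, hK⟩ := hχ.lipschitz
  obtain ⟨L, hL⟩ := hf.lipschitz
  obtain ⟨M, hM⟩ := hf.hasCompactSupport.exists_bound_of_continuous hf.continuous
  refine ⟨K * M.toNNReal + L, LipschitzWith.of_dist_le_mul fun x y => ?_⟩
  have h1 := hK.dist_le_mul x y
  have h2 := hL.dist_le_mul x y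
  have h3 := hM x
  have h4 := hχ.mem_Icc y
  have h5 : M ≤ M.toNNReal := Real.le_coe_toNNReal M
  rw [Real.dist_eq] at h1 h2 ⊢
  rw [Real.norm_eq_abs] at h3
  have h6 : χ x * f x - χ y * f y = (χ x - χ y) * f x + χ y * (f x - f y) := by ring
  rw [h6]
  refine (abs_add_le _ _).trans ?_
  rw [abs_mul, abs_mul, abs_of_nonneg h4.1]
  push_cast
  have h7 : |χ x - χ y| * |f x| ≤ K * dist x y * M.toNNReal :=
    mul_le_mul h1 (h3.trans h5) (abs_nonneg _) (by positivity)
  have h8 : χ y * |f x - f y| ≤ 1 * (L * dist x y) :=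
    mul_le_mul h4.2 h2 (abs_nonneg _) zero_le_one
  nlinarith

lemma IsCutoff.mul_isTest {Ω U : Opens X} {χ f : X → ℝ} (hχ : IsCutoff Ω χ) (hf : IsTest U f) :
    IsTest Ω fun x => χ x * f x :=
  ⟨hχ.exists_lipschitzWith_mul hf, hχ.hasCompactSupport.mul_right,
    (tsupport_mul_subset_left (f := χ) (g := f)).trans hχ.tsupport_subset⟩

lemma IsTest.of_exists_lipschitz {Ω : Opens X} {f : X → ℝ} (hf : ∃ L : ℝ≥0, LipschitzWith L f)
    {K : Set X} (hK : IsCompact K) (hKΩ : K ⊆ Ω) (h : tsupport f ⊆ K) : IsTest Ω f :=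
  ⟨hf, hK.of_isClosed_subset (isClosed_tsupport f) h, h.trans hKΩ⟩

lemma IsTest.add {Ω : Opens X} {f g : X → ℝ} (hf : IsTest Ω f) (hg : IsTest Ω g) :
    IsTest Ω fun x => f x + g x := by
  obtain ⟨K, hK⟩ := hf.lipschitz
  obtain ⟨L, hL⟩ := hg.lipschitz
  exact IsTest.of_exists_lipschitz ⟨_, hK.add hL⟩
    (hf.hasCompactSupport.isCompact.union hg.hasCompactSupport.isCompact)
    (union_subset hf.tsupport_subset hg.tsupport_subset) (tsupport_add f g)

lemma IsTest.sub {Ω : Opens X} {f g : X → ℝ} (hf : IsTest Ω f) (hg : IsTest Ω g) :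
    IsTest Ω fun x => f x - g x := by
  obtain ⟨K, hK⟩ := hf.lipschitz
  obtain ⟨L, hL⟩ := hg.lipschitz
  refine IsTest.of_exists_lipschitz ⟨_, hK.sub hL⟩
    (hf.hasCompactSupport.isCompact.union hg.hasCompactSupport.isCompact)
    (union_subset hf.tsupport_subset hg.tsupport_subset) (tsupport_sub f g)

variable [ProperSpace X]

lemma exists_cutoff {Ω : Opens X} {K : Set X} (hK : IsCompact K) (hKΩ : K ⊆ Ω) :
    ∃ χ, IsCutoff Ω χ ∧ ∀ x ∈ K, χ x = 1 := by
  obtain ⟨δ, hδ, hδΩ⟩ := hK.exists_cthickening_subset_open Ω.isOpen hKΩ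
  have hsupp : tsupport (fun x => (thickenedIndicator hδ K x : ℝ)) ⊆ Metric.cthickening δ K := by
    refine closure_minimal (fun x hx => ?_) Metric.isClosed_cthickening
    by_contra h
    refine hx ?_
    simp only [NNReal.coe_eq_zero]
    exact thickenedIndicator_zero hδ K fun h' => h (Metric.thickening_subset_cthickening _ _ h')
  have hcomp : IsCompact (Metric.cthickening δ K) := hK.cthickening
  refine ⟨fun x => thickenedIndicator hδ K x, ⟨⟨δ.toNNReal⁻¹, ?_⟩, fun x => ⟨NNReal.coe_nonneg _, ?_⟩,
    hcomp.of_isClosed_subset (isClosed_tsupport _) hsupp, hsupp.trans hδΩ⟩, fun x hx => ?_⟩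
  · exact lipschitzWith_thickenedIndicator hδ K
  · exact_mod_cast thickenedIndicator_le_one hδ K x
  · exact NNReal.coe_eq_one.2 (thickenedIndicator_one hδ K hx)

/-- Having `χ = 1` on a neighbourhood keeps the closed support of `f - χ f`, and not just its
non-zero set, away from `K`. -/
lemma exists_cutoff_nhds {Ω : Opens X} {K : Set X} (hK : IsCompact K) (hKΩ : K ⊆ Ω) :
    ∃ χ, IsCutoff Ω χ ∧ ∃ V, IsOpen V ∧ K ⊆ V ∧ ∀ x ∈ V, χ x = 1 := by
  obtain ⟨L, hL, hKL, hLΩ⟩ := exists_compact_between hK Ω.isOpen hKΩ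
  obtain ⟨χ, hχ, h1⟩ := exists_cutoff hL hLΩ
  exact ⟨χ, hχ, interior L, isOpen_interior, hKL, fun x hx => h1 x (interior_subset hx)⟩

lemma exists_compact_exhaustion (Ω : Opens X) : ∃ K : ℕ → Set X, (∀ n, IsCompact (K n)) ∧
    (∀ n, K n ⊆ Ω) ∧ Monotone K ∧ ⋃ n, K n = Ω := by
  obtain ⟨F, hFc, hFΩ, hF, hFm⟩ := Ω.isOpen.exists_iUnion_isClosed
  refine ⟨fun n => F n ∩ compactCovering X n, fun n =>
    (isCompact_compactCovering X n).inter_left (hFc n), fun n => inter_subset_left.trans (hFΩ n),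
    fun i j hij => inter_subset_inter (hFm hij) (compactCovering_subset X hij), ?_⟩
  rw [← hF]
  refine subset_antisymm (iUnion_mono fun n => inter_subset_left) fun x hx => ?_
  obtain ⟨i, hi⟩ := mem_iUnion.1 hx
  obtain ⟨j, hj⟩ := exists_mem_compactCovering x
  exact mem_iUnion.2 ⟨max i j, hFm (le_max_left i j) hi, compactCovering_subset X (le_max_right i j) hj⟩

lemma exists_cutoff_seq (Ω : Opens X) : ∃ χ : ℕ → X → ℝ, (∀ n, IsCutoff Ω (χ n)) ∧
    ∀ x ∈ Ω, ∃ n, χ n x = 1 := by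
  obtain ⟨K, hK, hKΩ, -, hU⟩ := exists_compact_exhaustion Ω
  choose χ hχ h1 using fun n => exists_cutoff (hK n) (hKΩ n)
  refine ⟨χ, hχ, fun x hx => ?_⟩
  obtain ⟨n, hn⟩ := mem_iUnion.1 (hU.symm ▸ hx : x ∈ ⋃ n, K n)
  exact ⟨n, h1 n x hn⟩

/-- A property that holds a.e. on `{χ = 1}` for every cut-off function holds a.e. on `Ω`. -/
lemma ae_of_forall_cutoff [MeasurableSpace X] {m : Measure X} {Ω : Opens X} {P : X → Prop}
    (h : ∀ χ, IsCutoff Ω χ → ∀ᵐ x ∂m, χ x = 1 → P x) : ∀ᵐ x ∂m, x ∈ Ω → P x := by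
  obtain ⟨χ, hχ, hΩ⟩ := exists_cutoff_seq Ω
  filter_upwards [ae_all_iff.2 fun n => h (χ n) (hχ n)] with x hx hxΩ
  obtain ⟨n, hn⟩ := hΩ x hxΩ
  exact hx n hn

end Cutoff

/-! ## Minimal gradients on open sets -/

section GradientOn

variable {X : Type*} [MetricSpace X] [MeasurableSpace X] [BorelSpace X] {m : Measure X} {p : ℝ}
  {Ω : Opens X}

lemma measurable_minGradientOn (u : X → ℝ) : Measurable (minGradientOn m p Ω u) := by
  rw [minGradientOn]
  split_ifs with h
  · exact h.choose_spec.1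
  · exact measurable_const

lemma MemSobolevLocOn.mono {U : Opens X} (hU : U ≤ Ω) {u : X → ℝ}
    (h : MemSobolevLocOn m p Ω u) : MemSobolevLocOn m p U u :=
  ⟨h.1.comp (measurable_inclusion hU), fun χ hχ => h.2 χ (hχ.mono hU)⟩

lemma MemSobolevLocOn.linear {u v : X → ℝ} (hu : MemSobolevLocOn m p Ω u)
    (hv : MemSobolevLocOn m p Ω v) (c d : ℝ) :
    MemSobolevLocOn m p Ω (fun x => c * u x + d * v x) := by
  refine ⟨(hu.1.const_mul c).add (hv.1.const_mul d), fun χ hχ => ?_⟩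
  convert (hu.2 χ hχ).linear (hv.2 χ hχ) c d using 2
  ring

lemma MemSobolevLocOn.mono_exponent [IsFiniteMeasureOnCompacts m] {p' : ℝ} (hp : 1 < p)
    (hpp : p ≤ p') {u : X → ℝ} (h : MemSobolevLocOn m p' Ω u) : MemSobolevLocOn m p Ω u :=
  ⟨h.1, fun χ hχ => MemSobolevLoc.mono_exponent hp hpp (h.2 χ hχ)⟩

lemma IsTest.memSobolevLocOn [IsFiniteMeasureOnCompacts m] (hp : 1 < p) {U : Opens X} {f : X → ℝ}
    (hf : IsTest U f) : MemSobolevLocOn m p Ω f :=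
  ⟨hf.continuous.measurable.comp measurable_subtype_coe, fun _ hχ =>
    LipschitzWith.memSobolevLoc hp (hχ.exists_lipschitzWith_mul hf).choose_spec⟩

lemma IsCutoff.measurable {χ : X → ℝ} (h : IsCutoff Ω χ) : Measurable χ :=
  h.lipschitz.choose_spec.continuous.measurable

variable [ProperSpace X] [SFinite m]

/-- Countably many sets `{χ n = 1}` cover `Ω`. Define `G` as `|D(χ n u)|` on their disjointed
pieces; strong locality shows that any other cut-off gives the same values a.e. -/
lemma exists_isMinimalGradientOn (hp : 1 < p) {u : X → ℝ} (hu : MemSobolevLocOn m p Ω u) :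
    ∃ G, IsMinimalGradientOn m p Ω u G := by
  obtain ⟨χ, hχ, hΩ⟩ := exists_cutoff_seq Ω
  have hA : ∀ n, MeasurableSet {x | χ n x = 1} := fun n =>
    measurableSet_eq_fun (hχ n).measurable measurable_const
  obtain ⟨G, hG, hGe⟩ := exists_measurable_piecewise (disjointed fun n => {x | χ n x = 1})
    (MeasurableSet.disjointed hA) (fun n => minGradient m p (fun y => χ n y * u y))
    (fun n => measurable_minGradient _) (fun i j hij x hx =>
      absurd hx.2 (disjoint_left.1 (disjoint_disjointed _ hij) hx.1))
  refine ⟨G, hG, fun η hη => ?_⟩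
  have h := ae_all_iff.2 fun n => minGradient_eq_of_eq hp (hu.2 _ (hχ n)) (hu.2 η hη)
  filter_upwards [h] with x hx hx1
  have hxΩ : x ∈ Ω := hη.tsupport_subset (subset_tsupport η (by simp [hx1]))
  have hxU : x ∈ ⋃ n, disjointed (fun n => {x | χ n x = 1}) n := by
    rw [iUnion_disjointed]
    exact mem_iUnion.2 (hΩ x hxΩ)
  obtain ⟨n, hn⟩ := mem_iUnion.1 hxU
  have hn1 : χ n x = 1 := disjointed_subset _ n hn
  rw [hGe n hn]
  exact hx n (by rw [hn1, hx1])

lemma minGradientOn_eq (hp : 1 < p) {u : X → ℝ} (hu : MemSobolevLocOn m p Ω u) {χ : X → ℝ}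
    (hχ : IsCutoff Ω χ) :
    ∀ᵐ x ∂m, χ x = 1 → minGradientOn m p Ω u x = minGradient m p (fun y => χ y * u y) x := by
  have h := exists_isMinimalGradientOn hp hu
  rw [minGradientOn, dif_pos h]
  exact h.choose_spec.2 χ hχ

lemma minGradientOn_nonneg (hp : 1 < p) {u : X → ℝ} (hu : MemSobolevLocOn m p Ω u) :
    ∀ᵐ x ∂m, x ∈ Ω → 0 ≤ minGradientOn m p Ω u x := by
  refine ae_of_forall_cutoff fun χ hχ => ?_
  filter_upwards [minGradientOn_eq hp hu hχ] with x hx h1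
  rw [hx h1]
  exact minGradient_nonneg _ x

lemma minGradientOn_restrict (hp : 1 < p) {U : Opens X} (hU : U ≤ Ω) {u : X → ℝ}
    (hu : MemSobolevLocOn m p Ω u) :
    ∀ᵐ x ∂m, x ∈ U → minGradientOn m p U u x = minGradientOn m p Ω u x := by
  refine ae_of_forall_cutoff fun χ hχ => ?_
  filter_upwards [minGradientOn_eq hp (hu.mono hU) hχ, minGradientOn_eq hp hu (hχ.mono hU)]
    with x hx hx' h1
  rw [hx h1, hx' h1]

lemma minGradientOn_linear_le (hp : 1 < p) {u v : X → ℝ} (hu : MemSobolevLocOn m p Ω u)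
    (hv : MemSobolevLocOn m p Ω v) (c d : ℝ) :
    ∀ᵐ x ∂m, x ∈ Ω → minGradientOn m p Ω (fun x => c * u x + d * v x) x ≤
      |c| * minGradientOn m p Ω u x + |d| * minGradientOn m p Ω v x := by
  refine ae_of_forall_cutoff fun χ hχ => ?_
  filter_upwards [minGradientOn_eq hp hu hχ, minGradientOn_eq hp hv hχ,
    minGradientOn_eq hp (hu.linear hv c d) hχ,
    minGradient_linear_le hp (hu.2 χ hχ) (hv.2 χ hχ) c d] with x h1 h2 h3 h4 hx
  rw [h1 hx, h2 hx, h3 hx]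
  convert h4 using 3
  ring

lemma minGradientOn_eq_of_eq (hp : 1 < p) {u v : X → ℝ} (hu : MemSobolevLocOn m p Ω u)
    (hv : MemSobolevLocOn m p Ω v) :
    ∀ᵐ x ∂m, x ∈ Ω → u x = v x → minGradientOn m p Ω u x = minGradientOn m p Ω v x := by
  refine ae_of_forall_cutoff fun χ hχ => ?_
  filter_upwards [minGradientOn_eq hp hu hχ, minGradientOn_eq hp hv hχ,
    minGradient_eq_of_eq hp (hu.2 χ hχ) (hv.2 χ hχ)] with x h1 h2 h3 hx he
  rw [h1 hx, h2 hx, h3 (by rw [he])]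

variable [IsFiniteMeasureOnCompacts m]

lemma IsTest.exists_minGradientOn_le (hp : 1 < p) {U : Opens X} {f : X → ℝ} (hf : IsTest U f) :
    ∃ L : ℝ, ∀ᵐ x ∂m, x ∈ Ω → minGradientOn m p Ω f x ≤ L := by
  obtain ⟨L, hL⟩ := hf.lipschitz
  have hfs : MemSobolevLocOn m p Ω f := hf.memSobolevLocOn hp
  refine ⟨L, ae_of_forall_cutoff fun χ hχ => ?_⟩
  filter_upwards [minGradientOn_eq hp hfs hχ, minGradient_eq_of_eq hp (hfs.2 χ hχ)
    (LipschitzWith.memSobolevLoc hp hL), minGradient_le_of_lipschitz hp hL] with x h1 h2 h3 hx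
  rw [h1 hx, h2 (by rw [hx, one_mul])]
  exact h3

lemma MemSobolevLocOn.memLpLoc_minGradientOn {p' : ℝ} (hp : 1 < p) (hpp : p ≤ p') {u : X → ℝ}
    (hu : MemSobolevLocOn m p' Ω u) : MemLpLoc m p' Ω (minGradientOn m p Ω u) := by
  intro K hK hKΩ
  obtain ⟨χ, hχ, h1⟩ := exists_cutoff hK hKΩ
  refine (memLp_congr_ae ?_).2
    (MemSobolevLoc.memLpLoc_minGradient hp hpp (hu.2 χ hχ) K hK fun _ _ => trivial)
  rw [EventuallyEq, ae_restrict_iff' hK.measurableSet]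
  filter_upwards [minGradientOn_eq hp (hu.mono_exponent hp hpp) hχ] with x hx hxK
  exact hx (h1 x hxK)

end GradientOn

/-! ## One-sided derivatives of convex functions of a rational variable -/

/-- Convex non-negative functions on `ℚ` with a Lipschitz bound at `0`. -/
structure RatConvex (φ : ℚ → ℝ) (M : ℝ) : Prop where
  nonneg : ∀ ε, 0 ≤ φ ε
  convex : ∀ a b s t : ℚ, 0 ≤ s → 0 ≤ t → s + t = 1 → φ (s * a + t * b) ≤ s * φ a + t * φ b
  bound : ∀ ε, |φ ε - φ 0| ≤ |(ε : ℝ)| * M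

namespace RatConvex

variable {φ : ℚ → ℝ} {M : ℝ}

lemma neg (h : RatConvex φ M) : RatConvex (fun ε => φ (-ε)) M :=
  ⟨fun ε => h.nonneg _, fun a b s t hs ht hst => by
    convert h.convex (-a) (-b) s t hs ht hst using 2; ring, fun ε => by simpa using h.bound (-ε)⟩

lemma slope_mono (h : RatConvex φ M) {s t : ℚ} (hs : 0 < s) (hst : s ≤ t) :
    (φ s - φ 0) / s ≤ (φ t - φ 0) / t := by
  have ht : 0 < t := hs.trans_le hst
  have hs' : (0 : ℝ) < s := by exact_mod_cast hs
  have ht' : (0 : ℝ) < t := by exact_mod_cast ht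
  have h1 := h.convex 0 t (1 - s / t) (s / t) (by rw [sub_nonneg, div_le_one ht]; exact hst)
    (by positivity) (by ring)
  rw [mul_zero, zero_add, div_mul_cancel₀ _ ht.ne'] at h1
  push_cast at h1
  have h2 : φ s - φ 0 ≤ s / t * (φ t - φ 0) := by linarith
  rw [div_le_div_iff₀ hs' ht']
  calc (φ s - φ 0) * t ≤ s / t * (φ t - φ 0) * t := by gcongr
    _ = (φ t - φ 0) * s := by field_simp

lemma abs_slope_le (h : RatConvex φ M) {s : ℚ} (hs : s ≠ 0) : |(φ s - φ 0) / s| ≤ M := by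
  have hs' : (0 : ℝ) < |(s : ℝ)| := abs_pos.2 (by exact_mod_cast hs)
  rw [abs_div, div_le_iff₀ hs', mul_comm]
  exact h.bound s

lemma exists_tendsto_right (h : RatConvex φ M) :
    ∃ d, Tendsto (fun ε : ℚ => (φ ε - φ 0) / ε) (𝓝[>] 0) (𝓝 d) := by
  have hm : MonotoneOn (fun ε : ℚ => (φ ε - φ 0) / ε) (Ioi 0) := fun s hs t _ hst =>
    h.slope_mono hs hst
  refine ⟨_, hm.tendsto_nhdsGT ⟨-M, ?_⟩⟩
  rintro _ ⟨s, hs, rfl⟩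
  exact (abs_le.1 (h.abs_slope_le (ne_of_gt hs))).1



lemma exists_tendsto_left (h : RatConvex φ M) :
    ∃ d, Tendsto (fun ε : ℚ => (φ ε - φ 0) / ε) (𝓝[<] 0) (𝓝 d) := by
  obtain ⟨d, hd⟩ := h.neg.exists_tendsto_right
  have hneg : Tendsto (fun ε : ℚ => -ε) (𝓝[<] 0) (𝓝[>] 0) := by
    simpa using tendsto_neg_nhdsLT (a := (0 : ℚ))
  refine ⟨-d, (hd.comp hneg).neg.congr fun ε => ?_⟩
  simp [div_neg]

lemma slope_neg_le (h : RatConvex φ M) {s : ℚ} (hs : 0 < s) :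
    (φ (-s) - φ 0) / ((-s : ℚ) : ℝ) ≤ (φ s - φ 0) / s := by
  have hs' : (0 : ℝ) < s := by exact_mod_cast hs
  have h1 := h.convex (-s) s (1 / 2) (1 / 2) (by norm_num) (by norm_num) (by norm_num)
  have h2 : (1 / 2 * -s + 1 / 2 * s : ℚ) = 0 := by ring
  rw [h2] at h1
  push_cast at h1 ⊢
  rw [div_neg, ← neg_div]
  gcongr
  linarith

lemma tendsto_self (h : RatConvex φ M) {l : Filter ℚ} (hl : l ≤ 𝓝 0) :
    Tendsto φ l (𝓝 (φ 0)) := by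
  rw [tendsto_iff_dist_tendsto_zero]
  have h0 : Tendsto (fun ε : ℚ => |(ε : ℝ)| * M) l (𝓝 0) := by
    have : Continuous fun ε : ℚ => |(ε : ℝ)| * M :=
      (Rat.continuous_coe_real.abs).mul continuous_const
    simpa using (this.tendsto 0).mono_left hl
  exact squeeze_zero (fun _ => dist_nonneg) (fun ε => h.bound ε) h0

/-- The quotient is the slope of `y ↦ y ^ p` between `φ 0` and `φ ε`, times the slope of `φ`, over
`p * φ 0 ^ (p - 2)`. The first slope tends to `p * φ 0 ^ (p - 1)`, so the exponent drops out of the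
limit. -/
lemma tendsto_rpow_quotient (h : RatConvex φ M) {l : Filter ℚ} (hl : l ≤ 𝓝 0) {d p : ℝ}
    (hp : 0 < p) (h0 : 0 < φ 0) (hd : Tendsto (fun ε : ℚ => (φ ε - φ 0) / ε) l (𝓝 d)) :
    Tendsto (fun ε : ℚ => (φ ε ^ p - φ 0 ^ p) / (p * (ε : ℝ) * φ 0 ^ (p - 2))) l
      (𝓝 (φ 0 * d)) := by
  set c := φ 0 with hc
  have hder : HasDerivAt (fun y : ℝ => y ^ p) (p * c ^ (p - 1)) c :=
    Real.hasDerivAt_rpow_const (Or.inl h0.ne')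
  have hψ : ContinuousAt (dslope (fun y : ℝ => y ^ p) c) c :=
    continuousAt_dslope_same.2 hder.differentiableAt
  have h1 := (hψ.tendsto.comp (h.tendsto_self hl)).mul hd
  rw [dslope_same, hder.deriv] at h1
  have h2 := h1.div_const (p * c ^ (p - 2))
  have hcp : 0 < c ^ (p - 2) := Real.rpow_pos_of_pos h0 _
  have e : p * c ^ (p - 1) * d / (p * c ^ (p - 2)) = c * d := by
    rw [show p - 1 = 1 + (p - 2) by ring, Real.rpow_add h0, Real.rpow_one]
    field_simp
  rw [e] at h2
  refine h2.congr fun ε => ?_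
  have h3 := sub_smul_dslope (fun y : ℝ => y ^ p) c (φ ε)
  simp only [smul_eq_mul] at h3
  rw [← h3, Function.comp_apply]
  -- The filter may charge `ε = 0`; both sides are then `0` because division by zero gives zero.
  by_cases hε : (ε : ℝ) = 0
  · simp [hε]
  · field_simp

end RatConvex

/-! ## The functions `D⁺f(∇g)` and `D⁻f(∇g)` pointwise -/

section Pointwise

variable {X : Type*} {N : (X → ℝ) → X → ℝ} {p : ℝ} {f g : X → ℝ} {x : X} {M : ℝ}

/-- The function `ε ↦ |D(g + ε f)|(x)`. -/
def perturb (N : (X → ℝ) → X → ℝ) (f g : X → ℝ) (x : X) (ε : ℚ) : ℝ :=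
  N (fun y => g y + (ε : ℝ) * f y) x

@[simp] lemma perturb_zero : perturb N f g x 0 = N g x := by simp [perturb]

lemma diffPlus_congr {Y : Type*} {N' : (Y → ℝ) → Y → ℝ} {f' g' : Y → ℝ} {x' : Y}
    (h : ∀ ε, perturb N f g x ε = perturb N' f' g' x' ε) :
    diffPlus N p f g x = diffPlus N' p f' g' x' := by
  have h0 : N g x = N' g' x' := by simpa using h 0
  simp only [perturb] at h
  simp only [diffPlus, h, h0]

lemma diffMinus_congr {Y : Type*} {N' : (Y → ℝ) → Y → ℝ} {f' g' : Y → ℝ} {x' : Y}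
    (h : ∀ ε, perturb N f g x ε = perturb N' f' g' x' ε) :
    diffMinus N p f g x = diffMinus N' p f' g' x' := by
  have h0 : N g x = N' g' x' := by simpa using h 0
  simp only [perturb] at h
  simp only [diffMinus, h, h0]

/-- The liminf is a genuine limit: `N g x` times the right derivative of `perturb N f g x` at `0`.
In this form the convention on `{N g = 0}` needs no exception, and the estimates on `diffPlus` can
be read off difference quotients. -/
lemma tendsto_diffPlus (hp : 0 < p) (h : RatConvex (perturb N f g x) M) :
    Tendsto (fun ε : ℚ => N g x * ((perturb N f g x ε - N g x) / ε)) (𝓝[>] 0)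
      (𝓝 (diffPlus N p f g x)) := by
  rw [diffPlus]
  split_ifs with h0
  · simp [h0]
  · have hpos : 0 < perturb N f g x 0 := (h.nonneg 0).lt_of_ne' (by simpa using h0)
    obtain ⟨d, hd⟩ := h.exists_tendsto_right
    have h1 := h.tendsto_rpow_quotient nhdsWithin_le_nhds hp hpos hd
    rw [perturb_zero] at h1 hd
    have h2 : liminf (fun ε : ℚ => (N (fun y => g y + (ε : ℝ) * f y) x ^ p - N g x ^ p) /
      (p * (ε : ℝ) * N g x ^ (p - 2))) (𝓝[>] (0 : ℚ)) = N g x * d := h1.liminf_eq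
    rw [h2]
    exact hd.const_mul _

lemma tendsto_diffMinus (hp : 0 < p) (h : RatConvex (perturb N f g x) M) :
    Tendsto (fun ε : ℚ => N g x * ((perturb N f g x ε - N g x) / ε)) (𝓝[<] 0)
      (𝓝 (diffMinus N p f g x)) := by
  rw [diffMinus]
  split_ifs with h0
  · simp [h0]
  · have hpos : 0 < perturb N f g x 0 := (h.nonneg 0).lt_of_ne' (by simpa using h0)
    obtain ⟨d, hd⟩ := h.exists_tendsto_left
    have h1 := h.tendsto_rpow_quotient nhdsWithin_le_nhds hp hpos hd
    rw [perturb_zero] at h1 hd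
    have h2 : limsup (fun ε : ℚ => (N (fun y => g y + (ε : ℝ) * f y) x ^ p - N g x ^ p) /
      (p * (ε : ℝ) * N g x ^ (p - 2))) (𝓝[<] (0 : ℚ)) = N g x * d := h1.limsup_eq
    rw [h2]
    exact hd.const_mul _

/-- The limit in `tendsto_diffPlus` does not involve the exponent. Hence strict convexity, assumed
at `p₀`, can be used for differentials computed with `p`. -/
lemma diffPlus_exponent {p' : ℝ} (hp : 0 < p) (hp' : 0 < p')
    (h : RatConvex (perturb N f g x) M) : diffPlus N p f g x = diffPlus N p' f g x :=
  tendsto_nhds_unique (tendsto_diffPlus hp h) (tendsto_diffPlus hp' h)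

lemma diffMinus_exponent {p' : ℝ} (hp : 0 < p) (hp' : 0 < p')
    (h : RatConvex (perturb N f g x) M) : diffMinus N p f g x = diffMinus N p' f g x :=
  tendsto_nhds_unique (tendsto_diffMinus hp h) (tendsto_diffMinus hp' h)

lemma diffMinus_le_diffPlus (hp : 0 < p) (h : RatConvex (perturb N f g x) M) :
    diffMinus N p f g x ≤ diffPlus N p f g x := by
  have hneg : Tendsto (fun ε : ℚ => -ε) (𝓝[>] 0) (𝓝[<] 0) := by
    simpa using tendsto_neg_nhdsGT (a := (0 : ℚ))
  refine le_of_tendsto_of_tendsto ((tendsto_diffMinus hp h).comp hneg) (tendsto_diffPlus hp h) ?_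
  filter_upwards [self_mem_nhdsWithin] with ε hε
  have h0 : 0 ≤ N g x := by simpa using h.nonneg 0
  have h1 := h.slope_neg_le hε
  rw [perturb_zero] at h1
  exact mul_le_mul_of_nonneg_left h1 h0

lemma abs_diffPlus_le (hp : 0 < p) (h : RatConvex (perturb N f g x) M) :
    |diffPlus N p f g x| ≤ N g x * M := by
  refine le_of_tendsto (tendsto_diffPlus hp h).abs ?_
  filter_upwards [self_mem_nhdsWithin] with ε hε
  have h0 : 0 ≤ N g x := by simpa using h.nonneg 0
  have h1 := h.abs_slope_le (ne_of_gt hε)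
  rw [perturb_zero] at h1
  rw [abs_mul, abs_of_nonneg h0]
  exact mul_le_mul_of_nonneg_left h1 h0

lemma abs_diffMinus_le (hp : 0 < p) (h : RatConvex (perturb N f g x) M) :
    |diffMinus N p f g x| ≤ N g x * M := by
  refine le_of_tendsto (tendsto_diffMinus hp h).abs ?_
  filter_upwards [self_mem_nhdsWithin] with ε hε
  have h0 : 0 ≤ N g x := by simpa using h.nonneg 0
  have h1 := h.abs_slope_le (ne_of_lt hε)
  rw [perturb_zero] at h1
  rw [abs_mul, abs_of_nonneg h0]
  exact mul_le_mul_of_nonneg_left h1 h0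

lemma diffPlus_eq_zero (hp : 0 < p) (h : RatConvex (perturb N f g x) M)
    (h0 : ∀ ε, perturb N f g x ε = N g x) : diffPlus N p f g x = 0 :=
  tendsto_nhds_unique (tendsto_diffPlus hp h) (by simp [h0])

variable {f' : X → ℝ} {M' M'' : ℝ}

/-- The factor `2` comes from `g + ε(f + f')` being the midpoint of `g + 2εf` and `g + 2εf'`. -/
lemma slope_add_le (hN : 0 ≤ N g x)
    (hadd : ∀ ε : ℚ, perturb N (fun y => f y + f' y) g x ε ≤
      (perturb N f g x (2 * ε) + perturb N f' g x (2 * ε)) / 2) {ε : ℚ} (hε : 0 < ε) :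
    N g x * ((perturb N (fun y => f y + f' y) g x ε - N g x) / ε) ≤
      N g x * ((perturb N f g x (2 * ε) - N g x) / ((2 * ε : ℚ) : ℝ)) +
        N g x * ((perturb N f' g x (2 * ε) - N g x) / ((2 * ε : ℚ) : ℝ)) := by
  have hε' : (0 : ℝ) < ε := by exact_mod_cast hε
  rw [← mul_add, ← add_div]
  refine mul_le_mul_of_nonneg_left ?_ hN
  push_cast
  rw [div_le_div_iff₀ hε' (by positivity)]
  nlinarith [hadd ε]

lemma diffPlus_add_le (hp : 0 < p) (h : RatConvex (perturb N f g x) M)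
    (h' : RatConvex (perturb N f' g x) M')
    (h'' : RatConvex (perturb N (fun y => f y + f' y) g x) M'')
    (hadd : ∀ ε : ℚ, perturb N (fun y => f y + f' y) g x ε ≤
      (perturb N f g x (2 * ε) + perturb N f' g x (2 * ε)) / 2) :
    diffPlus N p (fun y => f y + f' y) g x ≤ diffPlus N p f g x + diffPlus N p f' g x := by
  have h2 : Tendsto (fun ε : ℚ => 2 * ε) (𝓝[>] 0) (𝓝[>] 0) := by
    refine tendsto_nhdsWithin_iff.2 ⟨?_, ?_⟩
    · have : Continuous fun ε : ℚ => 2 * ε := by fun_prop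
      simpa using (this.tendsto 0).mono_left nhdsWithin_le_nhds
    · filter_upwards [self_mem_nhdsWithin] with ε hε
      exact mul_pos two_pos (mem_Ioi.1 hε)
  refine le_of_tendsto_of_tendsto (tendsto_diffPlus hp h'')
    (((tendsto_diffPlus hp h).comp h2).add ((tendsto_diffPlus hp h').comp h2)) ?_
  filter_upwards [self_mem_nhdsWithin] with ε hε
  exact slope_add_le (by simpa using h.nonneg 0) hadd hε

/-- The same midpoint inequality, reversed on division by a negative `ε`. Together with
`diffPlus_add_le` it gives additivity as soon as both differentials coincide. -/
lemma le_diffMinus_add (hp : 0 < p) (h : RatConvex (perturb N f g x) M)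
    (h' : RatConvex (perturb N f' g x) M')
    (h'' : RatConvex (perturb N (fun y => f y + f' y) g x) M'')
    (hadd : ∀ ε : ℚ, perturb N (fun y => f y + f' y) g x ε ≤
      (perturb N f g x (2 * ε) + perturb N f' g x (2 * ε)) / 2) :
    diffMinus N p f g x + diffMinus N p f' g x ≤ diffMinus N p (fun y => f y + f' y) g x := by
  have h2 : Tendsto (fun ε : ℚ => 2 * ε) (𝓝[<] 0) (𝓝[<] 0) := by
    refine tendsto_nhdsWithin_iff.2 ⟨?_, ?_⟩
    · have : Continuous fun ε : ℚ => 2 * ε := by fun_prop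
      simpa using (this.tendsto 0).mono_left nhdsWithin_le_nhds
    · filter_upwards [self_mem_nhdsWithin] with ε hε
      exact mul_neg_of_pos_of_neg two_pos (mem_Iio.1 hε)
  refine le_of_tendsto_of_tendsto
    (((tendsto_diffMinus hp h).comp h2).add ((tendsto_diffMinus hp h').comp h2))
    (tendsto_diffMinus hp h'') ?_
  filter_upwards [self_mem_nhdsWithin] with ε hε
  have hε' : (ε : ℝ) < 0 := by exact_mod_cast hε
  have hN : 0 ≤ N g x := by simpa using h.nonneg 0
  simp only [Function.comp_apply]
  rw [← mul_add, ← add_div]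
  refine mul_le_mul_of_nonneg_left ?_ hN
  push_cast
  rw [div_le_iff_of_neg (by linarith), mul_comm (2 : ℝ), ← mul_assoc, div_mul_cancel₀ _ hε'.ne]
  linarith [hadd ε]

end Pointwise

/-! ## Calculus of `D^±f(∇g)` almost everywhere -/

/-- The properties of `u ↦ |Du|` on the linear space `V`, up to `μ`-null sets. -/
structure IsGradientOperator {X : Type*} [MeasurableSpace X] (μ : Measure X) (V : Set (X → ℝ))
    (N : (X → ℝ) → X → ℝ) : Prop where
  linear_mem : ∀ u ∈ V, ∀ v ∈ V, ∀ c d : ℝ, (fun x => c * u x + d * v x) ∈ V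
  linear_le : ∀ u ∈ V, ∀ v ∈ V, ∀ c d : ℝ,
    ∀ᵐ x ∂μ, N (fun x => c * u x + d * v x) x ≤ |c| * N u x + |d| * N v x
  nonneg : ∀ u ∈ V, ∀ᵐ x ∂μ, 0 ≤ N u x
  eq_of_eq : ∀ u ∈ V, ∀ v ∈ V, ∀ᵐ x ∂μ, u x = v x → N u x = N v x
  measurable : ∀ u, Measurable (N u)

namespace IsGradientOperator

variable {X : Type*} [MeasurableSpace X] {μ : Measure X} {V : Set (X → ℝ)}
  {N : (X → ℝ) → X → ℝ} {f f' g : X → ℝ} {p : ℝ}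

lemma perturb_mem (h : IsGradientOperator μ V N) (hf : f ∈ V) (hg : g ∈ V) (ε : ℝ) :
    (fun y => g y + ε * f y) ∈ V := by
  simpa using h.linear_mem g hg f hf 1 ε

lemma add_mem (h : IsGradientOperator μ V N) (hf : f ∈ V) (hf' : f' ∈ V) :
    (fun y => f y + f' y) ∈ V := by
  simpa using h.linear_mem f hf f' hf' 1 1

/-- Each inequality holds off a null set depending on its parameters; rational parameters leave only
countably many such sets. -/
lemma ae_ratConvex (h : IsGradientOperator μ V N) (hf : f ∈ V) (hg : g ∈ V) :
    ∀ᵐ x ∂μ, RatConvex (perturb N f g x) (N f x) := by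
  have hP := fun ε : ℚ => h.perturb_mem hf hg (ε : ℝ)
  have h1 := ae_all_iff.2 fun ε : ℚ => h.nonneg _ (hP ε)
  have h2 := ae_all_iff.2 fun a : ℚ => ae_all_iff.2 fun b : ℚ => ae_all_iff.2 fun s : ℚ =>
    ae_all_iff.2 fun t : ℚ => h.linear_le _ (hP a) _ (hP b) (s : ℝ) (t : ℝ)
  have h3 := ae_all_iff.2 fun ε : ℚ => h.linear_le g hg f hf 1 (ε : ℝ)
  -- Writing `g = (g + εf) - εf` gives the lower half of the Lipschitz bound at `0`.
  have h4 := ae_all_iff.2 fun ε : ℚ => h.linear_le _ (hP ε) f hf 1 (-ε : ℝ)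
  filter_upwards [h1, h2, h3, h4] with x h1 h2 h3 h4
  refine ⟨h1, fun a b s t hs ht hst => ?_, fun ε => ?_⟩
  · have hst' : (s : ℝ) + t = 1 := by exact_mod_cast hst
    have h5 := h2 a b s t
    rw [abs_of_nonneg (by exact_mod_cast hs), abs_of_nonneg (by exact_mod_cast ht)] at h5
    refine le_of_eq_of_le ?_ h5
    unfold perturb
    congr 1
    funext y
    push_cast
    linear_combination (-g y) * hst'
  · rw [perturb_zero, abs_le]
    have h5 := h3 ε
    have h6 := h4 ε
    have e : (fun y => 1 * (g y + (ε : ℝ) * f y) + -(ε : ℝ) * f y) = g := by funext y; ring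
    rw [e] at h6
    simp only [one_mul, abs_one, abs_neg] at h5 h6
    constructor
    · simp only [perturb]; linarith
    · simp only [perturb]; linarith

lemma ae_perturb_add_le (h : IsGradientOperator μ V N) (hf : f ∈ V) (hf' : f' ∈ V) (hg : g ∈ V) :
    ∀ᵐ x ∂μ, ∀ ε : ℚ, perturb N (fun y => f y + f' y) g x ε ≤
      (perturb N f g x (2 * ε) + perturb N f' g x (2 * ε)) / 2 := by
  have h1 := ae_all_iff.2 fun ε : ℚ => h.linear_le _ (h.perturb_mem hf hg ((2 * ε : ℚ) : ℝ)) _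
    (h.perturb_mem hf' hg ((2 * ε : ℚ) : ℝ)) (1 / 2) (1 / 2)
  filter_upwards [h1] with x h1 ε
  have h2 := h1 ε
  have e : (fun y => 1 / 2 * (g y + ((2 * ε : ℚ) : ℝ) * f y) +
      1 / 2 * (g y + ((2 * ε : ℚ) : ℝ) * f' y)) = fun y => g y + (ε : ℝ) * (f y + f' y) := by
    funext y; push_cast; ring
  rw [e, abs_of_pos (by norm_num : (0 : ℝ) < 1 / 2)] at h2
  simp only [perturb]
  linarith

lemma measurable_perturb (h : IsGradientOperator μ V N) (ε : ℚ) :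
    Measurable fun x => perturb N f g x ε := h.measurable _

lemma aemeasurable_diffPlus (h : IsGradientOperator μ V N) (hp : 0 < p) (hf : f ∈ V) (hg : g ∈ V) :
    AEMeasurable (diffPlus N p f g) μ := by
  refine aemeasurable_of_tendsto_metrizable_ae (𝓝[>] (0 : ℚ)) (fun ε =>
    ((h.measurable g).mul (((h.measurable_perturb (f := f) (g := g) ε).sub
      (h.measurable g)).div_const (ε : ℝ))).aemeasurable) ?_
  filter_upwards [h.ae_ratConvex hf hg] with x hx
  exact tendsto_diffPlus hp hx

lemma aemeasurable_diffMinus (h : IsGradientOperator μ V N) (hp : 0 < p) (hf : f ∈ V)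
    (hg : g ∈ V) : AEMeasurable (diffMinus N p f g) μ := by
  refine aemeasurable_of_tendsto_metrizable_ae (𝓝[<] (0 : ℚ)) (fun ε =>
    ((h.measurable g).mul (((h.measurable_perturb (f := f) (g := g) ε).sub
      (h.measurable g)).div_const (ε : ℝ))).aemeasurable) ?_
  filter_upwards [h.ae_ratConvex hf hg] with x hx
  exact tendsto_diffMinus hp hx

lemma diffPlus_eq_zero (h : IsGradientOperator μ V N) (hp : 0 < p) (hf : f ∈ V) (hg : g ∈ V) :
    ∀ᵐ x ∂μ, f x = 0 → diffPlus N p f g x = 0 := by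
  have h1 := ae_all_iff.2 fun ε : ℚ => h.eq_of_eq _ (h.perturb_mem hf hg (ε : ℝ)) g hg
  filter_upwards [h.ae_ratConvex hf hg, h1] with x hx h1 h0
  exact MetricDivergence.diffPlus_eq_zero hp hx fun ε => h1 ε (by rw [h0, mul_zero, add_zero])

lemma diffPlus_add (h : IsGradientOperator μ V N) (hp : 0 < p) (hf : f ∈ V) (hf' : f' ∈ V)
    (hg : g ∈ V) (hD : ∀ u ∈ V, diffPlus N p u g =ᵐ[μ] diffMinus N p u g) :
    ∀ᵐ x ∂μ, diffPlus N p (fun y => f y + f' y) g x = diffPlus N p f g x + diffPlus N p f' g x := by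
  have hs := h.add_mem hf hf'
  filter_upwards [h.ae_ratConvex hf hg, h.ae_ratConvex hf' hg, h.ae_ratConvex hs hg,
    h.ae_perturb_add_le hf hf' hg, hD f hf, hD f' hf', hD _ hs] with x h1 h2 h3 h4 h5 h6 h7
  refine le_antisymm (diffPlus_add_le hp h1 h2 h3 h4) ?_
  rw [h5, h6, h7]
  exact le_diffMinus_add hp h1 h2 h3 h4

end IsGradientOperator

section Convexity

variable {X : Type*} [MetricSpace X] [MeasurableSpace X] [BorelSpace X] [ProperSpace X]
  {m : Measure X} [SFinite m] {p₀ p : ℝ} {Ω : Opens X}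

lemma isGradientOperator_minGradient (hp₀ : 1 < p₀) :
    IsGradientOperator m {u | MemSobolevLoc m p₀ u} (minGradient m p₀) where
  linear_mem _ hu _ hv c d := MemSobolevLoc.linear hu hv c d
  linear_le _ hu _ hv c d := minGradient_linear_le hp₀ hu hv c d
  nonneg _ _ := ae_of_all _ fun x => minGradient_nonneg _ x
  eq_of_eq _ hu _ hv := minGradient_eq_of_eq hp₀ hu hv
  measurable u := measurable_minGradient u

lemma isGradientOperator_minGradientOn (hp₀ : 1 < p₀) :
    IsGradientOperator (m.restrict (Ω : Set X)) {u | MemSobolevLocOn m p₀ Ω u}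
      (minGradientOn m p₀ Ω) where
  linear_mem _ hu _ hv c d := MemSobolevLocOn.linear hu hv c d
  linear_le _ hu _ hv c d := (ae_restrict_iff' Ω.isOpen.measurableSet).2
    (minGradientOn_linear_le hp₀ hu hv c d)
  nonneg _ hu := (ae_restrict_iff' Ω.isOpen.measurableSet).2 (minGradientOn_nonneg hp₀ hu)
  eq_of_eq _ hu _ hv := (ae_restrict_iff' Ω.isOpen.measurableSet).2
    (minGradientOn_eq_of_eq hp₀ hu hv)
  measurable u := measurable_minGradientOn u

lemma rpow_mul_le {a b q : ℝ} (ha : 0 ≤ a) (hb : 0 ≤ b) (hq : 1 ≤ q) :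
    a * b ^ (q - 1) ≤ a ^ q + b ^ q := by
  have key : ∀ c : ℝ, 0 ≤ c → c * c ^ (q - 1) = c ^ q := fun c hc => by
    rcases hc.eq_or_lt with rfl | hc
    · rw [zero_mul, Real.zero_rpow (by linarith)]
    · rw [← Real.rpow_one_add' hc.le (by linarith)]; ring_nf
  rcases le_total a b with h | h
  · calc a * b ^ (q - 1) ≤ b * b ^ (q - 1) := by gcongr
      _ = b ^ q := key b hb
      _ ≤ _ := le_add_of_nonneg_left (by positivity)
  · calc a * b ^ (q - 1) ≤ a * a ^ (q - 1) := by gcongr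
      _ = a ^ q := key a ha
      _ ≤ _ := le_add_of_nonneg_right (by positivity)

/-- An integrable majorant for the integrands of strict convexity. The bound on `D` compensates the
singularity of `G ^ (q - 2)` at `G = 0` when `q < 2`. -/
lemma abs_mul_rpow_le {D G M q : ℝ} (hG : 0 ≤ G) (hM : 0 ≤ M) (hq : 1 ≤ q) (hD : |D| ≤ G * M) :
    |D * G ^ (q - 2)| ≤ M ^ q + G ^ q := by
  rcases hG.eq_or_lt with rfl | hG
  · rw [zero_mul] at hD
    rw [abs_nonpos_iff.1 hD, zero_mul, abs_zero]
    positivity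
  · refine le_trans ?_ (rpow_mul_le hM hG.le hq)
    rw [abs_mul, abs_of_pos (Real.rpow_pos_of_pos hG _)]
    calc |D| * G ^ (q - 2) ≤ G * M * G ^ (q - 2) := by gcongr
      _ = M * G ^ (q - 1) := by
        rw [show q - 1 = 1 + (q - 2) by ring, Real.rpow_add hG, Real.rpow_one]; ring

/-- Under infinitesimal strict convexity `D⁺f(∇g) = D⁻f(∇g)` a.e. -/
lemma IsInfStrictlyConvex.diffPlus_eq_diffMinus (hconvex : IsInfStrictlyConvex m p₀) (hp₀ : 1 < p₀)
    (hp : 0 < p) {f g : X → ℝ} (hf : MemSobolev m p₀ f) (hg : MemSobolev m p₀ g) :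
    diffPlus (minGradient m p₀) p f g =ᵐ[m] diffMinus (minGradient m p₀) p f g := by
  have hp0 : 0 < p₀ := zero_lt_one.trans hp₀
  have hN := isGradientOperator_minGradient (m := m) hp₀
  have hfV : f ∈ {u | MemSobolevLoc m p₀ u} := hf.memSobolevLoc
  have hgV : g ∈ {u | MemSobolevLoc m p₀ u} := hg.memSobolevLoc
  have hconv := hN.ae_ratConvex hfV hgV
  have hpow : ∀ {u : X → ℝ}, MemSobolev m p₀ u → Integrable (fun x => minGradient m p₀ u x ^ p₀) m := by
    intro u hu
    have := (hu.memLp_minGradient hp₀).integrable_norm_rpow (by simpa using hp0)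
      ENNReal.ofReal_ne_top
    simpa [ENNReal.toReal_ofReal hp0.le, abs_of_nonneg (minGradient_nonneg _ _)] using this
  have hdom := (hpow hf).add (hpow hg)
  have hmG : Measurable fun x => minGradient m p₀ g x ^ (p₀ - 2) :=
    (measurable_minGradient g).pow_const _
  have hip : Integrable (fun x => diffPlus (minGradient m p₀) p₀ f g x *
      minGradient m p₀ g x ^ (p₀ - 2)) m := by
    refine hdom.mono' ((hN.aemeasurable_diffPlus hp0 hfV hgV).mul
      hmG.aemeasurable).aestronglyMeasurable ?_
    filter_upwards [hconv] with x hx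
    exact abs_mul_rpow_le (minGradient_nonneg _ _) (minGradient_nonneg _ _) hp₀.le
      (abs_diffPlus_le hp0 hx)
  have him : Integrable (fun x => diffMinus (minGradient m p₀) p₀ f g x *
      minGradient m p₀ g x ^ (p₀ - 2)) m := by
    refine hdom.mono' ((hN.aemeasurable_diffMinus hp0 hfV hgV).mul
      hmG.aemeasurable).aestronglyMeasurable ?_
    filter_upwards [hconv] with x hx
    exact abs_mul_rpow_le (minGradient_nonneg _ _) (minGradient_nonneg _ _) hp₀.le
      (abs_diffMinus_le hp0 hx)
  -- `D⁻ ≤ D⁺` a.e., so equal integrals force equal integrands.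
  have hae := (integral_eq_iff_of_ae_le him hip (by
    filter_upwards [hconv] with x hx
    exact mul_le_mul_of_nonneg_right (diffMinus_le_diffPlus hp0 hx)
      (Real.rpow_nonneg (minGradient_nonneg _ _) _))).1 (hconvex f g hf hg).symm
  filter_upwards [hae, hconv] with x hx hc
  rw [diffPlus_exponent hp hp0 hc, diffMinus_exponent hp hp0 hc]
  -- The weight cannot be cancelled where the gradient of `g` vanishes, but both differentials are
  -- zero there by definition.
  by_cases h0 : minGradient m p₀ g x = 0
  · rw [diffPlus, diffMinus, if_pos h0, if_pos h0]
  · have hpos : 0 < minGradient m p₀ g x := (minGradient_nonneg _ _).lt_of_ne' h0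
    exact (mul_right_cancel₀ (Real.rpow_pos_of_pos hpos _).ne' hx).symm

variable [IsFiniteMeasureOnCompacts m]

lemma MemSobolevLocOn.memSobolev_mul (hp₀ : 1 < p₀) {u : X → ℝ} (hu : MemSobolevLocOn m p₀ Ω u)
    {χ : X → ℝ} (hχ : IsCutoff Ω χ) : MemSobolev m p₀ (fun x => χ x * u x) :=
  (hu.2 χ hχ).memSobolev_of_compact hp₀ hχ.hasCompactSupport.isCompact fun x hx => by
    rw [image_eq_zero_of_notMem_tsupport hx, zero_mul]

/-- The localised version of `IsInfStrictlyConvex.diffPlus_eq_diffMinus`. -/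
lemma IsInfStrictlyConvex.diffPlus_eq_diffMinus_on (hconvex : IsInfStrictlyConvex m p₀)
    (hp₀ : 1 < p₀) (hp : 0 < p) {f g : X → ℝ} (hf : MemSobolevLocOn m p₀ Ω f)
    (hg : MemSobolevLocOn m p₀ Ω g) :
    diffPlus (minGradientOn m p₀ Ω) p f g =ᵐ[m.restrict (Ω : Set X)]
      diffMinus (minGradientOn m p₀ Ω) p f g := by
  rw [EventuallyEq, ae_restrict_iff' Ω.isOpen.measurableSet]
  refine ae_of_forall_cutoff fun χ hχ => ?_
  have hP : ∀ ε : ℚ, MemSobolevLocOn m p₀ Ω (fun y => g y + (ε : ℝ) * f y) := fun ε => by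
    simpa using hg.linear hf 1 (ε : ℝ)
  have h1 := ae_all_iff.2 fun ε : ℚ => minGradientOn_eq hp₀ (hP ε) hχ
  filter_upwards [h1, hconvex.diffPlus_eq_diffMinus hp₀ hp (hf.memSobolev_mul hp₀ hχ)
    (hg.memSobolev_mul hp₀ hχ)] with x h1 h2 hx
  -- On `{χ = 1}` the perturbations of `g` by `f` have the same gradients as those of `χ g` by `χ
  -- f`, which are globally Sobolev.
  have h3 : ∀ ε, perturb (minGradientOn m p₀ Ω) f g x ε =
      perturb (minGradient m p₀) (fun y => χ y * f y) (fun y => χ y * g y) x ε := fun ε => by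
    rw [perturb, h1 ε hx, perturb]
    congr 1
    funext y
    ring
  rw [diffPlus_congr h3, diffMinus_congr h3]
  exact h2

end Convexity

/-! ## The divergence functional -/

section Divergence

variable {X : Type*} [MetricSpace X] [MeasurableSpace X]

/-- The functional `f ↦ ∫_Ω D⁺f(∇g) h dm`. -/
def divFunctional (m : Measure X) (p₀ p : ℝ) (Ω : Opens X) (h g f : X → ℝ) : ℝ :=
  ∫ x in (Ω : Set X), diffPlus (minGradientOn m p₀ Ω) p f g x * h x ∂m

variable [BorelSpace X] [ProperSpace X] {m : Measure X} [IsFiniteMeasureOnCompacts m] {p₀ p : ℝ}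
  {Ω : Opens X} {h g : X → ℝ}

/-- Once `D⁺ = D⁻` a.e. the sign of `h` plays no role, and the upper and lower bounds are the same
number. -/
lemma mem_divergence_iff (hconvex : IsInfStrictlyConvex m p₀) (hp₀ : 1 < p₀) (hp : 0 < p)
    (hg : MemSobolevLocOn m p₀ Ω g) {μ : SignedRadon Ω} :
    μ ∈ divergence m p₀ p Ω h g ↔
      ∀ f, IsTest Ω f → μ.integral f = -divFunctional m p₀ p Ω h g f := by
  have key : ∀ f, IsTest Ω f →
      ∫ x in (Ω : Set X), signPlus m p₀ p Ω h g f x ∂m = divFunctional m p₀ p Ω h g f ∧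
      ∫ x in (Ω : Set X), signMinus m p₀ p Ω h g f x ∂m = divFunctional m p₀ p Ω h g f := by
    intro f hf
    have hae := hconvex.diffPlus_eq_diffMinus_on hp₀ hp (hf.memSobolevLocOn hp₀) hg
    constructor
    · refine integral_congr_ae ?_
      filter_upwards [hae] with x hx
      rw [signPlus, ← hx, ite_self]
    · refine integral_congr_ae ?_
      filter_upwards [hae] with x hx
      rw [signMinus, ← hx, ite_self]
  constructor
  · intro hμ f hf
    have h1 := hμ f hf
    rw [(key f hf).1, (key f hf).2] at h1
    exact le_antisymm h1.2 h1.1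
  · intro hμ f hf
    rw [(key f hf).1, (key f hf).2, hμ f hf]
    exact ⟨le_rfl, le_rfl⟩

lemma ae_diffPlus_eq_zero_of_notMem (hp₀ : 1 < p₀) (hp : 0 < p) (hg : MemSobolevLocOn m p₀ Ω g)
    {f : X → ℝ} (hf : IsTest Ω f) {A : Set X} (hA : tsupport f ⊆ A) :
    ∀ᵐ x ∂m, x ∈ (Ω : Set X) \ A → diffPlus (minGradientOn m p₀ Ω) p f g x * h x = 0 := by
  have h1 := (isGradientOperator_minGradientOn hp₀).diffPlus_eq_zero hp
    (show f ∈ {u | MemSobolevLocOn m p₀ Ω u} from hf.memSobolevLocOn hp₀) hg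
  rw [ae_restrict_iff' Ω.isOpen.measurableSet] at h1
  filter_upwards [h1] with x hx hxA
  rw [hx hxA.1 (image_eq_zero_of_notMem_tsupport fun h' => hxA.2 (hA h')), zero_mul]

/-- Gradients relative to `U` and `Ω` agree a.e. on `U`, and by locality the integrand vanishes a.e.
off the support of `f`. -/
lemma divFunctional_restrict (hp₀ : 1 < p₀) (hp : 0 < p) (hg : MemSobolevLocOn m p₀ Ω g)
    {U : Opens X} (hU : U ≤ Ω) {f : X → ℝ} (hf : IsTest U f) :
    divFunctional m p₀ p U h g f = divFunctional m p₀ p Ω h g f := by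
  have hP : ∀ ε : ℚ, MemSobolevLocOn m p₀ Ω (fun y => g y + (ε : ℝ) * f y) := fun ε => by
    simpa using hg.linear (hf.memSobolevLocOn hp₀) 1 (ε : ℝ)
  have h1 := ae_all_iff.2 fun ε : ℚ => minGradientOn_restrict hp₀ hU (hP ε)
  calc divFunctional m p₀ p U h g f
      = ∫ x in (U : Set X), diffPlus (minGradientOn m p₀ Ω) p f g x * h x ∂m := by
        refine integral_congr_ae ?_
        rw [EventuallyEq, ae_restrict_iff' U.isOpen.measurableSet]
        filter_upwards [h1] with x hx hxU
        have h2 : ∀ ε, perturb (minGradientOn m p₀ U) f g x ε =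
          perturb (minGradientOn m p₀ Ω) f g x ε := fun ε => hx ε hxU
        rw [diffPlus_congr h2]
    _ = _ := (setIntegral_eq_of_subset_of_ae_sdiff_eq_zero
        Ω.isOpen.measurableSet.nullMeasurableSet hU
        (ae_diffPlus_eq_zero_of_notMem hp₀ hp hg (hf.mono hU) hf.tsupport_subset)).symm

/-- The integrand is at most `L |Dg| |h|` and lives on the compact support of `f`, where Hölder
pairs `|Dg| ∈ L^p` with `h ∈ L^q`. -/
lemma integrableOn_diffPlus_mul {q : ℝ} (hp₀ : 1 < p₀) (hp : p₀ ≤ p) (hpq : p.HolderConjugate q)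
    (hg : MemSobolevLocOn m p Ω g) (hh : MemLpLoc m q Ω h) {f : X → ℝ} (hf : IsTest Ω f) :
    IntegrableOn (fun x => diffPlus (minGradientOn m p₀ Ω) p f g x * h x) Ω m := by
  have hp0 : 0 < p := by linarith
  have hg₀ := hg.mono_exponent hp₀ hp
  have hfV : MemSobolevLocOn m p₀ Ω f := hf.memSobolevLocOn hp₀
  have hN := isGradientOperator_minGradientOn (m := m) (Ω := Ω) hp₀
  have hK := hf.hasCompactSupport.isCompact
  have hKm := hK.measurableSet
  have hle : m.restrict (tsupport f) ≤ m.restrict (Ω : Set X) :=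
    Measure.restrict_mono hf.tsupport_subset le_rfl
  obtain ⟨L, hL⟩ := hf.exists_minGradientOn_le (m := m) (Ω := Ω) hp₀
  refine IntegrableOn.of_ae_sdiff_eq_zero (s := tsupport f) ?_
    Ω.isOpen.measurableSet.nullMeasurableSet
    (ae_diffPlus_eq_zero_of_notMem hp₀ hp0 hg₀ hf subset_rfl)
  have := hpq.ennrealOfReal
  have hint : Integrable (fun x => minGradientOn m p₀ Ω g x * h x) (m.restrict (tsupport f)) :=
    (hg.memLpLoc_minGradientOn hp₀ hp _ hK hf.tsupport_subset).integrable_mul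
      (hh _ hK hf.tsupport_subset)
  refine (hint.norm.const_mul L).mono' ?_ ?_
  · exact ((hN.aemeasurable_diffPlus hp0 hfV hg₀).mono_measure hle).aestronglyMeasurable.mul
      (hh _ hK hf.tsupport_subset).1
  · refine ae_mono hle ?_
    filter_upwards [hN.ae_ratConvex hfV hg₀, hN.nonneg g hg₀,
      (ae_restrict_iff' Ω.isOpen.measurableSet).2 hL] with x hx hx0 hxL
    rw [Real.norm_eq_abs, abs_mul, Real.norm_eq_abs, abs_mul, abs_of_nonneg hx0, ← mul_assoc]
    refine mul_le_mul_of_nonneg_right ?_ (abs_nonneg _)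
    refine (abs_diffPlus_le hp0 hx).trans ?_
    rw [mul_comm L]
    exact mul_le_mul_of_nonneg_left hxL hx0

lemma divFunctional_add {q : ℝ} (hconvex : IsInfStrictlyConvex m p₀) (hp₀ : 1 < p₀) (hp : p₀ ≤ p)
    (hpq : p.HolderConjugate q) (hg : MemSobolevLocOn m p Ω g) (hh : MemLpLoc m q Ω h)
    {f f' : X → ℝ} (hf : IsTest Ω f) (hf' : IsTest Ω f') :
    divFunctional m p₀ p Ω h g (fun x => f x + f' x) =
      divFunctional m p₀ p Ω h g f + divFunctional m p₀ p Ω h g f' := by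
  have hp0 : 0 < p := by linarith
  have hg₀ := hg.mono_exponent hp₀ hp
  have hN := isGradientOperator_minGradientOn (m := m) (Ω := Ω) hp₀
  simp only [divFunctional]
  rw [← integral_add (integrableOn_diffPlus_mul hp₀ hp hpq hg hh hf)
    (integrableOn_diffPlus_mul hp₀ hp hpq hg hh hf')]
  refine integral_congr_ae ?_
  filter_upwards [hN.diffPlus_add hp0
    (show f ∈ {u | MemSobolevLocOn m p₀ Ω u} from hf.memSobolevLocOn hp₀)
    (show f' ∈ {u | MemSobolevLocOn m p₀ Ω u} from hf'.memSobolevLocOn hp₀) hg₀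
    fun u hu => hconvex.diffPlus_eq_diffMinus_on hp₀ hp0 hu hg₀] with x hx
  rw [hx, add_mul]

end Divergence

/-! ## Signed Radon measures -/

section Radon

variable {X : Type*} [MetricSpace X] [MeasurableSpace X] [BorelSpace X]

lemma IsTest.integrable {Ω : Opens X} {f : X → ℝ} (hf : IsTest Ω f) {μ : Measure X}
    (hμ : ∀ K : Set X, IsCompact K → K ⊆ Ω → μ K < ∞) : Integrable f μ := by
  have hK := hf.hasCompactSupport.isCompact
  obtain ⟨M, hM⟩ := hf.hasCompactSupport.exists_bound_of_continuous hf.continuous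
  have h1 : IntegrableOn f (tsupport f) μ :=
    Measure.integrableOn_of_bounded (hμ _ hK hf.tsupport_subset).ne
      hf.continuous.measurable.aestronglyMeasurable (ae_of_all _ hM)
  exact (integrableOn_iff_integrable_of_support_subset (subset_tsupport f)).1 h1

lemma SignedRadon.integral_add {Ω : Opens X} (μ : SignedRadon Ω) {f f' : X → ℝ}
    (hf : IsTest Ω f) (hf' : IsTest Ω f') :
    μ.integral (fun x => f x + f' x) = μ.integral f + μ.integral f' := by
  simp only [SignedRadon.integral]
  rw [MeasureTheory.integral_add (hf.integrable μ.pos_lt_top) (hf'.integrable μ.pos_lt_top),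
    MeasureTheory.integral_add (hf.integrable μ.neg_lt_top) (hf'.integrable μ.neg_lt_top)]
  ring

lemma SignedRadon.integral_restrict {U Ω : Opens X} (μ : SignedRadon Ω) (hU : U ≤ Ω) {f : X → ℝ}
    (hf : IsTest U f) : (μ.restrict U hU).integral f = μ.integral f := by
  have h0 : ∀ x, x ∉ (U : Set X) → f x = 0 := fun x hx =>
    image_eq_zero_of_notMem_tsupport fun h => hx (hf.tsupport_subset h)
  simp only [SignedRadon.integral, SignedRadon.restrict]
  rw [setIntegral_eq_integral_of_forall_compl_eq_zero h0,
    setIntegral_eq_integral_of_forall_compl_eq_zero h0]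

/-- `p₁` is carried by a set on which `n₁` vanishes, and there `p₁ ≤ p₁ + n₂ = p₂`. Nothing is
subtracted, so infinite masses do no harm. -/
lemma le_of_add_eq_add_of_mutuallySingular {p₁ n₁ p₂ n₂ : Measure X} (h : p₁ ⟂ₘ n₁)
    (he : p₁ + n₂ = p₂ + n₁) : p₁ ≤ p₂ := by
  obtain ⟨s, -, hs1, hs2⟩ := h
  intro E
  calc p₁ E ≤ p₁ (E ∩ s) + p₁ (E \ s) := measure_le_inter_add_sdiff _ _ _
    _ = p₁ (E \ s) := by rw [measure_mono_null inter_subset_right hs1, zero_add]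
    _ ≤ (p₁ + n₂) (E \ s) := by rw [Measure.add_apply]; exact le_self_add
    _ = p₂ (E \ s) := by
      rw [he, Measure.add_apply, measure_mono_null (fun x hx => hx.2) hs2, add_zero]
    _ ≤ p₂ E := measure_mono sdiff_subset

variable [ProperSpace X]

lemma tendsto_integral_thickenedIndicator {Ω : Opens X} {K : Set X} (hK : IsCompact K) {δ : ℝ}
    (hδΩ : Metric.cthickening δ K ⊆ Ω) {μ : Measure X}
    (hμ : ∀ K : Set X, IsCompact K → K ⊆ Ω → μ K < ∞) {δs : ℕ → ℝ} (hδs : ∀ n, 0 < δs n)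
    (hle : ∀ n, δs n ≤ δ) (hlim : Tendsto δs atTop (𝓝 0)) :
    Tendsto (fun n => ∫ x, (thickenedIndicator (hδs n) K x : ℝ) ∂μ) atTop (𝓝 (μ.real K)) := by
  have hL : IsCompact (Metric.cthickening δ K) := hK.cthickening
  have e : μ.real K = ∫ x, K.indicator (fun _ => (1 : ℝ)) x ∂μ := by
    rw [integral_indicator hK.measurableSet]
    simp
  rw [e]
  refine tendsto_integral_of_dominated_convergence
    ((Metric.cthickening δ K).indicator fun _ => (1 : ℝ)) (fun n => ?_) ?_ (fun n => ?_) ?_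
  · exact (NNReal.continuous_coe.comp
      (thickenedIndicator (hδs n) K).continuous).measurable.aestronglyMeasurable
  · rw [integrable_indicator_iff hL.measurableSet]
    exact integrableOn_const (hμ _ hL hδΩ).ne
  · refine ae_of_all _ fun x => ?_
    rw [Real.norm_of_nonneg (NNReal.coe_nonneg _)]
    by_cases hx : x ∈ Metric.cthickening δ K
    · rw [indicator_of_mem hx]
      exact_mod_cast thickenedIndicator_le_one (hδs n) K x
    · rw [thickenedIndicator_zero (hδs n) K fun h => hx
        (Metric.cthickening_mono (hle n) K (Metric.thickening_subset_cthickening _ _ h)),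
        indicator_of_notMem hx, NNReal.coe_zero]
  · refine ae_of_all _ fun x => ?_
    have h1 := (tendsto_pi_nhds.1 (thickenedIndicator_tendsto_indicator_closure hδs hlim K)) x
    rw [hK.isClosed.closure_eq] at h1
    have h2 := (NNReal.continuous_coe.tendsto _).comp h1
    have h3 : ((K.indicator (fun _ => (1 : ℝ≥0)) x : ℝ≥0) : ℝ) = K.indicator (fun _ => (1 : ℝ)) x := by
      by_cases hx : x ∈ K <;> simp [hx]
    rw [← h3]
    exact h2

/-- Measures on `Ω` that are finite on compact sets are determined by Lipschitz test functions. -/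
lemma measure_eq_of_forall_isTest {Ω : Opens X} {μ ν : Measure X}
    (hμ0 : μ (Ω : Set X)ᶜ = 0) (hν0 : ν (Ω : Set X)ᶜ = 0)
    (hμ : ∀ K : Set X, IsCompact K → K ⊆ Ω → μ K < ∞)
    (hν : ∀ K : Set X, IsCompact K → K ⊆ Ω → ν K < ∞)
    (h : ∀ f, IsTest Ω f → ∫ x, f x ∂μ = ∫ x, f x ∂ν) : μ = ν := by
  have hcomp : ∀ K : Set X, IsCompact K → K ⊆ Ω → μ K = ν K := by
    intro K hK hKΩ
    obtain ⟨δ, hδ, hδΩ⟩ := hK.exists_cthickening_subset_open Ω.isOpen hKΩ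
    have hδs : ∀ n : ℕ, 0 < δ / (n + 1) := fun n => by positivity
    have hle : ∀ n : ℕ, δ / (n + 1) ≤ δ := fun n => div_le_self hδ.le (by simp)
    have hlim : Tendsto (fun n : ℕ => δ / ((n : ℝ) + 1)) atTop (𝓝 0) := by
      simpa [div_eq_mul_inv] using tendsto_one_div_add_atTop_nhds_zero_nat.const_mul δ
    have h1 := tendsto_integral_thickenedIndicator hK hδΩ hμ hδs hle hlim
    have h2 := tendsto_integral_thickenedIndicator hK hδΩ hν hδs hle hlim
    have h3 : μ.real K = ν.real K := by
      refine tendsto_nhds_unique h1 (h2.congr fun n => (h _ ?_).symm)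
      refine IsTest.of_exists_lipschitz ⟨_, lipschitzWith_thickenedIndicator (hδs n) K⟩
        hK.cthickening hδΩ (closure_minimal (fun x hx => ?_) Metric.isClosed_cthickening)
      by_contra hx'
      refine hx (NNReal.coe_eq_zero.2 (thickenedIndicator_zero (hδs n) K fun h' => hx' ?_))
      exact Metric.cthickening_mono (hle n) K (Metric.thickening_subset_cthickening _ _ h')
    exact (measureReal_eq_measureReal_iff (hμ K hK hKΩ).ne (hν K hK hKΩ).ne).1 h3
  obtain ⟨K, hK, hKΩ, -, hU⟩ := exists_compact_exhaustion Ω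
  have hnull : ∀ s : Set X, μ (s ∩ (Ω : Set X)ᶜ) = ν (s ∩ (Ω : Set X)ᶜ) := fun s => by
    rw [measure_mono_null inter_subset_right hμ0, measure_mono_null inter_subset_right hν0]
  -- Closed sets form a generating π-system. The cover consists of compact subsets of `Ω`, where the
  -- measures are finite and already compared, and of the complement of `Ω`, null for both.
  refine Measure.ext_of_generateFrom_of_cover (S := {s | IsClosed s})
    (T := insert (Ω : Set X)ᶜ (range K)) ?_ ((countable_range K).insert _) isPiSystem_isClosed
    ?_ ?_ ?_ ?_
  · rw [← borel_eq_generateFrom_isClosed]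
    exact BorelSpace.measurable_eq
  · rw [sUnion_insert, sUnion_range, hU, compl_union_self]
  · rintro _ (rfl | ⟨n, rfl⟩)
    · rw [hμ0]; exact ENNReal.zero_ne_top
    · exact (hμ _ (hK n) (hKΩ n)).ne
  · rintro _ (rfl | ⟨n, rfl⟩) s hs
    · exact hnull s
    · exact hcomp _ ((hK n).inter_left hs) (inter_subset_right.trans (hKΩ n))
  · rintro _ (rfl | ⟨n, rfl⟩)
    · rw [hμ0, hν0]
    · exact hcomp _ (hK n) (hKΩ n)

/-- A signed Radon measure is determined by its integrals of test functions. -/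
lemma SignedRadon.ext_of_integral {Ω : Opens X} {μ ν : SignedRadon Ω}
    (h : ∀ f, IsTest Ω f → μ.integral f = ν.integral f) : μ = ν := by
  -- Equality of signed integrals is rearranged into an equality of sums of positive measures, since
  -- either part may have infinite mass. Mutual singularity then recovers the Jordan parts.
  have he : μ.pos + ν.neg = ν.pos + μ.neg := by
    refine measure_eq_of_forall_isTest (Ω := Ω) ?_ ?_ (fun K hK hKΩ => ?_) (fun K hK hKΩ => ?_)
      fun f hf => ?_
    · rw [Measure.add_apply, μ.pos_compl, ν.neg_compl, add_zero]
    · rw [Measure.add_apply, ν.pos_compl, μ.neg_compl, add_zero]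
    · exact ENNReal.add_lt_top.2 ⟨μ.pos_lt_top K hK hKΩ, ν.neg_lt_top K hK hKΩ⟩
    · exact ENNReal.add_lt_top.2 ⟨ν.pos_lt_top K hK hKΩ, μ.neg_lt_top K hK hKΩ⟩
    · rw [integral_add_measure (hf.integrable μ.pos_lt_top) (hf.integrable ν.neg_lt_top),
        integral_add_measure (hf.integrable ν.pos_lt_top) (hf.integrable μ.neg_lt_top)]
      have := h f hf
      simp only [SignedRadon.integral] at this
      linarith
  have he' : μ.neg + ν.pos = ν.neg + μ.pos := by rw [add_comm, ← he, add_comm]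
  exact SignedRadon.ext
    (le_antisymm (le_of_add_eq_add_of_mutuallySingular μ.mutuallySingular he)
      (le_of_add_eq_add_of_mutuallySingular ν.mutuallySingular he.symm))
    (le_antisymm (le_of_add_eq_add_of_mutuallySingular μ.mutuallySingular.symm he')
      (le_of_add_eq_add_of_mutuallySingular ν.mutuallySingular.symm he'.symm))

/-! ### Gluing -/

/-- The measure equal to `ν (e n)` on the `n`-th piece of the cover. -/
def glue {ι : Type*} (U : ι → Opens X) (e : ℕ → ι) (ν : ι → Measure X) : Measure X :=
  Measure.sum fun n => (ν (e n)).restrict (disjointed (fun k => (U (e k) : Set X)) n)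

variable {ι : Type*} {U : ι → Opens X} {e : ℕ → ι} {ν : ι → Measure X}

lemma measurableSet_piece (U : ι → Opens X) (e : ℕ → ι) (n : ℕ) :
    MeasurableSet (disjointed (fun k => (U (e k) : Set X)) n) :=
  MeasurableSet.disjointed (fun k => (U (e k)).isOpen.measurableSet) n

/-- Inside `U i` the `n`-th piece lies in `U i ⊓ U (e n)`, where `ν (e n)` may be replaced by `ν i`;
countable additivity over the disjoint pieces does the rest. -/
lemma glue_restrict (hcov : ∀ i, (U i : Set X) ⊆ ⋃ n, (U (e n) : Set X))
    (h0 : ∀ i, ν i (U i : Set X)ᶜ = 0)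
    (hc : ∀ i j, (ν i).restrict ((U i ⊓ U j : Opens X) : Set X) =
      (ν j).restrict ((U i ⊓ U j : Opens X) : Set X)) (i : ι) :
    (glue U e ν).restrict (U i : Set X) = ν i := by
  ext E hE
  have hUi := (U i).isOpen.measurableSet
  have hEi := hE.inter hUi
  rw [Measure.restrict_apply hE, glue, Measure.sum_apply _ hEi]
  have h1 : ∀ n, (ν (e n)).restrict (disjointed (fun k => (U (e k) : Set X)) n) (E ∩ U i) =
      ν i (E ∩ U i ∩ disjointed (fun k => (U (e k) : Set X)) n) := by
    intro n
    rw [Measure.restrict_apply hEi]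
    have hm := hEi.inter (measurableSet_piece U e n)
    have hsub : E ∩ U i ∩ disjointed (fun k => (U (e k) : Set X)) n ⊆
        ((U i ⊓ U (e n) : Opens X) : Set X) :=
      fun x hx => ⟨hx.1.2, disjointed_subset _ n hx.2⟩
    have h2 := congrArg (fun m : Measure X =>
      m (E ∩ U i ∩ disjointed (fun k => (U (e k) : Set X)) n)) (hc i (e n))
    simp only [Measure.restrict_apply hm, inter_eq_self_of_subset_left hsub] at h2
    exact h2.symm
  simp only [h1]
  rw [← measure_iUnion (fun a b hab => (disjoint_disjointed _ hab).mono inter_subset_right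
    inter_subset_right) (fun n => hEi.inter (measurableSet_piece U e n)), ← inter_iUnion,
    iUnion_disjointed, inter_eq_self_of_subset_left (inter_subset_right.trans (hcov i))]
  refine le_antisymm (measure_mono inter_subset_left) ?_
  refine (measure_le_inter_add_sdiff (ν i) E (U i)).trans ?_
  have h3 : ν i (E \ U i) = 0 := measure_mono_null (fun x hx => hx.2) (h0 i)
  rw [h3, add_zero]

lemma glue_compl {Ω : Opens X} (hΩ : ∀ i, U i ≤ Ω) : glue U e ν (Ω : Set X)ᶜ = 0 := by
  rw [glue, Measure.sum_apply _ Ω.isOpen.measurableSet.compl]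
  refine ENNReal.tsum_eq_zero.2 fun n => ?_
  rw [Measure.restrict_apply Ω.isOpen.measurableSet.compl]
  refine measure_mono_null ?_ (measure_empty (μ := ν (e n)))
  exact fun x hx => hx.1 (hΩ _ (disjointed_subset _ n hx.2))

lemma glue_mutuallySingular {ν' : ι → Measure X} (h : ∀ i, ν i ⟂ₘ ν' i) :
    glue U e ν ⟂ₘ glue U e ν' := by
  refine Measure.MutuallySingular.sum_left.2 fun n => Measure.MutuallySingular.sum_right.2
    fun k => ?_
  by_cases hnk : n = k
  · subst hnk
    exact (h _).mono Measure.restrict_le_self Measure.restrict_le_self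
  · refine ⟨(disjointed (fun k => (U (e k) : Set X)) n)ᶜ, (measurableSet_piece U e n).compl, ?_, ?_⟩
    · rw [Measure.restrict_apply (measurableSet_piece U e n).compl, compl_inter_self, measure_empty]
    · rw [compl_compl, Measure.restrict_apply (measurableSet_piece U e n),
        (disjoint_disjointed _ hnk).inter_eq, measure_empty]

/-- Near each point of `K` the glued measure is one of the `ν i`, hence locally finite; compactness
does the rest. -/
lemma glue_lt_top {Ω : Opens X} (hΩ : (Ω : Set X) ⊆ ⋃ i, (U i : Set X))
    (hr : ∀ i, (glue U e ν).restrict (U i : Set X) = ν i)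
    (hfin : ∀ i, ∀ K : Set X, IsCompact K → K ⊆ U i → ν i K < ∞) {K : Set X} (hK : IsCompact K)
    (hKΩ : K ⊆ Ω) : glue U e ν K < ∞ := by
  refine hK.measure_lt_top_of_nhdsWithin fun x hx => ?_
  obtain ⟨i, hi⟩ := mem_iUnion.1 (hΩ (hKΩ hx))
  obtain ⟨L, hL, hxL, hLU⟩ := exists_compact_subset (U i).isOpen hi
  refine ⟨L, mem_nhdsWithin_of_mem_nhds (mem_interior_iff_mem_nhds.1 hxL), ?_⟩
  have h1 := hfin i L hL hLU
  rwa [← hr i, Measure.restrict_apply hL.measurableSet, inter_eq_self_of_subset_left hLU] at h1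

lemma SignedRadon.exists_glue {Ω : Opens X} (hΩ : ⨆ i, U i = Ω) (μ : (i : ι) → SignedRadon (U i))
    (hμ : ∀ i j, (μ i).restrict (U i ⊓ U j) inf_le_left = (μ j).restrict (U i ⊓ U j) inf_le_right) :
    ∃ μ' : SignedRadon Ω, ∀ i, μ'.restrict (U i) ((le_iSup U i).trans_eq hΩ) = μ i := by
  rcases isEmpty_or_nonempty ι with hι | ⟨⟨i₀⟩⟩
  · exact ⟨⟨0, 0, Measure.MutuallySingular.zero_left, rfl, rfl, fun _ _ _ => by simp,
      fun _ _ _ => by simp⟩, fun i => hι.elim i⟩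
  have hle : ∀ i, U i ≤ Ω := fun i => (le_iSup U i).trans_eq hΩ
  have hΩ' : (Ω : Set X) ⊆ ⋃ i, (U i : Set X) := by rw [← hΩ, Opens.coe_iSup]
  -- The Lindelöf property gives a countable subcover; inserting `i₀` makes it non-empty, hence the
  -- range of a sequence. Positive and negative parts are then glued separately.
  obtain ⟨T, hT, hTU⟩ := isOpen_iUnion_countable (fun i => (U i : Set X)) fun i => (U i).isOpen
  obtain ⟨e, he⟩ := (hT.insert i₀).exists_eq_range (insert_nonempty i₀ T)
  have hcov : ∀ i, (U i : Set X) ⊆ ⋃ n, (U (e n) : Set X) := by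
    intro i x hx
    have hx' : x ∈ ⋃ i ∈ T, (U i : Set X) := hTU ▸ mem_iUnion.2 ⟨i, hx⟩
    obtain ⟨j, hj, hxj⟩ := mem_iUnion₂.1 hx'
    obtain ⟨n, rfl⟩ : j ∈ range e := he ▸ mem_insert_of_mem _ hj
    exact mem_iUnion.2 ⟨n, hxj⟩
  have hpos := glue_restrict hcov (fun i => (μ i).pos_compl)
    fun i j => congrArg SignedRadon.pos (hμ i j)
  have hneg := glue_restrict hcov (fun i => (μ i).neg_compl)
    fun i j => congrArg SignedRadon.neg (hμ i j)
  exact ⟨⟨glue U e fun i => (μ i).pos, glue U e fun i => (μ i).neg,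
    glue_mutuallySingular fun i => (μ i).mutuallySingular, glue_compl hle, glue_compl hle,
    fun K hK hKΩ => glue_lt_top hΩ' hpos (fun i => (μ i).pos_lt_top) hK hKΩ,
    fun K hK hKΩ => glue_lt_top hΩ' hneg (fun i => (μ i).neg_lt_top) hK hKΩ⟩,
    fun i => SignedRadon.ext (hpos i) (hneg i)⟩

end Radon

/-! ## From local to global -/

section LocalToGlobal

variable {X : Type*} [MetricSpace X] [MeasurableSpace X] [BorelSpace X] [ProperSpace X]
  {m : Measure X} [IsFiniteMeasureOnCompacts m] {p₀ p q : ℝ} {Ω : Opens X} {h g : X → ℝ}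

lemma eq_of_mem_divergence (hconvex : IsInfStrictlyConvex m p₀) (hp₀ : 1 < p₀) (hp : 0 < p)
    (hg : MemSobolevLocOn m p₀ Ω g) {μ ν : SignedRadon Ω} (hμ : μ ∈ divergence m p₀ p Ω h g)
    (hν : ν ∈ divergence m p₀ p Ω h g) : μ = ν := by
  rw [mem_divergence_iff hconvex hp₀ hp hg] at hμ hν
  exact SignedRadon.ext_of_integral fun f hf => by rw [hμ f hf, hν f hf]

lemma restrict_mem_divergence (hconvex : IsInfStrictlyConvex m p₀) (hp₀ : 1 < p₀) (hp : 0 < p)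
    (hg : MemSobolevLocOn m p₀ Ω g) {U : Opens X} (hU : U ≤ Ω) {μ : SignedRadon Ω}
    (hμ : μ ∈ divergence m p₀ p Ω h g) : μ.restrict U hU ∈ divergence m p₀ p U h g := by
  rw [mem_divergence_iff hconvex hp₀ hp hg] at hμ
  rw [mem_divergence_iff hconvex hp₀ hp (hg.mono hU)]
  intro f hf
  rw [μ.integral_restrict hU hf, hμ f (hf.mono hU), divFunctional_restrict hp₀ hp hg hU hf]

/-- A test function supported in `U ∪ V` splits into test functions supported in `U` and `V`. -/
lemma IsTest.exists_split {f : X → ℝ} {U V : Opens X} (hf : IsTest (U ⊔ V) f) :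
    ∃ f₁ f₂, IsTest U f₁ ∧ IsTest V f₂ ∧ f = fun x => f₁ x + f₂ x := by
  have hK := hf.hasCompactSupport.isCompact
  have hKV : tsupport f \ V ⊆ U := fun x hx =>
    (hf.tsupport_subset hx.1).resolve_right hx.2
  -- `χ` equals one near the part of the support lying outside `V`, so `f - χ f` is supported in
  -- `V`.
  obtain ⟨χ, hχ, W, hW, hKW, h1⟩ := exists_cutoff_nhds (hK.diff V.isOpen) hKV
  have hf₁ := hχ.mul_isTest hf
  have hlip := (IsTest.mono le_sup_left hf₁ : IsTest (U ⊔ V) _)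
  refine ⟨_, fun x => f x - χ x * f x, hf₁, ?_, by funext x; ring⟩
  have hsub := (hf.sub hlip)
  have hsupp : tsupport (fun x => f x - χ x * f x) ⊆ tsupport f \ W := by
    refine closure_minimal (fun x hx => ⟨?_, fun hxW => hx ?_⟩)
      ((isClosed_tsupport f).sdiff hW)
    · refine subset_tsupport f fun h0 => hx ?_
      simp only [h0, mul_zero, sub_zero]
    · simp only [h1 x hxW, one_mul, sub_self]
  refine IsTest.of_exists_lipschitz hsub.lipschitz (hK.diff hW) (fun x hx => ?_) hsupp
  by_contra hxV
  exact hx.2 (hKW ⟨hx.1, hxV⟩)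

/-- Both sides of the defining equation are additive in `f`, so it is enough to know it on each `U
i`: the compact support meets a finite subcover, and induction splits off one member at a time. -/
lemma mem_divergence_of_forall_restrict {ι : Type*} {U : ι → Opens X}
    (hconvex : IsInfStrictlyConvex m p₀) (hp₀ : 1 < p₀) (hp : p₀ ≤ p)
    (hpq : p.HolderConjugate q) (hg : MemSobolevLocOn m p Ω g) (hh : MemLpLoc m q Ω h)
    (hΩ : ⨆ i, U i = Ω) (hU : ∀ i, U i ≤ Ω) {μ : SignedRadon Ω}
    (hμ : ∀ i, μ.restrict (U i) (hU i) ∈ divergence m p₀ p (U i) h g) :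
    μ ∈ divergence m p₀ p Ω h g := by
  have hp0 : 0 < p := by linarith
  have hg₀ := hg.mono_exponent hp₀ hp
  have key : ∀ s : Finset ι, ∀ f, IsTest (⨆ i ∈ s, U i) f →
      μ.integral f = -divFunctional m p₀ p Ω h g f := by
    classical
    intro s
    induction s using Finset.induction_on with
    | empty =>
      intro f hf
      have hf0 : f = fun _ => 0 := by
        funext x
        refine image_eq_zero_of_notMem_tsupport fun hx => ?_
        simpa using hf.tsupport_subset hx
      have hT : IsTest Ω (fun _ : X => (0 : ℝ)) :=
        hf0 ▸ hf.mono (by simp)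
      -- Additivity applied to `0 + 0` shows that the functional vanishes at zero.
      have h1 := divFunctional_add hconvex hp₀ hp hpq hg hh hT hT
      simp only [add_zero] at h1
      have h2 : divFunctional m p₀ p Ω h g (fun _ => 0) = 0 := by linarith
      rw [hf0, h2]
      simp [SignedRadon.integral]
    | insert i s _ ih =>
      intro f hf
      rw [Finset.iSup_insert] at hf
      obtain ⟨f₁, f₂, hf₁, hf₂, rfl⟩ := hf.exists_split
      have hs : ⨆ i ∈ s, U i ≤ Ω := iSup₂_le fun i _ => hU i
      have h1 := (mem_divergence_iff hconvex hp₀ hp0 (hg₀.mono (hU i))).1 (hμ i) f₁ hf₁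
      rw [μ.integral_restrict (hU i) hf₁, divFunctional_restrict hp₀ hp0 hg₀ (hU i) hf₁] at h1
      rw [μ.integral_add (hf₁.mono (hU i)) (hf₂.mono hs), h1, ih f₂ hf₂,
        divFunctional_add hconvex hp₀ hp hpq hg hh (hf₁.mono (hU i)) (hf₂.mono hs)]
      ring
  rw [mem_divergence_iff hconvex hp₀ hp0 hg₀]
  intro f hf
  obtain ⟨s, hs⟩ := hf.hasCompactSupport.isCompact.elim_finite_subcover
    (fun i => (U i : Set X)) (fun i => (U i).isOpen) (by
      rw [← Opens.coe_iSup, hΩ]; exact hf.tsupport_subset)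
  refine key s f ⟨hf.lipschitz, hf.hasCompactSupport, hs.trans fun x hx => ?_⟩
  simpa using hx

end LocalToGlobal

end MetricDivergence

end

theorem mainTheorem10 {X : Type*} [MetricSpace X] [CompleteSpace X]
    [TopologicalSpace.SeparableSpace X] [MeasurableSpace X] [BorelSpace X]
    (m : Measure X) (hm : IsDoubling m)
    (p₀ : ℝ) (hp₀ : 1 < p₀) (hPoincare : SupportsPoincare m p₀)
    (hconvex : IsInfStrictlyConvex m p₀)
    {ι : Type*} (Ωi : ι → Opens X) (Ω : Opens X) (hΩ : ⨆ i, Ωi i = Ω)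
    (p q : ℝ) (hp : p₀ ≤ p) (hpq : p.HolderConjugate q)
    (g h : X → ℝ) (hg : MemSobolevLocOn m p Ω g) (hh : MemLpLoc m q Ω h)
    (hdiv : ∀ i, InDomainDiv m p₀ p (Ωi i) h g) :
    (∀ i, ∃! μ, μ ∈ divergence m p₀ p (Ωi i) h g) ∧
    ∀ μi : (i : ι) → SignedRadon (Ωi i), (∀ i, μi i ∈ divergence m p₀ p (Ωi i) h g) →
      (∀ i j, (μi i).restrict (Ωi i ⊓ Ωi j) inf_le_left =
        (μi j).restrict (Ωi i ⊓ Ωi j) inf_le_right) ∧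
      InDomainDiv m p₀ p Ω h g ∧
      (∃! μ : SignedRadon Ω, ∀ i, μ.restrict (Ωi i) ((le_iSup Ωi i).trans_eq hΩ) = μi i) ∧
      ∀ μ : SignedRadon Ω, (∀ i, μ.restrict (Ωi i) ((le_iSup Ωi i).trans_eq hΩ) = μi i) →
        divergence m p₀ p Ω h g = {μ} := by
  have := hm.properSpace
  have := hm.isFiniteMeasureOnCompacts
  have hp0 : 0 < p := by linarith
  have hle : ∀ i, Ωi i ≤ Ω := fun i => (le_iSup Ωi i).trans_eq hΩ
  have hg₀ := hg.mono_exponent hp₀ hp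
  have hgi : ∀ i, MemSobolevLocOn m p₀ (Ωi i) g := fun i => hg₀.mono (hle i)
  refine ⟨fun i => ?_, fun μi hμi => ?_⟩
  · obtain ⟨μ, hμ⟩ := hdiv i
    exact ⟨μ, hμ, fun ν hν => eq_of_mem_divergence hconvex hp₀ hp0 (hgi i) hν hμ⟩
  -- Both restrictions are divergences on the intersection, where there is at most one.
  have hcompat : ∀ i j, (μi i).restrict (Ωi i ⊓ Ωi j) inf_le_left =
      (μi j).restrict (Ωi i ⊓ Ωi j) inf_le_right := fun i j =>
    eq_of_mem_divergence hconvex hp₀ hp0 ((hgi i).mono inf_le_left)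
      (restrict_mem_divergence hconvex hp₀ hp0 (hgi i) inf_le_left (hμi i))
      (restrict_mem_divergence hconvex hp₀ hp0 (hgi j) inf_le_right (hμi j))
  have hmem : ∀ μ : SignedRadon Ω, (∀ i, μ.restrict (Ωi i) (hle i) = μi i) →
      μ ∈ divergence m p₀ p Ω h g := fun μ hμ =>
    mem_divergence_of_forall_restrict hconvex hp₀ hp hpq hg hh hΩ hle fun i => by
      rw [hμ i]
      exact hμi i
  obtain ⟨μ, hμ⟩ := SignedRadon.exists_glue hΩ μi hcompat
  refine ⟨hcompat, ⟨μ, hmem μ hμ⟩, ⟨μ, hμ, fun ν hν =>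
    eq_of_mem_divergence hconvex hp₀ hp0 hg₀ (hmem ν hν) (hmem μ hμ)⟩, fun ν hν => ?_⟩
  exact eq_singleton_iff_unique_mem.2 ⟨hmem ν hν, fun ν' hν' =>
    eq_of_mem_divergence hconvex hp₀ hp0 hg₀ hν' (hmem ν hν)⟩
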